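/- Let $M$ be a $C^\infty$ Riemannian manifold of dimension $n\ge 2$, and give $M\times\mathbb R$ the product metric $\langle\,,\rangle_M+dt^2$. Let $\Sigma$ be an (immersed) oriented smooth hypersurface of $M\times\mathbb R$ with unit normal field $N$, shape operator $AX=-\overline\nabla_XN$, height function $\xi=\pi_{\mathbb R}|_\Sigma$ and angle function $\theta=\langle N,\partial_t\rangle$. Suppose that $\Sigma$ is a *vertical helicoid*: $\theta^2\neq 1$ everywhere, $\theta$ is nonconstant, every horizontal section $\Sigma_t=\Sigma\cap(M\times\{t\})$ is a minimal hypersurface of $M\times\{t\}$, and $\langle A\nabla\xi,\nabla\xi\rangle=0$ on $\Sigma$. Suppose moreover that $\theta$ vanishes nowhere. (1) Assume that each horizontal section $\Sigma_t$ is totally geodesic in $M\times\{t\}$. Then for every $x_0\in\Sigma$, with $t_0=\xi(x_0)$, there exist a connected open set $\Sigma'\ni x_0$ of $\Sigma$ (embedded injectively in $M\times\mathbb R$, with $\pi_M(\Sigma')$ open in $M$), an $\epsilon>0$, an embedded hypersurface $\mathfrak L_0$ of $M$ with $\mathfrak L_0\subset\pi_M(\Sigma')$, and a local one-parameter group of isometries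 $$\Gamma_t:\pi_M(\Sigma')\to\Gamma_t(\pi_M(\Sigma'))\subset M,\qquad t\in(-\epsilon,\epsilon)$$ (smooth in $(t,p)$, each $\Gamma_t$ injective and preserving the Riemannian metric, $\Gamma_0=\mathrm{id}$, and $\Gamma_{s+t}(p)=\Gamma_s(\Gamma_t(p))$ whenever $s,t,s+t\in(-\epsilon,\epsilon)$ and $p,\Gamma_t(p)\in\pi_M(\Sigma')$), such that, up to the vertical translation by $t_0$, $\Sigma'$ is the $1$-pitched twisting of $\mathfrak L_0$ determined by $\{\Gamma_t\}$, that is, $$\Sigma'=\{(\Gamma_t(p),\,t_0+t)\;;\;p\in\mathfrak L_0,\ t\in(-\epsilon,\epsilon)\}.$$ (2) If $n=2$, then (without assuming that the horizontal sections are totally geodesic) the conclusion of (1) holds for every $x_0\in\Sigma$, with $\mathfrak L_0$ the trace of a nonconstant geodesic $\gamma:(-\delta,\delta)\to M$. -/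

import Mathlib

open Set Bundle
open scoped Manifold ContDiff

noncomputable section

namespace VerticalHelicoid

section Connection

variable {E : Type*} [NormedAddCommGroup E] [NormedSpace ℝ E]
  {H : Type*} [TopologicalSpace H] (I : ModelWithCorners ℝ E H)
  {P : Type*} [TopologicalSpace P] [ChartedSpace H P] [IsManifold I 1 P]
  {E' : Type*} [NormedAddCommGroup E'] [NormedSpace ℝ E']
  {H' : Type*} [TopologicalSpace H'] (J : ModelWithCorners ℝ E' H')
  {S : Type*} [TopologicalSpace S] [ChartedSpace H' S]

/-- The component `g(∂_u, ∂_w)` of a metric `g` in the preferred chart at `p₀`, as a function of the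
coordinates. Here `∂_u` is the coordinate vector field of that chart with constant components `u`,
given by the trivialization of the tangent bundle that the chart induces. -/
def coordMetric (g : ∀ p : P, TangentSpace I p → TangentSpace I p → ℝ) (p₀ : P) (u w : E) :
    E → ℝ := fun y =>
  g ((extChartAt I p₀).symm y)
    ((trivializationAt E (TangentSpace I : P → Type _) p₀).symmL ℝ ((extChartAt I p₀).symm y) u)
    ((trivializationAt E (TangentSpace I : P → Type _) p₀).symmL ℝ ((extChartAt I p₀).symm y) w)

/-- The Christoffel symbol of the first kind `⟨∇_{∂_u} ∂_w, ∂_z⟩` of the Levi-Civita connection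
of `g`, at the point `p₀`, in the preferred chart at `p₀`. -/
def christoffel (g : ∀ p : P, TangentSpace I p → TangentSpace I p → ℝ) (p₀ : P) (u w z : E) : ℝ :=
  (fderiv ℝ (coordMetric I g p₀ w z) (extChartAt I p₀ p₀) u
    + fderiv ℝ (coordMetric I g p₀ u z) (extChartAt I p₀ p₀) w
    - fderiv ℝ (coordMetric I g p₀ u w) (extChartAt I p₀ p₀) z) / 2

/-- `⟨∇_v V, z⟩`, where `∇` is the Levi-Civita connection of the metric `g` on `P`, `V` is a vector
field along the map `f : S → P`, `v` is tangent to `S` at `x` and `z` is tangent to `P` at `f x`: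
the derivative of the components of `V` plus the Christoffel term, in the preferred chart at
`f x`. (The tangent space at `f x` is identified with `E` by that very chart.) -/
def covAlong (g : ∀ p : P, TangentSpace I p → TangentSpace I p → ℝ) (f : S → P)
    (V : ∀ y : S, TangentSpace I (f y)) (x : S) (v : TangentSpace J x)
    (z : TangentSpace I (f x)) : ℝ :=
  g (f x)
    (mfderiv J 𝓘(ℝ, E)
      (fun y => (trivializationAt E (TangentSpace I : P → Type _) (f x) ⟨f y, V y⟩).2) x v) z
    + christoffel I g (f x) (mfderiv J I f x v) (V x) z

/-- `⟨A v, w⟩` for the shape operator `A X = -∇_X N` of an immersed hypersurface `f : S → (P, g)`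
with unit normal field `N`. -/
def shapeForm (g : ∀ p : P, TangentSpace I p → TangentSpace I p → ℝ) (f : S → P)
    (N : ∀ y : S, TangentSpace I (f y)) (x : S) (v w : TangentSpace J x) : ℝ :=
  - covAlong I J g f N x v (mfderiv J I f x w)

end Connection

section Product

variable {n : ℕ} {M : Type*} [TopologicalSpace M] [ChartedSpace (EuclideanSpace ℝ (Fin n)) M]
  [IsManifold (𝓡 n) ∞ M] [RiemannianBundle (fun p : M => TangentSpace (𝓡 n) p)]
  {S : Type*} [TopologicalSpace S] [ChartedSpace (EuclideanSpace ℝ (Fin n)) S]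

/-- The Riemannian metric of `M`. -/
def metric (p : M) (v w : TangentSpace (𝓡 n) p) : ℝ := inner ℝ v w

/-- The product metric `⟨ , ⟩_M + dt²` of `M × ℝ`. -/
def prodMetric (q : M × ℝ) (v w : TangentSpace ((𝓡 n).prod 𝓘(ℝ, ℝ)) q) : ℝ :=
  metric q.1 (v.1 : TangentSpace (𝓡 n) q.1) (w.1 : TangentSpace (𝓡 n) q.1)
    + (v.2 : ℝ) * (w.2 : ℝ)

/-- The vertical field `∂_t` of `M × ℝ`. -/
def vertical (q : M × ℝ) : TangentSpace ((𝓡 n).prod 𝓘(ℝ, ℝ)) q :=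
  ((0, 1) : EuclideanSpace ℝ (Fin n) × ℝ)

/-- `f : S → M × ℝ` is a smooth immersed hypersurface, oriented by the smooth unit normal field
`N` (a vector field along `f`). The manifold `S` has dimension `n = dim M`. -/
structure IsOrientedHypersurface (f : S → M × ℝ)
    (N : ∀ x : S, TangentSpace ((𝓡 n).prod 𝓘(ℝ, ℝ)) (f x)) : Prop where
  smooth : ContMDiff (𝓡 n) ((𝓡 n).prod 𝓘(ℝ, ℝ)) ∞ f
  immersion : ∀ x, Function.Injective (mfderiv (𝓡 n) ((𝓡 n).prod 𝓘(ℝ, ℝ)) f x)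
  normal_smooth : ContMDiff (𝓡 n) ((𝓡 n).prod 𝓘(ℝ, ℝ)).tangent ∞
    (fun x => (⟨f x, N x⟩ : TangentBundle ((𝓡 n).prod 𝓘(ℝ, ℝ)) (M × ℝ)))
  normal_unit : ∀ x, prodMetric (f x) (N x) (N x) = 1
  normal_orthogonal : ∀ x (v : TangentSpace (𝓡 n) x),
    prodMetric (f x) (N x) (mfderiv (𝓡 n) ((𝓡 n).prod 𝓘(ℝ, ℝ)) f x v) = 0

/-- The angle function `θ = ⟨N, ∂_t⟩`. -/
def angle (f : S → M × ℝ) (N : ∀ x : S, TangentSpace ((𝓡 n).prod 𝓘(ℝ, ℝ)) (f x)) (x : S) : ℝ :=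
  prodMetric (f x) (N x) (vertical (f x))

/-- The projection `π_M ∘ f` of the hypersurface to `M`. -/
def proj (f : S → M × ℝ) (x : S) : M := (f x).1

/-- The height function `ξ = π_ℝ ∘ f`. -/
def height (f : S → M × ℝ) (x : S) : ℝ := (f x).2

/-- The differential `dξ_x(v)` of the height function. -/
def dheight (f : S → M × ℝ) (x : S) (v : TangentSpace (𝓡 n) x) : ℝ :=
  mfderiv (𝓡 n) 𝓘(ℝ, ℝ) (height f) x v

/-- `v` is the gradient `∇ξ` of the height function at `x`, for the metric that `f` induces. -/
def IsHeightGradient (f : S → M × ℝ) (x : S) (v : TangentSpace (𝓡 n) x) : Prop :=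
  ∀ w : TangentSpace (𝓡 n) x,
    prodMetric (f x) (mfderiv (𝓡 n) ((𝓡 n).prod 𝓘(ℝ, ℝ)) f x v)
      (mfderiv (𝓡 n) ((𝓡 n).prod 𝓘(ℝ, ℝ)) f x w) = dheight f x w

/-- The unit normal `η = -(1 - θ²)^(-1/2) (N - θ ∂_t)` of the horizontal sections
`Σ_t = {ξ = t}`; it is horizontal, hence a vector field along `π_M ∘ f`. -/
def sectionNormal (f : S → M × ℝ) (N : ∀ x : S, TangentSpace ((𝓡 n).prod 𝓘(ℝ, ℝ)) (f x))
    (x : S) : TangentSpace (𝓡 n) (proj f x) :=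
  (-(√(1 - angle f N x ^ 2))⁻¹) •
    ((N x - angle f N x • vertical (f x)).1 : TangentSpace (𝓡 n) (proj f x))

/-- `⟨A_η v, w⟩` for the shape operator of the horizontal section through `x`, as a hypersurface of
`M × {t}`, which is identified with `M`. It is only used for `v`, `w` in the tangent space
`ker dξ_x` of the section; for such `v` the derivative `∇_v η` only sees `η` along the section. -/
def sectionShapeForm (f : S → M × ℝ)
    (N : ∀ x : S, TangentSpace ((𝓡 n).prod 𝓘(ℝ, ℝ)) (f x)) (x : S)
    (v w : TangentSpace (𝓡 n) x) : ℝ :=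
  shapeForm (𝓡 n) (𝓡 n) metric (proj f) (sectionNormal f N) x v w

/-- Every horizontal section `Σ_t` is totally geodesic in `M × {t}`. -/
def TotallyGeodesicSections (f : S → M × ℝ)
    (N : ∀ x : S, TangentSpace ((𝓡 n).prod 𝓘(ℝ, ℝ)) (f x)) : Prop :=
  ∀ (x : S) (v w : TangentSpace (𝓡 n) x), dheight f x v = 0 → dheight f x w = 0 →
    sectionShapeForm f N x v w = 0

/-- Every horizontal section `Σ_t` is minimal in `M × {t}`: the trace of its shape operator,
computed in any orthonormal basis of its tangent space, vanishes. -/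
def MinimalSections (f : S → M × ℝ)
    (N : ∀ x : S, TangentSpace ((𝓡 n).prod 𝓘(ℝ, ℝ)) (f x)) : Prop :=
  ∀ (x : S) (e : Fin (n - 1) → TangentSpace (𝓡 n) x),
    (∀ i, dheight f x (e i) = 0) →
    (∀ i j, prodMetric (f x) (mfderiv (𝓡 n) ((𝓡 n).prod 𝓘(ℝ, ℝ)) f x (e i))
      (mfderiv (𝓡 n) ((𝓡 n).prod 𝓘(ℝ, ℝ)) f x (e j)) = if i = j then 1 else 0) →
    ∑ i, sectionShapeForm f N x (e i) (e i) = 0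

/-- Vertical helicoids in `M × ℝ`. -/
structure IsVerticalHelicoid (f : S → M × ℝ)
    (N : ∀ x : S, TangentSpace ((𝓡 n).prod 𝓘(ℝ, ℝ)) (f x)) : Prop where
  hypersurface : IsOrientedHypersurface f N
  no_horizontal_point : ∀ x, angle f N x ^ 2 ≠ 1
  angle_nonconstant : ∃ x y, angle f N x ≠ angle f N y
  minimal_sections : MinimalSections f N
  asymptotic : ∀ (x : S) (v : TangentSpace (𝓡 n) x), IsHeightGradient f x v →
    shapeForm ((𝓡 n).prod 𝓘(ℝ, ℝ)) (𝓡 n) prodMetric f N x v v = 0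

/-- `L` is an embedded smooth hypersurface of `M`: locally a regular level set. -/
def IsHypersurface (L : Set M) : Prop :=
  ∀ p ∈ L, ∃ (U : Set M) (F : M → ℝ), IsOpen U ∧ p ∈ U ∧ ContMDiffOn (𝓡 n) 𝓘(ℝ, ℝ) ∞ F U ∧
    (∀ q ∈ U, mfderiv (𝓡 n) 𝓘(ℝ, ℝ) F q ≠ 0) ∧ L ∩ U = {q ∈ U | F q = 0}

/-- `Γ_t`, `t ∈ (-ε, ε)`, is a (local) one-parameter group of isometries, each of them defined on the
open set `Ω` and mapping it isometrically (in the Riemannian sense) onto its image. -/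
structure IsLocalIsometryGroup (Ω : Set M) (ε : ℝ) (Γ : ℝ → M → M) : Prop where
  isOpen : IsOpen Ω
  smooth : ContMDiffOn (𝓘(ℝ, ℝ).prod (𝓡 n)) (𝓡 n) ∞ (fun q : ℝ × M => Γ q.1 q.2)
    (Ioo (-ε) ε ×ˢ Ω)
  injOn : ∀ t ∈ Ioo (-ε) ε, InjOn (Γ t) Ω
  isometry : ∀ t ∈ Ioo (-ε) ε, ∀ p ∈ Ω, ∀ v w : TangentSpace (𝓡 n) p,
    metric (Γ t p) (mfderiv (𝓡 n) (𝓡 n) (Γ t) p v) (mfderiv (𝓡 n) (𝓡 n) (Γ t) p w)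
      = metric p v w
  zero : ∀ p ∈ Ω, Γ 0 p = p
  add : ∀ s ∈ Ioo (-ε) ε, ∀ t ∈ Ioo (-ε) ε, s + t ∈ Ioo (-ε) ε →
    ∀ p ∈ Ω, Γ t p ∈ Ω → Γ (s + t) p = Γ s (Γ t p)

/-- The `a`-pitched twisting of `L` determined by `Γ_s`, `s ∈ (-ε, ε)`, starting at height `t₀`. -/
def pitchedTwisting (a t₀ : ℝ) (L : Set M) (ε : ℝ) (Γ : ℝ → M → M) : Set (M × ℝ) :=
  {q | ∃ p ∈ L, ∃ s ∈ Ioo (-ε) ε, q = (Γ s p, t₀ + a * s)}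

/-- The connected open piece `S'` of the hypersurface `f : S → M × ℝ` is the `1`-pitched twisting,
starting at height `t₀`, of the hypersurface `L ⊆ π_M(S')` of `M` determined by a one-parameter
group of isometries `Γ_t : π_M(S') → Γ_t(π_M(S'))`. -/
structure IsTwistingPiece (f : S → M × ℝ) (S' : Set S) (t₀ : ℝ) (L : Set M) (ε : ℝ)
    (Γ : ℝ → M → M) : Prop where
  isOpen : IsOpen S'
  isConnected : IsConnected S'
  injOn : InjOn f S'
  eps_pos : 0 < ε
  hypersurface : IsHypersurface (n := n) L
  subset : L ⊆ proj f '' S'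
  group : IsLocalIsometryGroup (n := n) (proj f '' S') ε Γ
  eq_twisting : f '' S' = pitchedTwisting 1 t₀ L ε Γ

/-- The velocity `γ'(t)` of a curve in `M`. -/
def velocity (γ : ℝ → M) (t : ℝ) : TangentSpace (𝓡 n) (γ t) :=
  mfderiv 𝓘(ℝ, ℝ) (𝓡 n) γ t (1 : ℝ)

/-- `γ` is a (nonconstant) geodesic of `M` on the interval `(-δ, δ)`: `∇_{γ'} γ' = 0`. -/
structure IsGeodesic (γ : ℝ → M) (δ : ℝ) : Prop where
  smooth : ContMDiffOn 𝓘(ℝ, ℝ) (𝓡 n) ∞ γ (Ioo (-δ) δ)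
  velocity_ne_zero : ∀ t ∈ Ioo (-δ) δ, velocity (n := n) γ t ≠ 0
  geodesic : ∀ t ∈ Ioo (-δ) δ, ∀ z : TangentSpace (𝓡 n) (γ t),
    covAlong (𝓡 n) 𝓘(ℝ, ℝ) metric γ (velocity γ) t (1 : ℝ) z = 0

end Product

end VerticalHelicoid

end

/-! Since `θ` does not vanish, the hypersurface is locally the graph of a function `u` on `M`. Let
`X` be the multiple of the gradient of `u` with `du(X) = 1`, so that `g(X, ·) = ρ du` with `ρ =
|X|²`; then `(L_X g)(X, ·) = X(ρ) du`. As `ρ` is a function of `θ`, the condition `⟨A∇ξ, ∇ξ⟩ = 0`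
says that `X(ρ) = 0`. On vectors tangent to the level sets of `u`, `L_X g` is a multiple of their
second fundamental form, which vanishes when the horizontal sections are totally geodesic. So `X`
is a Killing field, and because `du(X) = 1` its flow moves the level set through a point at unit
vertical speed: the graph is the `1`-pitched twisting of that level set. If `n = 2`, minimal
sections are totally geodesic, and their unit speed parametrizations project to geodesics of `M`. -/

noncomputable section

namespace VerticalHelicoid

universe u

section Flow

open Metric Filter Topology

variable {E F : Type*} [NormedAddCommGroup E] [NormedSpace ℝ E]
  [NormedAddCommGroup F] [NormedSpace ℝ F]

theorem exists_openPartialHomeomorph_contDiffOn_symm [CompleteSpace E] {f : E → F} {s : Set E}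
    (hs : IsOpen s) (hf : ContDiffOn ℝ ∞ f s) {a : E} (ha : a ∈ s) {e : E ≃L[ℝ] F}
    (he : HasFDerivAt f (e : E →L[ℝ] F) a) :
    ∃ h : OpenPartialHomeomorph E F, a ∈ h.source ∧ h.source ⊆ s ∧ (∀ x, h x = f x) ∧
      ContDiffOn ℝ ∞ h.symm h.target := by
  have hfa : ContDiffAt ℝ ∞ f a := hf.contDiffAt (hs.mem_nhds ha)
  set V := s ∩ (fderiv ℝ f) ⁻¹' range ((↑) : (E ≃L[ℝ] F) → E →L[ℝ] F)
  have hV : IsOpen V := (hf.continuousOn_fderiv_of_isOpen hs (by simp)).isOpen_inter_preimage hs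
    ContinuousLinearEquiv.isOpen
  let h := (hfa.toOpenPartialHomeomorph f he (by simp)).restrOpen V hV
  refine ⟨h, ⟨hfa.mem_toOpenPartialHomeomorph_source he (by simp), ha, e, he.fderiv.symm⟩,
    fun x hx => hx.2.1, fun _ => rfl, fun z hz => ?_⟩
  obtain ⟨-, hzs, e', he'⟩ := h.map_target hz
  have hfz : ContDiffAt ℝ ∞ f (h.symm z) := hf.contDiffAt (hs.mem_nhds hzs)
  refine (h.contDiffAt_symm (f₀' := e') hz ?_ hfz).contDiffWithinAt
  exact he' ▸ (hfz.differentiableAt (by simp)).hasFDerivAt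

set_option synthInstance.maxHeartbeats 200000 in
-- instance search in `C(K, E →L[ℝ] F)` is slow
/-- The pointwise application `(A, h) ↦ (k ↦ A k (h k))` of a continuous family of linear maps. -/
def familyApply (K : Type*) [TopologicalSpace K] [CompactSpace K] (E F : Type*)
    [NormedAddCommGroup E] [NormedSpace ℝ E] [NormedAddCommGroup F] [NormedSpace ℝ F] :
    C(K, E →L[ℝ] F) →L[ℝ] C(K, E) →L[ℝ] C(K, F) :=
  LinearMap.mkContinuous₂
    (LinearMap.mk₂ ℝ (fun (A : C(K, E →L[ℝ] F)) (h : C(K, E)) =>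
      (⟨fun k => A k (h k), by fun_prop⟩ : C(K, F)))
      (fun _ _ _ => by ext; simp) (fun _ _ _ => by ext; simp) (fun _ _ _ => by ext; simp)
      (fun _ _ _ => by ext; simp)) 1
    (fun A h => by
      refine (ContinuousMap.norm_le _ (by positivity)).2 fun k => ?_
      calc ‖A k (h k)‖ ≤ ‖A k‖ * ‖h k‖ := (A k).le_opNorm _
        _ ≤ ‖A‖ * ‖h‖ := by gcongr <;> exact ContinuousMap.norm_coe_le_norm _ _
        _ = 1 * ‖A‖ * ‖h‖ := by ring)

/-- Constant maps, as a continuous linear map. -/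
def constCLM (K : Type*) [TopologicalSpace K] [CompactSpace K] (E : Type*)
    [NormedAddCommGroup E] [NormedSpace ℝ E] : E →L[ℝ] C(K, E) :=
  LinearMap.mkContinuous
    { toFun := fun y => ContinuousMap.const K y
      map_add' := fun _ _ => rfl
      map_smul' := fun _ _ => rfl } 1
    (fun y => (ContinuousMap.norm_le _ (by positivity)).2 fun _ => (one_mul ‖y‖).ge)

@[simp] theorem constCLM_apply {K : Type*} [TopologicalSpace K] [CompactSpace K] (y : E) (k : K) :
    constCLM K E y k = y := rfl

set_option synthInstance.maxHeartbeats 200000 in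
-- instance search in `C(K, E →L[ℝ] F)` is slow
theorem hasFDerivAt_postcomp {K : Type*} [TopologicalSpace K] [CompactSpace K] (X : C(E, F))
    (X' : C(E, E →L[ℝ] F)) (hX : ∀ x, HasFDerivAt X (X' x) x) (α : C(K, E)) :
    HasFDerivAt (fun α : C(K, E) => X.comp α) (familyApply K E F (X'.comp α)) α := by
  rw [hasFDerivAt_iff_isLittleO_nhds_zero, Asymptotics.isLittleO_iff]
  intro ε hε
  have hX' : ContinuousAt (fun α : C(K, E) => X'.comp α) α :=
    (ContinuousMap.continuous_postcomp X').continuousAt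
  obtain ⟨δ, hδ, hcont⟩ :=
    (Metric.continuousAt_iff (α := C(K, E)) (β := C(K, E →L[ℝ] F))).1 hX' ε hε
  -- A translate of `α` by a constant passes through any given point, so continuity of `X' ∘ ·`
  -- at `α` controls `X'` near the points `α k` uniformly in `k`.
  have hunif : ∀ k, ∀ x, ‖x - α k‖ < δ → ‖X' x - X' (α k)‖ ≤ ε := by
    intro k x hx
    have hdist : dist (α + constCLM K E (x - α k)) α < δ := by
      rw [dist_eq_norm, add_sub_cancel_left, ContinuousMap.norm_lt_iff _ hδ]
      exact fun _ => hx
    have := (ContinuousMap.dist_apply_le_dist k).trans_lt (hcont hdist)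
    simpa [dist_eq_norm] using this.le
  filter_upwards [ball_mem_nhds 0 hδ] with h hh
  rw [mem_ball_zero_iff] at hh
  refine (ContinuousMap.norm_le _ (by positivity)).2 fun k => ?_
  have hk : ‖h k‖ ≤ ‖h‖ := ContinuousMap.norm_coe_le_norm _ _
  have key := (convex_closedBall (α k) ‖h k‖).norm_image_sub_le_of_norm_hasFDerivWithin_le'
    (f := X) (φ := X' (α k)) (x := α k) (y := α k + h k)
    (fun x _ => (hX x).hasFDerivWithinAt)
    (fun x hx => hunif k x ((mem_closedBall_iff_norm.1 hx).trans_lt (hk.trans_lt hh)))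
    (by simp) (by simp)
  rw [add_sub_cancel_left] at key
  change ‖X (α k + h k) - X (α k) - X' (α k) (h k)‖ ≤ _
  exact key.trans (mul_le_mul_of_nonneg_left hk hε.le)

set_option synthInstance.maxHeartbeats 200000 in
-- instance search in `C(K, E →L[ℝ] F)` is slow
theorem contDiff_postcomp {K : Type*} [TopologicalSpace K] [CompactSpace K]
    {E : Type u} [NormedAddCommGroup E] [NormedSpace ℝ E] (n : ℕ) :
    ∀ {F : Type u} [NormedAddCommGroup F] [NormedSpace ℝ F] (X : C(E, F)),
      ContDiff ℝ n X → ContDiff ℝ n (fun α : C(K, E) => X.comp α) := by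
  induction n with
  | zero => exact fun X _ => contDiff_zero.2 (ContinuousMap.continuous_postcomp _)
  | succ n ih =>
    intro F _ _ X hX
    push_cast at hX ⊢
    have hd : ContDiff ℝ n (fderiv ℝ X) := hX.fderiv_right le_rfl
    exact contDiff_succ_iff_hasFDerivAt.2 ⟨_, (familyApply K E F).contDiff.comp
        (ih ⟨fderiv ℝ X, hd.continuous⟩ hd),
      hasFDerivAt_postcomp X ⟨fderiv ℝ X, hd.continuous⟩ fun x =>
        (hX.differentiable (by simp) x).hasFDerivAt⟩

/-- The operator `α ↦ ∫₀ˢ α` on continuous maps on `[-1, 1]`. -/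
def primitive (E : Type*) [NormedAddCommGroup E] [NormedSpace ℝ E] :
    C(Icc (-1 : ℝ) 1, E) →L[ℝ] C(Icc (-1 : ℝ) 1, E) :=
  LinearMap.mkContinuous
    { toFun := fun α => ⟨fun s => ∫ r in (0 : ℝ)..s, IccExtend (by norm_num : (-1 : ℝ) ≤ 1) α r,
        (intervalIntegral.continuous_primitive
          (fun a b => (α.continuous.Icc_extend' (h := by norm_num)).intervalIntegrable a b) 0).comp
          continuous_subtype_val⟩
      map_add' := fun α β => by
        ext s
        exact intervalIntegral.integral_add
          ((α.continuous.Icc_extend' (h := by norm_num)).intervalIntegrable _ _)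
          ((β.continuous.Icc_extend' (h := by norm_num)).intervalIntegrable _ _)
      map_smul' := fun c α => by
        ext s
        exact intervalIntegral.integral_smul c _ }
    1
    (fun α => by
      refine (ContinuousMap.norm_le _ (by positivity)).2 fun s => ?_
      have hs : |(s : ℝ) - 0| ≤ 1 := by simpa only [sub_zero] using abs_le.2 s.2
      calc _ ≤ ‖α‖ * |(s : ℝ) - 0| := intervalIntegral.norm_integral_le_of_norm_le_const
            fun r _ => ContinuousMap.norm_coe_le_norm α _
        _ ≤ ‖α‖ * 1 := by gcongr
        _ = 1 * ‖α‖ := mul_comm _ _)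

@[simp] theorem primitive_apply (α : C(Icc (-1 : ℝ) 1, E)) (s : Icc (-1 : ℝ) 1) :
    primitive E α s = ∫ r in (0 : ℝ)..s, IccExtend (by norm_num : (-1 : ℝ) ≤ 1) α r := rfl

/-- `α` solves the integral equation `α(s) = y + l ∫₀ˢ X(α)` on `[-1, 1]`, that is, `α' = l X(α)`
and `α(0) = y`: it is the flow line of `X` through `y`, run at speed `l`. -/
def IsScaledFlowLine (X : C(E, E)) (l : ℝ) (y : E) (α : C(Icc (-1 : ℝ) 1, E)) : Prop :=
  α = constCLM _ E y + l • primitive E (X.comp α)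

namespace IsScaledFlowLine

variable {X : C(E, E)} {l : ℝ} {y : E} {α : C(Icc (-1 : ℝ) 1, E)}

theorem apply (hα : IsScaledFlowLine X l y α) (s : Icc (-1 : ℝ) 1) :
    α s = y + l • ∫ r in (0 : ℝ)..s, IccExtend (by norm_num : (-1 : ℝ) ≤ 1) (X.comp α) r :=
  congrArg (fun β : C(Icc (-1 : ℝ) 1, E) => β s) hα

theorem apply_zero (hα : IsScaledFlowLine X l y α) : α ⟨0, by simp⟩ = y := by
  simp [hα.apply]

theorem hasDerivAt [CompleteSpace E] (hα : IsScaledFlowLine X l y α) {s : ℝ}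
    (hs : s ∈ Ioo (-1 : ℝ) 1) :
    HasDerivAt (IccExtend (by norm_num : (-1 : ℝ) ≤ 1) α)
      (l • X (IccExtend (by norm_num : (-1 : ℝ) ≤ 1) α s)) s := by
  have hcont : Continuous (IccExtend (by norm_num : (-1 : ℝ) ≤ 1) (X.comp α)) :=
    (X.comp α).continuous.Icc_extend'
  have hint := intervalIntegral.integral_hasDerivAt_right (hcont.intervalIntegrable 0 s)
    (hcont.stronglyMeasurableAtFilter _ _) hcont.continuousAt
  refine ((hint.const_smul l).const_add y).congr_of_eventuallyEq ?_
  filter_upwards [Icc_mem_nhds hs.1 hs.2] with r hr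
  rw [IccExtend_of_mem _ _ hr, hα.apply]
  rfl

/-- Both sides solve `g' = l X(g)`, `g(0) = y`. -/
theorem apply_one_eq [CompleteSpace E] {C : NNReal} (hX : LipschitzWith C X) {a : ℝ} {β}
    (hα : IsScaledFlowLine X l y α) (hβ : IsScaledFlowLine X a y β) (hl : |l| < a) :
    α ⟨1, by simp⟩ = IccExtend (by norm_num : (-1 : ℝ) ≤ 1) β (l / a) := by
  have ha : 0 < a := (abs_nonneg l).trans_lt hl
  have hscale : ∀ s ∈ Ioo (-1 : ℝ) 1, s * (l / a) ∈ Ioo (-1 : ℝ) 1 := by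
    refine fun s hs => abs_lt.1 ?_
    rw [abs_mul, abs_div, abs_of_pos ha]
    exact mul_lt_one_of_nonneg_of_lt_one_left (abs_nonneg _) (abs_lt.2 hs)
      ((div_lt_one ha).2 hl).le
  have heq : EqOn (IccExtend (by norm_num : (-1 : ℝ) ≤ 1) α)
      (fun s => IccExtend (by norm_num : (-1 : ℝ) ≤ 1) β (s * (l / a))) (Icc (-1) 1) := by
    refine ODE_solution_unique_of_mem_Icc (v := fun _ x => l • X x) (s := fun _ => univ)
      (K := ‖l‖₊ * C) (t₀ := 0) (fun _ _ => ((lipschitzWith_smul l).comp hX).lipschitzOnWith)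
      (by simp) α.continuous.Icc_extend'.continuousOn (fun s hs => hα.hasDerivAt hs)
      (fun _ _ => mem_univ _)
      (β.continuous.Icc_extend'.comp (continuous_mul_const _)).continuousOn
      (fun s hs => ?_) (fun _ _ => mem_univ _) ?_
    · have := (hβ.hasDerivAt (hscale s hs)).scomp s ((hasDerivAt_id s).mul_const (l / a))
      rwa [smul_smul, one_mul, div_mul_cancel₀ _ ha.ne'] at this
    · have h0 : (0 : ℝ) ∈ Icc (-1 : ℝ) 1 := by simp
      simp only [zero_mul, IccExtend_of_mem _ _ h0, hα.apply_zero, hβ.apply_zero]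
  have h1 : (1 : ℝ) ∈ Icc (-1 : ℝ) 1 := by simp
  simpa only [one_mul, IccExtend_of_mem _ _ h1] using heq h1

end IsScaledFlowLine

/-- The map `((l, y), α) ↦ ((l, y), β)` whose component `β = α - y - l ∫₀ˢ X(α)` vanishes exactly
when `α` is the flow line of `X` through `y`, run at speed `l`. -/
def flowLineDefect (X : C(E, E)) (z : (ℝ × E) × C(Icc (-1 : ℝ) 1, E)) :
    (ℝ × E) × C(Icc (-1 : ℝ) 1, E) :=
  (z.1, z.2 - constCLM _ E z.1.2 - z.1.1 • primitive E (X.comp z.2))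

theorem contDiff_primitive_comp {X : C(E, E)} (hX : ContDiff ℝ ∞ X) :
    ContDiff ℝ ∞ (fun z : (ℝ × E) × C(Icc (-1 : ℝ) 1, E) => primitive E (X.comp z.2)) :=
  (primitive E).contDiff.comp
    ((contDiff_infty.2 fun n => contDiff_postcomp n X (contDiff_infty.1 hX n)).comp contDiff_snd)

theorem contDiff_flowLineDefect {X : C(E, E)} (hX : ContDiff ℝ ∞ X) :
    ContDiff ℝ ∞ (flowLineDefect X) :=
  contDiff_fst.prodMk ((contDiff_snd.sub
    ((constCLM (Icc (-1 : ℝ) 1) E).contDiff.comp (contDiff_snd.comp contDiff_fst))).sub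
    ((contDiff_fst.comp contDiff_fst).smul (contDiff_primitive_comp hX)))

/-- The differential is the shear `(q, h) ↦ (q, h - L₀ q)`. -/
theorem exists_hasFDerivAt_flowLineDefect {X : C(E, E)} (hX : ContDiff ℝ ∞ X) (y₀ : E) :
    ∃ e : ((ℝ × E) × C(Icc (-1 : ℝ) 1, E)) ≃L[ℝ] ((ℝ × E) × C(Icc (-1 : ℝ) 1, E)),
      HasFDerivAt (flowLineDefect X) (e : _ →L[ℝ] _) ((0, y₀), constCLM _ E y₀) := by
  let K := Icc (-1 : ℝ) 1
  let z₀ : (ℝ × E) × C(K, E) := ((0, y₀), constCLM K E y₀)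
  let p₁ := ContinuousLinearMap.fst ℝ (ℝ × E) C(K, E)
  let p₂ := ContinuousLinearMap.snd ℝ (ℝ × E) C(K, E)
  let L₀ : (ℝ × E) →L[ℝ] C(K, E) := (constCLM K E).comp (ContinuousLinearMap.snd ℝ ℝ E) +
    (ContinuousLinearMap.fst ℝ ℝ E).smulRight (primitive E (X.comp (constCLM K E y₀)))
  let e : ((ℝ × E) × C(K, E)) ≃L[ℝ] ((ℝ × E) × C(K, E)) :=
    ContinuousLinearEquiv.equivOfInverse (p₁.prod (p₂ - L₀.comp p₁)) (p₁.prod (p₂ + L₀.comp p₁))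
      (fun z => by ext <;> simp [p₁, p₂]) (fun z => by ext <;> simp [p₁, p₂])
  have htime : HasFDerivAt (fun z : (ℝ × E) × C(K, E) => z.1.1)
      ((ContinuousLinearMap.fst ℝ ℝ E).comp p₁) z₀ :=
    ((ContinuousLinearMap.fst ℝ ℝ E).comp p₁).hasFDerivAt
  have hstart : HasFDerivAt (fun z : (ℝ × E) × C(K, E) => constCLM K E z.1.2)
      ((constCLM K E).comp ((ContinuousLinearMap.snd ℝ ℝ E).comp p₁)) z₀ :=
    ((constCLM K E).comp ((ContinuousLinearMap.snd ℝ ℝ E).comp p₁)).hasFDerivAt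
  refine ⟨e, (p₁.hasFDerivAt.prodMk ((p₂.hasFDerivAt.sub hstart).sub (htime.smul
    ((contDiff_primitive_comp hX).differentiable (by simp) z₀).hasFDerivAt))).congr_fderiv ?_⟩
  refine ContinuousLinearMap.ext ?_
  rintro ⟨⟨l, v⟩, h⟩
  simp [e, p₁, p₂, L₀, z₀, sub_sub]

theorem exists_contDiffOn_isScaledFlowLine [CompleteSpace E] (X : C(E, E)) (hX : ContDiff ℝ ∞ X)
    (y₀ : E) : ∃ r > 0, ∃ α : ℝ × E → C(Icc (-1 : ℝ) 1, E),
      ContDiffOn ℝ ∞ α (Ioo (-r) r ×ˢ ball y₀ r) ∧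
      ∀ l ∈ Ioo (-r) r, ∀ y ∈ ball y₀ r, IsScaledFlowLine X l y (α (l, y)) := by
  obtain ⟨e, he⟩ := exists_hasFDerivAt_flowLineDefect hX y₀
  obtain ⟨h, hz₀, -, hh, hsymm⟩ := exists_openPartialHomeomorph_contDiffOn_symm isOpen_univ
    (contDiff_flowLineDefect hX).contDiffOn (mem_univ _) he
  have htarget : ∀ᶠ q : ℝ × E in 𝓝 (0, y₀), (q, (0 : C(Icc (-1 : ℝ) 1, E))) ∈ h.target := by
    have hc : ContinuousAt (fun q : ℝ × E => (q, (0 : C(Icc (-1 : ℝ) 1, E)))) (0, y₀) := by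
      fun_prop
    refine hc.eventually (h.open_target.mem_nhds ?_)
    simpa [hh, flowLineDefect] using h.map_source hz₀
  obtain ⟨r, hr, hball⟩ := Metric.eventually_nhds_iff_ball.1 htarget
  rw [← ball_prod_same, Real.ball_eq_Ioo, zero_sub, zero_add] at hball
  refine ⟨r, hr, fun q => (h.symm (q, 0)).2, ?_, fun l hl y hy => ?_⟩
  · exact contDiff_snd.comp_contDiffOn
      (hsymm.comp (contDiff_id.prodMk contDiff_const).contDiffOn hball)
  · have hinv : flowLineDefect X (h.symm ((l, y), 0)) = ((l, y), 0) := by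
      rw [← hh, h.right_inv (hball _ ⟨hl, hy⟩)]
    have hfst : (h.symm ((l, y), 0)).1 = (l, y) := congrArg Prod.fst hinv
    have hsnd := congrArg Prod.snd hinv
    simp only [flowLineDefect, hfst] at hsnd
    rwa [sub_sub, sub_eq_zero] at hsnd

/-- `Fl` is a smooth local flow of the vector field `X`: it is defined for times in `(-a, a)` and
initial values in `B`, and its flow lines stay in `U`. -/
structure IsLocalFlow (X : E → E) (U B : Set E) (a : ℝ) (Fl : ℝ → E → E) : Prop where
  smooth : ContDiffOn ℝ ∞ (fun q : ℝ × E => Fl q.1 q.2) (Ioo (-a) a ×ˢ B)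
  zero : ∀ y ∈ B, Fl 0 y = y
  mem : ∀ y ∈ B, ∀ t ∈ Ioo (-a) a, Fl t y ∈ U
  hasDerivAt : ∀ y ∈ B, ∀ t ∈ Ioo (-a) a, HasDerivAt (fun t => Fl t y) (X (Fl t y)) t

theorem exists_isLocalFlow_of_lipschitzWith [CompleteSpace E] {X : E → E} (hX : ContDiff ℝ ∞ X)
    {C : NNReal} (hC : LipschitzWith C X) (y₀ : E) :
    ∃ a > 0, ∃ r > 0, ∃ Fl : ℝ → E → E, IsLocalFlow X univ (ball y₀ r) a Fl := by
  obtain ⟨r, hr, α, hsmooth, hα⟩ := exists_contDiffOn_isScaledFlowLine ⟨X, hX.continuous⟩ hX y₀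
  set a := r / 2
  have ha : 0 < a := half_pos hr
  have hsub : Ioo (-a) a ⊆ Ioo (-r) r :=
    Ioo_subset_Ioo (neg_le_neg (half_le_self hr.le)) (half_le_self hr.le)
  have hone : (1 : ℝ) ∈ Icc (-1 : ℝ) 1 := by simp
  have hline : ∀ y ∈ ball y₀ r, ∀ t ∈ Ioo (-a) a,
      α (t, y) ⟨1, hone⟩ = IccExtend (by norm_num : (-1 : ℝ) ≤ 1) (α (a, y)) (t / a) :=
    fun y hy t ht => (hα t (hsub ht) y hy).apply_one_eq hC
      (hα a ⟨by linarith, half_lt_self hr⟩ y hy) (abs_lt.2 ht)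
  refine ⟨a, ha, r, hr, fun t y => α (t, y) ⟨1, hone⟩, ?_, fun y hy => ?_,
    fun _ _ _ _ => mem_univ _, fun y hy t ht => ?_⟩
  · exact (ContinuousMap.evalCLM ℝ (⟨1, hone⟩ : Icc (-1 : ℝ) 1)).contDiff.comp_contDiffOn
      (hsmooth.mono (prod_mono hsub subset_rfl))
  · simpa using (hα 0 (by simpa using hr) y hy).apply ⟨1, hone⟩
  · have hta : t / a ∈ Ioo (-1 : ℝ) 1 :=
      abs_lt.1 (by rw [abs_div, abs_of_pos ha, div_lt_one ha]; exact abs_lt.2 ht)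
    have hd := ((hα a ⟨by linarith, half_lt_self hr⟩ y hy).hasDerivAt hta).scomp t
      ((hasDerivAt_id t).div_const a)
    rw [smul_smul, one_div, inv_mul_cancel₀ ha.ne', one_smul] at hd
    rw [hline y hy t ht]
    refine hd.congr_of_eventuallyEq ?_
    filter_upwards [Ioo_mem_nhds ht.1 ht.2] with τ hτ using hline y hy τ hτ

namespace IsLocalFlow

variable {X : E → E} {U B : Set E} {a : ℝ} {Fl : ℝ → E → E} {C : NNReal}

theorem mono {B' : Set E} {a' : ℝ} (h : IsLocalFlow X U B a Fl) (hB : B' ⊆ B) (ha : a' ≤ a) :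
    IsLocalFlow X U B' a' Fl := by
  have hI : Ioo (-a') a' ⊆ Ioo (-a) a := Ioo_subset_Ioo (neg_le_neg ha) ha
  exact ⟨h.smooth.mono (prod_mono hI hB), fun y hy => h.zero y (hB hy),
    fun y hy t ht => h.mem y (hB hy) t (hI ht), fun y hy t ht => h.hasDerivAt y (hB hy) t (hI ht)⟩

theorem subset (h : IsLocalFlow X U B a Fl) (ha : 0 < a) : B ⊆ U := fun y hy =>
  h.zero y hy ▸ h.mem y hy 0 ⟨neg_lt_zero.2 ha, ha⟩

theorem congr {X' : E → E} (h : IsLocalFlow X U B a Fl) (hX : EqOn X X' U) :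
    IsLocalFlow X' U B a Fl :=
  ⟨h.smooth, h.zero, h.mem, fun y hy t ht => hX (h.mem y hy t ht) ▸ h.hasDerivAt y hy t ht⟩

theorem exists_mapsTo {y₀ : E} {r : ℝ} {V : Set E} (h : IsLocalFlow X U (ball y₀ r) a Fl)
    (ha : 0 < a) (hr : 0 < r) (hV : V ∈ 𝓝 y₀) :
    ∃ a' > 0, ∃ r' > 0, IsLocalFlow X V (ball y₀ r') a' Fl := by
  have hcont : ContinuousAt (fun q : ℝ × E => Fl q.1 q.2) (0, y₀) :=
    h.smooth.continuousOn.continuousAt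
      (prod_mem_nhds (Ioo_mem_nhds (neg_lt_zero.2 ha) ha) (ball_mem_nhds _ hr))
  have hV' : ∀ᶠ q : ℝ × E in 𝓝 (0, y₀), Fl q.1 q.2 ∈ V :=
    hcont.eventually (show V ∈ 𝓝 (Fl 0 y₀) by rwa [h.zero y₀ (mem_ball_self hr)])
  obtain ⟨ρ, hρ, hball⟩ := Metric.eventually_nhds_iff_ball.1 hV'
  rw [← ball_prod_same, Real.ball_eq_Ioo, zero_sub, zero_add] at hball
  have h' : IsLocalFlow X U (ball y₀ (min r ρ)) (min a ρ) Fl :=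
    h.mono (ball_subset_ball (min_le_left _ _)) (min_le_left _ _)
  refine ⟨min a ρ, lt_min ha hρ, min r ρ, lt_min hr hρ, h'.smooth, h'.zero,
    fun y hy t ht => hball (t, y) ⟨?_, ball_subset_ball (min_le_right _ _) hy⟩, h'.hasDerivAt⟩
  exact Ioo_subset_Ioo (neg_le_neg (min_le_right _ _)) (min_le_right _ _) ht

theorem add (h : IsLocalFlow X U B a Fl) (hX : LipschitzOnWith C X U) {s t : ℝ} {y : E}
    (hy : y ∈ B) (hs : s ∈ Ioo (-a) a) (ht : t ∈ Ioo (-a) a) (hst : s + t ∈ Ioo (-a) a)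
    (hty : Fl t y ∈ B) : Fl (s + t) y = Fl s (Fl t y) := by
  have ha : 0 < a := by linarith [ht.1, ht.2]
  have key : EqOn (fun τ => Fl (τ + t) y) (fun τ => Fl τ (Fl t y))
      (Ioo (max (-a) (-a - t)) (min a (a - t))) := by
    have hshift : ∀ τ ∈ Ioo (max (-a) (-a - t)) (min a (a - t)), τ + t ∈ Ioo (-a) a := fun τ hτ =>
      ⟨by linarith [(max_lt_iff.1 hτ.1).2], by linarith [(lt_min_iff.1 hτ.2).2]⟩
    have hself : ∀ τ ∈ Ioo (max (-a) (-a - t)) (min a (a - t)), τ ∈ Ioo (-a) a := fun τ hτ =>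
      ⟨(max_lt_iff.1 hτ.1).1, (lt_min_iff.1 hτ.2).1⟩
    refine ODE_solution_unique_of_mem_Ioo (v := fun _ => X) (s := fun _ => U) (t₀ := 0)
      (fun _ _ => hX) ⟨max_lt (by linarith) (by linarith [ht.1]), lt_min ha (by linarith [ht.2])⟩
      (fun τ hτ => ⟨(h.hasDerivAt y hy _ (hshift τ hτ)).comp_add_const τ t,
        h.mem y hy _ (hshift τ hτ)⟩)
      (fun τ hτ => ⟨h.hasDerivAt _ hty τ (hself τ hτ), h.mem _ hty τ (hself τ hτ)⟩) ?_
    simp only [zero_add, h.zero _ hty]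
  exact key ⟨max_lt hs.1 (by linarith [hst.1]), lt_min hs.2 (by linarith [hst.2])⟩

theorem injOn (h : IsLocalFlow X U B a Fl) (hX : LipschitzOnWith C X U) {t : ℝ}
    (ht : t ∈ Ioo (-a) a) : InjOn (Fl t) B := by
  intro y hy z hz hyz
  have key := ODE_solution_unique_of_mem_Ioo (v := fun _ => X) (s := fun _ => U)
    (fun _ _ => hX) ht (fun τ hτ => ⟨h.hasDerivAt y hy τ hτ, h.mem y hy τ hτ⟩)
    (fun τ hτ => ⟨h.hasDerivAt z hz τ hτ, h.mem z hz τ hτ⟩) hyz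
  have h0 : (0 : ℝ) ∈ Ioo (-a) a := by constructor <;> linarith [ht.1, ht.2]
  simpa only [h.zero y hy, h.zero z hz] using key h0

end IsLocalFlow

theorem exists_contDiff_hasCompactSupport_eqOn_ball [FiniteDimensional ℝ E] {X : E → F}
    {U : Set E} (hU : IsOpen U) (hX : ContDiffOn ℝ ∞ X U) {y₀ : E} (hy₀ : y₀ ∈ U) :
    ∃ X' : E → F, ContDiff ℝ ∞ X' ∧ HasCompactSupport X' ∧
      ∃ R > 0, ball y₀ R ⊆ U ∧ EqOn X' X (ball y₀ R) := by
  obtain ⟨R, hR, hRU⟩ := nhds_basis_closedBall.mem_iff.1 (hU.mem_nhds hy₀)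
  let b : ContDiffBump y₀ := ⟨R / 2, R, half_pos hR, half_lt_self hR⟩
  refine ⟨fun y => b y • X y, contDiff_iff_contDiffAt.2 fun y => ?_,
    b.hasCompactSupport.smul_right, R / 2, half_pos hR, ?_, fun y hy => ?_⟩
  · by_cases hy : y ∈ U
    · exact b.contDiff.contDiffAt.smul (hX.contDiffAt (hU.mem_nhds hy))
    · refine (contDiffAt_const (c := 0)).congr_of_eventuallyEq ?_
      filter_upwards [isClosed_closedBall.isOpen_compl.mem_nhds fun h => hy (hRU h)] with z hz
      rw [b.zero_of_le_dist (not_le.1 fun h => hz h).le, zero_smul]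
  · exact ((ball_subset_ball (half_le_self hR.le)).trans ball_subset_closedBall).trans hRU
  · simp [b.one_of_mem_closedBall (ball_subset_closedBall hy)]

theorem exists_isLocalFlow [FiniteDimensional ℝ E] {X : E → E} {U : Set E} (hU : IsOpen U)
    (hX : ContDiffOn ℝ ∞ X U) {y₀ : E} (hy₀ : y₀ ∈ U) :
    ∃ V ⊆ U, IsOpen V ∧ ∃ C, LipschitzOnWith C X V ∧
      ∃ a > 0, ∃ r > 0, ∃ Fl : ℝ → E → E, IsLocalFlow X V (ball y₀ r) a Fl := by
  have : CompleteSpace E := FiniteDimensional.complete ℝ E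
  obtain ⟨X', hX', hsupp, R, hR, hRU, hEq⟩ := exists_contDiff_hasCompactSupport_eqOn_ball hU hX hy₀
  obtain ⟨C, hC⟩ := ContDiff.lipschitzWith_of_hasCompactSupport hsupp hX' (by simp)
  obtain ⟨a, ha, r, hr, Fl, hFl⟩ := exists_isLocalFlow_of_lipschitzWith hX' hC y₀
  obtain ⟨a', ha', r', hr', hFl'⟩ := hFl.exists_mapsTo ha hr (ball_mem_nhds y₀ hR)
  exact ⟨ball y₀ R, hRU, isOpen_ball, C,
    fun x hx y hy => hEq hx ▸ hEq hy ▸ hC x y, a', ha', r', hr', Fl, hFl'.congr hEq⟩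

end Flow

/-- Without this shortcut the instance search times out. -/
local instance normedAddCommGroupBilin {E : Type*} [NormedAddCommGroup E] [NormedSpace ℝ E] :
    NormedAddCommGroup (E →L[ℝ] E →L[ℝ] ℝ) :=
  ContinuousLinearMap.toNormedAddCommGroup

section Calculus

open Metric Filter Topology

variable {E : Type*} [NormedAddCommGroup E] [NormedSpace ℝ E]
  {F : Type*} [NormedAddCommGroup F] [NormedSpace ℝ F]

theorem fderiv_bilin_apply {G : F → E →L[ℝ] E →L[ℝ] ℝ} {V W : F → E} {y : F}
    (hG : DifferentiableAt ℝ G y) (hV : DifferentiableAt ℝ V y) (hW : DifferentiableAt ℝ W y)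
    (a : F) : fderiv ℝ (fun z => G z (V z) (W z)) y a
      = fderiv ℝ G y a (V y) (W y) + G y (fderiv ℝ V y a) (W y) + G y (V y) (fderiv ℝ W y a) := by
  rw [((hG.hasFDerivAt.clm_apply hV.hasFDerivAt).clm_apply hW.hasFDerivAt).fderiv]
  simp
  ring

theorem fderiv_bilin_const_apply {G : F → E →L[ℝ] E →L[ℝ] ℝ} {y : F}
    (hG : DifferentiableAt ℝ G y) (v : F) (a b : E) :
    fderiv ℝ (fun z => G z a b) y v = fderiv ℝ G y v a b := by
  simp [fderiv_bilin_apply hG (differentiableAt_const a) (differentiableAt_const b)]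

theorem fderiv_bilin_symm {G : F → E →L[ℝ] E →L[ℝ] ℝ} {y : F} (hG : DifferentiableAt ℝ G y)
    (hsymm : ∀ᶠ z in 𝓝 y, ∀ a b, G z a b = G z b a) (v : F) (a b : E) :
    fderiv ℝ G y v a b = fderiv ℝ G y v b a := by
  have h : (fun z => G z a b) =ᶠ[𝓝 y] fun z => G z b a := by
    filter_upwards [hsymm] with z hz using hz a b
  rw [← fderiv_bilin_const_apply hG, h.fderiv_eq, fderiv_bilin_const_apply hG]

theorem hasDerivAt_bilin {G : F → E →L[ℝ] E →L[ℝ] ℝ} {c : ℝ → F} {V W : ℝ → E} {c' : F}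
    {V' W' : E} {t : ℝ} (hG : DifferentiableAt ℝ G (c t)) (hc : HasDerivAt c c' t)
    (hV : HasDerivAt V V' t) (hW : HasDerivAt W W' t) : HasDerivAt (fun s => G (c s) (V s) (W s))
      (fderiv ℝ G (c t) c' (V t) (W t) + G (c t) V' (W t) + G (c t) (V t) W') t := by
  have h := ((HasFDerivAt.comp_hasDerivAt (l := G) t hG.hasFDerivAt hc).clm_apply hV).clm_apply hW
  refine h.congr_deriv ?_
  simp

theorem hasFDerivAt_fderiv_apply {f : E → F} {y : E} (hf : DifferentiableAt ℝ (fderiv ℝ f) y)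
    (a : E) : HasFDerivAt (fun z => fderiv ℝ f z a) ((fderiv ℝ (fderiv ℝ f) y).flip a) y := by
  refine (hf.hasFDerivAt.clm_apply (hasFDerivAt_const a y)).congr_fderiv ?_
  ext v
  simp

theorem fderiv_prodMk_right {f : ℝ × E → F} {s : ℝ} {y : E}
    (hf : DifferentiableAt ℝ f (s, y)) (v : E) :
    fderiv ℝ (fun z => f (s, z)) y v = fderiv ℝ f (s, y) (0, v) := by
  have h := (hf.hasFDerivAt.comp y (hasFDerivAt_prodMk_right s y)).fderiv
  change fderiv ℝ (fun z => f (s, z)) y = _ at h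
  simp [h]

end Calculus

section LieDerivative

open Filter Topology

variable {E : Type*} [NormedAddCommGroup E] [NormedSpace ℝ E] {G : E → E →L[ℝ] E →L[ℝ] ℝ}
  {X : E → E} {y : E}

/-- The Lie derivative `(L_X G)(a, b)` at `y` of the bilinear form `G` along the vector field `X`,
both given in coordinates. -/
def lieForm (G : E → E →L[ℝ] E →L[ℝ] ℝ) (X : E → E) (y a b : E) : ℝ :=
  fderiv ℝ G y (X y) a b + G y (fderiv ℝ X y a) b + G y a (fderiv ℝ X y b)

theorem lieForm_add_smul_left (a a' b : E) (c : ℝ) :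
    lieForm G X y (a + c • a') b = lieForm G X y a b + c * lieForm G X y a' b := by
  simp only [lieForm, map_add, map_smul, add_apply, smul_apply, smul_eq_mul]
  ring

theorem lieForm_symm (hG : DifferentiableAt ℝ G y)
    (hsymm : ∀ᶠ z in 𝓝 y, ∀ a b, G z a b = G z b a) (a b : E) :
    lieForm G X y a b = lieForm G X y b a := by
  have hs := hsymm.self_of_nhds
  rw [lieForm, lieForm, fderiv_bilin_symm hG hsymm, hs (fderiv ℝ X y a), hs a]
  ring

theorem lieForm_smul {k : E → ℝ} (hk : DifferentiableAt ℝ k y) (hX : DifferentiableAt ℝ X y)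
    (a b : E) : lieForm G (fun z => k z • X z) y a b = k y * lieForm G X y a b
      + fderiv ℝ k y a * G y (X y) b + fderiv ℝ k y b * G y a (X y) := by
  have hd : fderiv ℝ (fun z => k z • X z) y = _ := (hk.hasFDerivAt.smul hX.hasFDerivAt).fderiv
  simp only [lieForm, hd, map_add, ContinuousLinearMap.map_smul, add_apply, smul_apply, smul_eq_mul,
    ContinuousLinearMap.smulRight_apply]
  ring

/-- Both sides of `G(X, b) = ρ du(b)` are differentiated along `X`, both sides of `du(X) = 1` along
`b`; the second derivatives of `u` then cancel. -/
theorem lieForm_self_left {u ρ : E → ℝ} (hG : DifferentiableAt ℝ G y)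
    (hX : DifferentiableAt ℝ X y) (hu : ContDiffAt ℝ 2 u y) (hρ : DifferentiableAt ℝ ρ y)
    (hdual : ∀ᶠ z in 𝓝 y, ∀ b, G z (X z) b = ρ z * fderiv ℝ u z b)
    (huX : ∀ᶠ z in 𝓝 y, fderiv ℝ u z (X z) = 1) (b : E) :
    lieForm G X y (X y) b = fderiv ℝ ρ y (X y) * fderiv ℝ u y b := by
  have hu2 : DifferentiableAt ℝ (fderiv ℝ u) y :=
    (hu.fderiv_right (m := 1) (by norm_num)).differentiableAt (by simp)
  have hGX : fderiv ℝ G y (X y) (X y) b + G y (fderiv ℝ X y (X y)) b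
      = ρ y * fderiv ℝ (fderiv ℝ u) y (X y) b + fderiv ℝ u y b * fderiv ℝ ρ y (X y) := by
    have h : (fun z => G z (X z) b) =ᶠ[𝓝 y] fun z => ρ z * fderiv ℝ u z b := by
      filter_upwards [hdual] with z hz using hz b
    have h' := congrArg (fun A : E →L[ℝ] ℝ => A (X y))
      (h.fderiv_eq.trans (hρ.hasFDerivAt.mul (hasFDerivAt_fderiv_apply hu2 b)).fderiv)
    simpa [fderiv_bilin_apply hG hX] using h'
  have hduX : fderiv ℝ (fderiv ℝ u) y b (X y) + fderiv ℝ u y (fderiv ℝ X y b) = 0 := by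
    have h := congrArg (fun A : E →L[ℝ] ℝ => A b)
      ((hu2.hasFDerivAt.clm_apply hX.hasFDerivAt).fderiv.symm.trans
        (EventuallyEq.fderiv_eq (𝕜 := ℝ) (f := fun _ => (1 : ℝ)) huX))
    simpa [add_comm] using h
  rw [lieForm, hGX, hdual.self_of_nhds, (hu.isSymmSndFDerivAt (by simp)).eq (X y) b]
  linear_combination ρ y * hduX

theorem lieForm_eq_zero_of_ker {u ρ : E → ℝ} (hG : DifferentiableAt ℝ G y)
    (hX : DifferentiableAt ℝ X y) (hu : ContDiffAt ℝ 2 u y) (hρ : DifferentiableAt ℝ ρ y)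
    (hsymm : ∀ᶠ z in 𝓝 y, ∀ a b, G z a b = G z b a)
    (hdual : ∀ᶠ z in 𝓝 y, ∀ b, G z (X z) b = ρ z * fderiv ℝ u z b)
    (huX : ∀ᶠ z in 𝓝 y, fderiv ℝ u z (X z) = 1) (hρX : fderiv ℝ ρ y (X y) = 0)
    (hker : ∀ a b, fderiv ℝ u y a = 0 → fderiv ℝ u y b = 0 → lieForm G X y a b = 0) (a b : E) :
    lieForm G X y a b = 0 := by
  have hself : ∀ b, lieForm G X y (X y) b = 0 := fun b => by
    rw [lieForm_self_left hG hX hu hρ hdual huX, hρX, zero_mul]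
  have hdecomp : ∀ a, ∃ a' c, fderiv ℝ u y a' = 0 ∧ a = a' + (c : ℝ) • X y := fun a =>
    ⟨a - fderiv ℝ u y a • X y, fderiv ℝ u y a, by simp [huX.self_of_nhds], by simp⟩
  obtain ⟨a', c, ha', rfl⟩ := hdecomp a
  obtain ⟨b', d, hb', rfl⟩ := hdecomp b
  rw [lieForm_add_smul_left, hself, mul_zero, add_zero, lieForm_symm hG hsymm,
    lieForm_add_smul_left, hself, mul_zero, add_zero, hker b' a' hb' ha']

end LieDerivative

section ChangeOfCoordinates

open Filter Topology

variable {E : Type*} [NormedAddCommGroup E] [NormedSpace ℝ E]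
  {F : Type*} [NormedAddCommGroup F] [NormedSpace ℝ F] {τ : E → F} {y : E}

theorem fderiv_pullback_apply {G : E → E →L[ℝ] E →L[ℝ] ℝ} {G' : F → F →L[ℝ] F →L[ℝ] ℝ}
    (hτ : ContDiffAt ℝ 2 τ y) (hG : DifferentiableAt ℝ G y) (hG' : DifferentiableAt ℝ G' (τ y))
    (hGG' : ∀ᶠ z in 𝓝 y, ∀ a b, G z a b = G' (τ z) (fderiv ℝ τ z a) (fderiv ℝ τ z b))
    (v a b : E) :
    fderiv ℝ G y v a b = fderiv ℝ G' (τ y) (fderiv ℝ τ y v) (fderiv ℝ τ y a) (fderiv ℝ τ y b)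
      + G' (τ y) (fderiv ℝ (fderiv ℝ τ) y v a) (fderiv ℝ τ y b)
      + G' (τ y) (fderiv ℝ τ y a) (fderiv ℝ (fderiv ℝ τ) y v b) := by
  have hdτ := hasFDerivAt_fderiv_apply
    ((hτ.fderiv_right (m := 1) (by norm_num)).differentiableAt (by simp))
  have hGτ : HasFDerivAt (fun z => G' (τ z)) ((fderiv ℝ G' (τ y)).comp (fderiv ℝ τ y)) y :=
    HasFDerivAt.comp (g := G') y hG'.hasFDerivAt (hτ.differentiableAt (by simp)).hasFDerivAt
  have h : (fun z => G z a b) =ᶠ[𝓝 y] fun z => G' (τ z) (fderiv ℝ τ z a) (fderiv ℝ τ z b) := by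
    filter_upwards [hGG'] with z hz using hz a b
  rw [← fderiv_bilin_const_apply hG, h.fderiv_eq,
    fderiv_bilin_apply hGτ.differentiableAt (hdτ a).differentiableAt (hdτ b).differentiableAt,
    hGτ.fderiv, (hdτ a).fderiv, (hdτ b).fderiv]
  rfl

theorem fderiv_apply_fderiv_of_related {X : E → E} {X' : F → F} (hτ : ContDiffAt ℝ 2 τ y)
    (hX : DifferentiableAt ℝ X y) (hX' : DifferentiableAt ℝ X' (τ y))
    (hXX' : ∀ᶠ z in 𝓝 y, X' (τ z) = fderiv ℝ τ z (X z)) (v : E) :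
    fderiv ℝ X' (τ y) (fderiv ℝ τ y v)
      = fderiv ℝ (fderiv ℝ τ) y v (X y) + fderiv ℝ τ y (fderiv ℝ X y v) := by
  have hττ : DifferentiableAt ℝ (fderiv ℝ τ) y :=
    (hτ.fderiv_right (m := 1) (by norm_num)).differentiableAt (by simp)
  have hcomp : HasFDerivAt (fun z => X' (τ z)) ((fderiv ℝ X' (τ y)).comp (fderiv ℝ τ y)) y :=
    hX'.hasFDerivAt.comp y (hτ.differentiableAt (by simp)).hasFDerivAt
  have h := congrArg (fun A : E →L[ℝ] F => A v) (hcomp.fderiv.symm.trans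
    ((EventuallyEq.fderiv_eq (𝕜 := ℝ) hXX').trans
      (hττ.hasFDerivAt.clm_apply hX.hasFDerivAt).fderiv))
  simpa [add_comm] using h

theorem lieForm_pullback {G : E → E →L[ℝ] E →L[ℝ] ℝ} {G' : F → F →L[ℝ] F →L[ℝ] ℝ}
    {X : E → E} {X' : F → F} (hτ : ContDiffAt ℝ 2 τ y) (hG : DifferentiableAt ℝ G y)
    (hG' : DifferentiableAt ℝ G' (τ y)) (hX : DifferentiableAt ℝ X y)
    (hX' : DifferentiableAt ℝ X' (τ y))
    (hGG' : ∀ᶠ z in 𝓝 y, ∀ a b, G z a b = G' (τ z) (fderiv ℝ τ z a) (fderiv ℝ τ z b))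
    (hXX' : ∀ᶠ z in 𝓝 y, X' (τ z) = fderiv ℝ τ z (X z)) (a b : E) :
    lieForm G X y a b = lieForm G' X' (τ y) (fderiv ℝ τ y a) (fderiv ℝ τ y b) := by
  have hsymm := (hτ.isSymmSndFDerivAt (by simp)).eq
  rw [lieForm, lieForm, fderiv_pullback_apply hτ hG hG' hGG', hGG'.self_of_nhds,
    hGG'.self_of_nhds, fderiv_apply_fderiv_of_related hτ hX hX' hXX',
    fderiv_apply_fderiv_of_related hτ hX hX' hXX', hXX'.self_of_nhds, hsymm (X y) a,
    hsymm (X y) b]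
  simp only [map_add, add_apply]
  ring

end ChangeOfCoordinates

namespace IsLocalFlow

open Filter Topology

variable {E : Type*} [NormedAddCommGroup E] [NormedSpace ℝ E] {X : E → E} {U B : Set E} {a : ℝ}
  {Fl : ℝ → E → E}

theorem contDiffAt (h : IsLocalFlow X U B a Fl) (hB : IsOpen B) {t : ℝ} (ht : t ∈ Ioo (-a) a)
    {y : E} (hy : y ∈ B) : ContDiffAt ℝ ∞ (fun q : ℝ × E => Fl q.1 q.2) (t, y) :=
  h.smooth.contDiffAt ((isOpen_Ioo.prod hB).mem_nhds ⟨ht, hy⟩)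

theorem fderiv_apply_time (h : IsLocalFlow X U B a Fl) (hB : IsOpen B) {t : ℝ}
    (ht : t ∈ Ioo (-a) a) {y : E} (hy : y ∈ B) :
    fderiv ℝ (fun q : ℝ × E => Fl q.1 q.2) (t, y) (1, 0) = X (Fl t y) := by
  have hd := ((h.contDiffAt hB ht hy).differentiableAt (by simp)).hasFDerivAt
  exact (hd.comp_hasDerivAt (f := fun s => (s, y)) t
    ((hasDerivAt_id t).prodMk (hasDerivAt_const t y))).unique (h.hasDerivAt y hy t ht)

theorem fderiv_apply_space (h : IsLocalFlow X U B a Fl) (hB : IsOpen B) {t : ℝ}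
    (ht : t ∈ Ioo (-a) a) {y : E} (hy : y ∈ B) (v : E) :
    fderiv ℝ (Fl t) y v = fderiv ℝ (fun q : ℝ × E => Fl q.1 q.2) (t, y) (0, v) :=
  fderiv_prodMk_right ((h.contDiffAt hB ht hy).differentiableAt (by simp)) v

theorem fderiv_zero (h : IsLocalFlow X U B a Fl) (hB : IsOpen B) {y : E} (hy : y ∈ B) (v : E) :
    fderiv ℝ (Fl 0) y v = v := by
  have hid : Fl 0 =ᶠ[𝓝 y] id := by filter_upwards [hB.mem_nhds hy] with z hz using h.zero z hz
  simp [hid.fderiv_eq]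

/-- The variational equation of the flow. -/
theorem hasDerivAt_fderiv (h : IsLocalFlow X U B a Fl) (hB : IsOpen B) {t : ℝ}
    (ht : t ∈ Ioo (-a) a) {y : E} (hy : y ∈ B) (hX : DifferentiableAt ℝ X (Fl t y)) (v : E) :
    HasDerivAt (fun s => fderiv ℝ (Fl s) y v) (fderiv ℝ X (Fl t y) (fderiv ℝ (Fl t) y v)) t := by
  set Φ : ℝ × E → E := fun q => Fl q.1 q.2
  have hΦ : ContDiffAt ℝ ∞ Φ (t, y) := h.contDiffAt hB ht hy
  have hΦ2 : DifferentiableAt ℝ (fderiv ℝ Φ) (t, y) :=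
    (hΦ.fderiv_right (m := ∞) (by simp)).differentiableAt (by simp)
  have htime : (fun q => fderiv ℝ Φ q (1, 0)) =ᶠ[𝓝 (t, y)] X ∘ Φ := by
    filter_upwards [(isOpen_Ioo.prod hB).mem_nhds (show (t, y) ∈ _ from ⟨ht, hy⟩)] with q hq
    exact h.fderiv_apply_time hB hq.1 hq.2
  have hmixed : fderiv ℝ (fderiv ℝ Φ) (t, y) (0, v) (1, 0)
      = fderiv ℝ X (Fl t y) (fderiv ℝ Φ (t, y) (0, v)) := by
    have h' := congrArg (fun A : ℝ × E →L[ℝ] E => A (0, v))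
      (((hasFDerivAt_fderiv_apply hΦ2 (1, 0)).fderiv.symm.trans htime.fderiv_eq).trans
        (hX.hasFDerivAt.comp (t, y) (hΦ.differentiableAt (by simp)).hasFDerivAt).fderiv)
    simpa using h'
  have hsymm := ((hΦ.of_le (m := 2) (WithTop.coe_le_coe.2 le_top)).isSymmSndFDerivAt
    (by simp)).eq (1, 0) (0, v)
  have hd := (hasFDerivAt_fderiv_apply hΦ2 (0, v)).comp_hasDerivAt t
    ((hasDerivAt_id t).prodMk (hasDerivAt_const t y))
  rw [ContinuousLinearMap.flip_apply, hsymm, hmixed, ← h.fderiv_apply_space hB ht hy] at hd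
  refine hd.congr_of_eventuallyEq ?_
  filter_upwards [Ioo_mem_nhds ht.1 ht.2] with s hs using h.fderiv_apply_space hB hs hy v

theorem isometry {G : E → E →L[ℝ] E →L[ℝ] ℝ} (h : IsLocalFlow X U B a Fl) (hU : IsOpen U)
    (hB : IsOpen B) (hG : DifferentiableOn ℝ G U) (hX : DifferentiableOn ℝ X U)
    (hK : ∀ y ∈ U, ∀ v w, lieForm G X y v w = 0) {t : ℝ} (ht : t ∈ Ioo (-a) a) {y : E}
    (hy : y ∈ B) (v w : E) :
    G (Fl t y) (fderiv ℝ (Fl t) y v) (fderiv ℝ (Fl t) y w) = G y v w := by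
  have hderiv : ∀ s ∈ Ioo (-a) a, HasDerivAt
      (fun s => G (Fl s y) (fderiv ℝ (Fl s) y v) (fderiv ℝ (Fl s) y w)) 0 s := by
    intro s hs
    have hmem := hU.mem_nhds (h.mem y hy s hs)
    have hvar := h.hasDerivAt_fderiv hB hs hy (hX.differentiableAt hmem)
    refine (hasDerivAt_bilin (hG.differentiableAt hmem) (h.hasDerivAt y hy s hs) (hvar v)
      (hvar w)).congr_deriv ?_
    exact hK _ (h.mem y hy s hs) _ _
  have h0 : (0 : ℝ) ∈ Ioo (-a) a := by constructor <;> linarith [ht.1, ht.2]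
  have hconst := isOpen_Ioo.is_const_of_deriv_eq_zero isPreconnected_Ioo
    (fun s hs => (hderiv s hs).differentiableAt.differentiableWithinAt)
    (fun s hs => (hderiv s hs).deriv) ht h0
  simpa only [h.zero y hy, h.fderiv_zero hB hy] using hconst

end IsLocalFlow

section Charts

open Filter Topology

variable {E : Type*} [NormedAddCommGroup E] [NormedSpace ℝ E] {H : Type*} [TopologicalSpace H]
  {P : Type*} [TopologicalSpace P] [ChartedSpace H P]

/-- The differential at `p` of the preferred chart at `p₀`, as a map of the model space. -/
def dchart (I : ModelWithCorners ℝ E H) (p₀ p : P) : E →L[ℝ] E :=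
  mfderiv I 𝓘(ℝ, E) (extChartAt I p₀) p

/-- The differential at `y` of the inverse of the preferred chart at `p₀`, as a map of the model
space. -/
def dchartSymm (I : ModelWithCorners ℝ E H) (p₀ : P) (y : E) : E →L[ℝ] E :=
  mfderiv 𝓘(ℝ, E) I (extChartAt I p₀).symm y

/-- The change of coordinates from the preferred chart at `p` to the one at `q`. -/
def transition (I : ModelWithCorners ℝ E H) (p q : P) (y : E) : E :=
  extChartAt I q ((extChartAt I p).symm y)

variable {I : ModelWithCorners ℝ E H} {p₀ p q : P} {y : E}

theorem dchart_self [IsManifold I 1 P] (p : P) (v : E) : dchart I p p v = v :=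
  congrArg (fun A : E →L[ℝ] E => A v) (mfderiv_extChartAt_self (I := I) (x := p))

theorem trivializationAt_snd_eq_dchart [IsManifold I 1 P] (hp : p ∈ (extChartAt I p₀).source)
    (v : TangentSpace I p) :
    (trivializationAt E (TangentSpace I : P → Type _) p₀ ⟨p, v⟩).2 = dchart I p₀ p v := by
  rw [extChartAt_source] at hp
  have h : (trivializationAt E (TangentSpace I : P → Type _) p₀).continuousLinearMapAt ℝ p v
      = (trivializationAt E (TangentSpace I : P → Type _) p₀ ⟨p, v⟩).2 := by
    rw [Trivialization.continuousLinearMapAt_apply, Trivialization.linearMapAt_apply, if_pos]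
    rwa [TangentBundle.trivializationAt_baseSet]
  rw [← h, TangentBundle.continuousLinearMapAt_trivializationAt hp]
  rfl

theorem symmL_eq_dchartSymm [I.Boundaryless] [IsManifold I 1 P]
    (hy : y ∈ (extChartAt I p₀).target) (a : E) :
    (trivializationAt E (TangentSpace I : P → Type _) p₀).symmL ℝ ((extChartAt I p₀).symm y) a
      = dchartSymm I p₀ y a := by
  have h := TangentBundle.symmL_trivializationAt (𝕜 := ℝ) (I := I)
    (extChartAt_source I p₀ ▸ (extChartAt I p₀).map_target hy)
  rw [(extChartAt I p₀).right_inv hy, I.range_eq_univ, mfderivWithin_univ] at h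
  exact congrArg (fun A : E →L[ℝ] E => A a) h

theorem dchart_dchartSymm [I.Boundaryless] [IsManifold I 1 P]
    (hy : y ∈ (extChartAt I p₀).target) (a : E) :
    dchart I p₀ ((extChartAt I p₀).symm y) (dchartSymm I p₀ y a) = a := by
  have h := mfderiv_extChartAt_comp_mfderivWithin_extChartAt_symm (I := I) hy
  rw [I.range_eq_univ, mfderivWithin_univ] at h
  exact congrArg (fun A : E →L[ℝ] E => A a) h

theorem dchartSymm_dchart [I.Boundaryless] [IsManifold I 1 P]
    (hp : p ∈ (extChartAt I p₀).source) (v : E) :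
    dchartSymm I p₀ (extChartAt I p₀ p) (dchart I p₀ p v) = v := by
  have h := mfderivWithin_extChartAt_symm_comp_mfderiv_extChartAt' (I := I) hp
  rw [I.range_eq_univ, mfderivWithin_univ] at h
  exact congrArg (fun A : E →L[ℝ] E => A v) h

theorem dchartSymm_self [I.Boundaryless] [IsManifold I 1 P] (p : P) (v : E) :
    dchartSymm I p (extChartAt I p p) v = v := by
  simpa only [dchart_self] using dchartSymm_dchart (mem_extChartAt_source (I := I) p) v

theorem contMDiffAt_extChartAt_of_mem [IsManifold I ∞ P] (hp : p ∈ (extChartAt I p₀).source) :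
    ContMDiffAt I 𝓘(ℝ, E) ∞ (extChartAt I p₀) p :=
  contMDiffAt_extChartAt' (by rwa [extChartAt_source] at hp)

theorem contMDiffAt_extChartAt_symm [I.Boundaryless] [IsManifold I ∞ P]
    (hy : y ∈ (extChartAt I p₀).target) :
    ContMDiffAt 𝓘(ℝ, E) I ∞ (extChartAt I p₀).symm y :=
  (contMDiffOn_extChartAt_symm p₀).contMDiffAt ((isOpen_extChartAt_target p₀).mem_nhds hy)

theorem contDiffAt_transition [I.Boundaryless] [IsManifold I ∞ P]
    (hy : y ∈ (extChartAt I p).target) (hq : (extChartAt I p).symm y ∈ (extChartAt I q).source) :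
    ContDiffAt ℝ ∞ (transition I p q) y :=
  ((contMDiffAt_extChartAt_of_mem hq).comp y (contMDiffAt_extChartAt_symm hy)).contDiffAt

theorem fderiv_transition [I.Boundaryless] [IsManifold I ∞ P]
    (hy : y ∈ (extChartAt I p).target) (hq : (extChartAt I p).symm y ∈ (extChartAt I q).source)
    (a : E) : fderiv ℝ (transition I p q) y a
      = dchart I q ((extChartAt I p).symm y) (dchartSymm I p y a) := by
  have h : fderiv ℝ (transition I p q) y = _ := mfderiv_eq_fderiv.symm.trans
    (mfderiv_comp y ((contMDiffAt_extChartAt_of_mem hq).mdifferentiableAt (by simp))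
      ((contMDiffAt_extChartAt_symm hy).mdifferentiableAt (by simp)))
  rw [h]
  rfl

variable {E' : Type*} [NormedAddCommGroup E'] [NormedSpace ℝ E'] {H' : Type*}
  [TopologicalSpace H'] {J : ModelWithCorners ℝ E' H'} {S : Type*} [TopologicalSpace S]
  [ChartedSpace H' S] {f : S → P} {V : ∀ y : S, TangentSpace I (f y)} {x : S}

theorem trivializationAt_snd_eventuallyEq_dchart [IsManifold I 1 P] (hf : ContinuousAt f x)
    (hx : f x ∈ (extChartAt I p₀).source) :
    (fun y => (trivializationAt E (TangentSpace I : P → Type _) p₀ ⟨f y, V y⟩).2)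
      =ᶠ[𝓝 x] fun y => dchart I p₀ (f y) (V y) := by
  filter_upwards [hf.preimage_mem_nhds ((isOpen_extChartAt_source p₀).mem_nhds hx)] with y hy
  exact trivializationAt_snd_eq_dchart hy (V y)

theorem covAlong_eq [IsManifold I 1 P] (hf : ContinuousAt f x)
    (g : ∀ p : P, TangentSpace I p → TangentSpace I p → ℝ) (v : TangentSpace J x)
    (z : TangentSpace I (f x)) : covAlong I J g f V x v z
      = g (f x) (mfderiv J 𝓘(ℝ, E) (fun y => dchart I (f x) (f y) (V y)) x v) z
        + christoffel I g (f x) (mfderiv J I f x v) (V x) z := by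
  rw [covAlong,
    (trivializationAt_snd_eventuallyEq_dchart hf (mem_extChartAt_source (f x))).mfderiv_eq]
  rfl

theorem contMDiffAt_dchart [IsManifold I ∞ P]
    (hV : ContMDiffAt J I.tangent ∞ (fun y => (⟨f y, V y⟩ : TangentBundle I P)) x)
    (hx : f x ∈ (extChartAt I p₀).source) :
    ContMDiffAt J 𝓘(ℝ, E) ∞ (fun y => dchart I p₀ (f y) (V y)) x := by
  have : IsManifold I (∞ + 1) P := by simpa
  have hx' : (⟨f x, V x⟩ : TangentBundle I P)
      ∈ (trivializationAt E (TangentSpace I : P → Type _) p₀).source := by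
    rw [Trivialization.mem_source]
    simpa using hx
  obtain ⟨hf, hV'⟩ := (Trivialization.contMDiffAt_iff (IB := I) (n := ∞)
    (f := fun y => (⟨f y, V y⟩ : TangentBundle I P)) hx').1 hV
  exact hV'.congr_of_eventuallyEq
    (trivializationAt_snd_eventuallyEq_dchart hf.continuousAt hx).symm

end Charts

section ProductCharts

variable {n : ℕ} {M : Type*} [TopologicalSpace M] [ChartedSpace (EuclideanSpace ℝ (Fin n)) M]

local notation "ℝⁿ" => EuclideanSpace ℝ (Fin n)

theorem extChartAt_prod_real (q₀ : M × ℝ) : extChartAt ((𝓡 n).prod 𝓘(ℝ, ℝ)) q₀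
    = (extChartAt (𝓡 n) q₀.1).prod (PartialEquiv.refl ℝ) := by
  rw [extChartAt_prod, extChartAt_model_space_eq_id]

variable [IsManifold (𝓡 n) ∞ M]

theorem dchart_prod {q₀ q : M × ℝ} (hq : q.1 ∈ (extChartAt (𝓡 n) q₀.1).source) (v : ℝⁿ × ℝ) :
    dchart ((𝓡 n).prod 𝓘(ℝ, ℝ)) q₀ q v = (dchart (𝓡 n) q₀.1 q.1 v.1, v.2) := by
  have h := mfderiv_prodMap (p := q)
    ((contMDiffAt_extChartAt_of_mem hq).mdifferentiableAt (by simp))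
    (mdifferentiableAt_id (I := 𝓘(ℝ, ℝ)))
  rw [dchart, extChartAt_prod_real, modelWithCornersSelf_prod, ← chartedSpaceSelf_prod]
  exact (congrArg (fun A : ℝⁿ × ℝ →L[ℝ] ℝⁿ × ℝ => A v) h).trans (by rw [mfderiv_id]; rfl)

theorem dchartSymm_prod {q₀ : M × ℝ} {z : ℝⁿ × ℝ} (hz : z.1 ∈ (extChartAt (𝓡 n) q₀.1).target)
    (a : ℝⁿ × ℝ) :
    dchartSymm ((𝓡 n).prod 𝓘(ℝ, ℝ)) q₀ z a = (dchartSymm (𝓡 n) q₀.1 z.1 a.1, a.2) := by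
  have h := mfderiv_prodMap (p := z)
    ((contMDiffAt_extChartAt_symm hz).mdifferentiableAt (by simp))
    (mdifferentiableAt_id (I := 𝓘(ℝ, ℝ)))
  rw [dchartSymm, extChartAt_prod_real, modelWithCornersSelf_prod, ← chartedSpaceSelf_prod]
  exact (congrArg (fun A : ℝⁿ × ℝ →L[ℝ] ℝⁿ × ℝ => A a) h).trans (by rw [mfderiv_id]; rfl)

theorem contMDiffOn_symmL (p₀ : M) (c : ℝⁿ) : ContMDiffOn 𝓘(ℝ, ℝⁿ) (𝓡 n).tangent ∞
    (fun y => (⟨(extChartAt (𝓡 n) p₀).symm y,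
      (trivializationAt ℝⁿ (TangentSpace (𝓡 n) : M → Type _) p₀).symmL ℝ
        ((extChartAt (𝓡 n) p₀).symm y) c⟩ : TangentBundle (𝓡 n) M))
    (extChartAt (𝓡 n) p₀).target := by
  have : IsManifold (𝓡 n) (∞ + 1) M := by simpa
  rw [Trivialization.contMDiffOn_iff
    (e := trivializationAt ℝⁿ (TangentSpace (𝓡 n) : M → Type _) p₀)]
  · refine ⟨contMDiffOn_extChartAt_symm p₀, contMDiffOn_const (c := c) |>.congr fun y hy => ?_⟩
    rw [trivializationAt_snd_eq_dchart ((extChartAt (𝓡 n) p₀).map_target hy),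
      symmL_eq_dchartSymm hy, dchart_dchartSymm hy]
  · intro y hy
    rw [Trivialization.mem_source]
    simpa using (extChartAt (𝓡 n) p₀).map_target hy

end ProductCharts

section RiemannianCharts

open Filter Topology

variable {n : ℕ} {M : Type*} [TopologicalSpace M] [ChartedSpace (EuclideanSpace ℝ (Fin n)) M]
  [RiemannianBundle (fun p : M => TangentSpace (𝓡 n) p)]

local notation "ℝⁿ" => EuclideanSpace ℝ (Fin n)

/-- The metric at `p`, as a bilinear form on the model space. -/
def metricForm (p : M) : ℝⁿ →ₗ[ℝ] ℝⁿ →ₗ[ℝ] ℝ := innerₗ (TangentSpace (𝓡 n) p)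

theorem metricForm_symm (p : M) (v w : ℝⁿ) : metricForm p v w = metricForm p w v :=
  real_inner_comm (F := TangentSpace (𝓡 n) p) w v

theorem metricForm_pos (p : M) {v : ℝⁿ} (hv : v ≠ 0) : 0 < metricForm p v v :=
  real_inner_self_pos (F := TangentSpace (𝓡 n) p).2 hv

/-- The metric in the preferred chart at `p₀`, as a family of bilinear forms. -/
def gram (p₀ : M) (y : ℝⁿ) : ℝⁿ →L[ℝ] ℝⁿ →L[ℝ] ℝ :=
  LinearMap.toContinuousBilinearMap ((metricForm ((extChartAt (𝓡 n) p₀).symm y)).compl₁₂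
    (dchartSymm (𝓡 n) p₀ y).toLinearMap (dchartSymm (𝓡 n) p₀ y).toLinearMap)

theorem gram_apply (p₀ : M) (y a b : ℝⁿ) : gram p₀ y a b
    = metricForm ((extChartAt (𝓡 n) p₀).symm y) (dchartSymm (𝓡 n) p₀ y a)
      (dchartSymm (𝓡 n) p₀ y b) := rfl

theorem prodMetric_eq (q : M × ℝ) (v w : TangentSpace ((𝓡 n).prod 𝓘(ℝ, ℝ)) q) :
    prodMetric q v w = metricForm q.1 v.1 w.1 + v.2 * w.2 := rfl

theorem gram_symm (p₀ : M) (y a b : ℝⁿ) : gram p₀ y a b = gram p₀ y b a := metricForm_symm _ _ _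

variable [IsManifold (𝓡 n) ∞ M]

theorem gram_pos {p₀ : M} {y : ℝⁿ} (hy : y ∈ (extChartAt (𝓡 n) p₀).target) {a : ℝⁿ}
    (ha : a ≠ 0) : 0 < gram p₀ y a a := by
  rw [gram_apply]
  refine metricForm_pos _ fun h => ha ?_
  rw [← dchart_dchartSymm hy a, h, map_zero]

theorem gram_self (p : M) (a b : ℝⁿ) : gram p (extChartAt (𝓡 n) p p) a b = metricForm p a b := by
  rw [gram_apply, dchartSymm_self, dchartSymm_self, extChartAt_to_inv]

theorem gram_dchart {p₀ p : M} (hp : p ∈ (extChartAt (𝓡 n) p₀).source) (v w : ℝⁿ) :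
    gram p₀ (extChartAt (𝓡 n) p₀ p) (dchart (𝓡 n) p₀ p v) (dchart (𝓡 n) p₀ p w)
      = metricForm p v w := by
  rw [gram_apply, dchartSymm_dchart hp, dchartSymm_dchart hp, (extChartAt (𝓡 n) p₀).left_inv hp]

theorem gram_transition {p q : M} {y : ℝⁿ} (hy : y ∈ (extChartAt (𝓡 n) p).target)
    (hq : (extChartAt (𝓡 n) p).symm y ∈ (extChartAt (𝓡 n) q).source) (a b : ℝⁿ) :
    gram p y a b = gram q (transition (𝓡 n) p q y)
      (fderiv ℝ (transition (𝓡 n) p q) y a) (fderiv ℝ (transition (𝓡 n) p q) y b) := by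
  rw [fderiv_transition hy hq, fderiv_transition hy hq, transition, gram_dchart hq, gram_apply]

theorem gram_eq_coordMetric {p₀ : M} {y : ℝⁿ} (hy : y ∈ (extChartAt (𝓡 n) p₀).target)
    (a b : ℝⁿ) : gram p₀ y a b = coordMetric (𝓡 n) (metric (M := M)) p₀ a b y := by
  rw [gram_apply, coordMetric, ← symmL_eq_dchartSymm hy, ← symmL_eq_dchartSymm hy]
  rfl

theorem contDiffOn_gram [IsContMDiffRiemannianBundle (𝓡 n) ∞ ℝⁿ
    (fun p : M => TangentSpace (𝓡 n) p)] (p₀ : M) :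
    ContDiffOn ℝ ∞ (gram p₀) (extChartAt (𝓡 n) p₀).target := by
  refine contDiffOn_clm_apply.2 fun a => contDiffOn_clm_apply.2 fun b => ?_
  rw [← contMDiffOn_iff_contDiffOn]
  exact ((contMDiffOn_symmL p₀ a).inner_bundle (contMDiffOn_symmL p₀ b)).congr
    fun y hy => gram_eq_coordMetric hy a b

theorem differentiableAt_gram [IsContMDiffRiemannianBundle (𝓡 n) ∞ ℝⁿ
    (fun p : M => TangentSpace (𝓡 n) p)] {p₀ : M} {y : ℝⁿ}
    (hy : y ∈ (extChartAt (𝓡 n) p₀).target) : DifferentiableAt ℝ (gram p₀) y :=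
  ((contDiffOn_gram p₀).contDiffAt ((isOpen_extChartAt_target p₀).mem_nhds hy)).differentiableAt
    (by simp)

end RiemannianCharts

section Christoffel

open Filter Topology

/-- The Christoffel symbols of the first kind of the metric `G`, given in coordinates. -/
def chris {E : Type*} [NormedAddCommGroup E] [NormedSpace ℝ E] (G : E → E →L[ℝ] E →L[ℝ] ℝ)
    (y u w z : E) : ℝ :=
  (fderiv ℝ G y u w z + fderiv ℝ G y w u z - fderiv ℝ G y z u w) / 2

variable {n : ℕ} {M : Type*} [TopologicalSpace M] [ChartedSpace (EuclideanSpace ℝ (Fin n)) M]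
  [IsManifold (𝓡 n) ∞ M] [RiemannianBundle (fun p : M => TangentSpace (𝓡 n) p)]

local notation "ℝⁿ" => EuclideanSpace ℝ (Fin n)

theorem christoffel_eq_chris [IsContMDiffRiemannianBundle (𝓡 n) ∞ ℝⁿ
    (fun p : M => TangentSpace (𝓡 n) p)] (p : M) (u w z : ℝⁿ) :
    christoffel (𝓡 n) (metric (M := M)) p u w z = chris (gram p) (extChartAt (𝓡 n) p p) u w z := by
  have h : ∀ a b c, fderiv ℝ (coordMetric (𝓡 n) (metric (M := M)) p a b)
      (extChartAt (𝓡 n) p p) c = fderiv ℝ (gram p) (extChartAt (𝓡 n) p p) c a b := by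
    intro a b c
    have hg : coordMetric (𝓡 n) (metric (M := M)) p a b =ᶠ[𝓝 (extChartAt (𝓡 n) p p)]
        fun y => gram p y a b := by
      filter_upwards [extChartAt_target_mem_nhds (I := 𝓡 n) p] with y hy
      exact (gram_eq_coordMetric hy a b).symm
    rw [hg.fderiv_eq, fderiv_bilin_const_apply (differentiableAt_gram (mem_extChartAt_target p))]
  rw [christoffel, chris, h, h, h]

theorem coordMetric_prod {q₀ : M × ℝ} {z : ℝⁿ × ℝ} (hz : z.1 ∈ (extChartAt (𝓡 n) q₀.1).target)
    (a b : ℝⁿ × ℝ) : coordMetric ((𝓡 n).prod 𝓘(ℝ, ℝ)) (prodMetric (M := M)) q₀ a b z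
      = gram q₀.1 z.1 a.1 b.1 + a.2 * b.2 := by
  have hz' : z ∈ (extChartAt ((𝓡 n).prod 𝓘(ℝ, ℝ)) q₀).target := by
    rw [extChartAt_prod_real]
    exact ⟨hz, mem_univ _⟩
  rw [coordMetric, prodMetric_eq, symmL_eq_dchartSymm hz', symmL_eq_dchartSymm hz',
    dchartSymm_prod hz, dchartSymm_prod hz, gram_apply, extChartAt_prod_real]
  rfl

theorem christoffel_prod [IsContMDiffRiemannianBundle (𝓡 n) ∞ ℝⁿ
    (fun p : M => TangentSpace (𝓡 n) p)] (q : M × ℝ) (u w z : ℝⁿ × ℝ) :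
    christoffel ((𝓡 n).prod 𝓘(ℝ, ℝ)) (prodMetric (M := M)) q u w z
      = chris (gram q.1) (extChartAt (𝓡 n) q.1 q.1) u.1 w.1 z.1 := by
  have hd := differentiableAt_gram (mem_extChartAt_target (I := 𝓡 n) q.1)
  have h : ∀ a b c, fderiv ℝ (coordMetric ((𝓡 n).prod 𝓘(ℝ, ℝ)) (prodMetric (M := M)) q a b)
      (extChartAt ((𝓡 n).prod 𝓘(ℝ, ℝ)) q q) c
        = fderiv ℝ (gram q.1) (extChartAt (𝓡 n) q.1 q.1) c.1 a.1 b.1 := by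
    intro a b c
    have hq : extChartAt ((𝓡 n).prod 𝓘(ℝ, ℝ)) q q = (extChartAt (𝓡 n) q.1 q.1, q.2) := by
      rw [extChartAt_prod_real]
      rfl
    have hg : coordMetric ((𝓡 n).prod 𝓘(ℝ, ℝ)) (prodMetric (M := M)) q a b
        =ᶠ[𝓝 (extChartAt (𝓡 n) q.1 q.1, q.2)] fun z => gram q.1 z.1 a.1 b.1 + a.2 * b.2 := by
      filter_upwards [continuousAt_fst (extChartAt_target_mem_nhds (I := 𝓡 n) q.1)] with z hz
      exact coordMetric_prod hz a b
    have hfst : HasFDerivAt (fun z : ℝⁿ × ℝ => gram q.1 z.1) _ (extChartAt (𝓡 n) q.1 q.1, q.2) :=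
      HasFDerivAt.comp (g := gram q.1) (f := fun z : ℝⁿ × ℝ => z.1) _ hd.hasFDerivAt
        (ContinuousLinearMap.fst ℝ ℝⁿ ℝ).hasFDerivAt
    rw [hq, hg.fderiv_eq, fderiv_add_const, fderiv_bilin_const_apply hfst.differentiableAt,
      hfst.fderiv]
    rfl
  rw [christoffel, chris, h, h, h]

end Christoffel

section CovariantDerivative

open Filter Topology

variable {E : Type*} [NormedAddCommGroup E] [NormedSpace ℝ E] {G : E → E →L[ℝ] E →L[ℝ] ℝ}
  {Y : E → E} {y : E}

/-- `⟨∇_a Y, b⟩` at `y`, where `∇` is the Levi-Civita connection of the metric `G`, given in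
coordinates. -/
def covDerivForm (G : E → E →L[ℝ] E →L[ℝ] ℝ) (Y : E → E) (y a b : E) : ℝ :=
  G y (fderiv ℝ Y y a) b + chris G y a (Y y) b

theorem covDerivForm_smul_smul (c d : ℝ) (a b : E) :
    covDerivForm G Y y (c • a) (d • b) = c * d * covDerivForm G Y y a b := by
  simp only [covDerivForm, chris, ContinuousLinearMap.map_smul, smul_apply, smul_eq_mul]
  ring

theorem two_mul_covDerivForm_self (hG : DifferentiableAt ℝ G y) (hY : DifferentiableAt ℝ Y y)
    (hsymm : ∀ a b, G y a b = G y b a) (a : E) :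
    2 * covDerivForm G Y y a (Y y) = fderiv ℝ (fun z => G z (Y z) (Y z)) y a := by
  rw [fderiv_bilin_apply hG hY hY, hsymm (Y y), covDerivForm, chris]
  ring

theorem lieForm_eq_covDerivForm_add (hG : DifferentiableAt ℝ G y)
    (hsymm : ∀ᶠ z in 𝓝 y, ∀ a b, G z a b = G z b a) (a b : E) :
    lieForm G Y y a b = covDerivForm G Y y a b + covDerivForm G Y y b a := by
  have hs := fderiv_bilin_symm hG hsymm
  rw [lieForm, covDerivForm, covDerivForm, chris, chris, hsymm.self_of_nhds a (fderiv ℝ Y y b),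
    hs (Y y) b a, hs a b (Y y), hs b a (Y y)]
  ring

end CovariantDerivative

section Hypersurface

open Filter Topology

variable {n : ℕ} {M : Type*} [TopologicalSpace M] [ChartedSpace (EuclideanSpace ℝ (Fin n)) M]
  {S : Type*} {f : S → M × ℝ} {N : ∀ x : S, TangentSpace ((𝓡 n).prod 𝓘(ℝ, ℝ)) (f x)}

local notation "ℝⁿ" => EuclideanSpace ℝ (Fin n)

/-- The horizontal part of the normal field. -/
def normalH (N : ∀ x : S, TangentSpace ((𝓡 n).prod 𝓘(ℝ, ℝ)) (f x)) (x : S) : ℝⁿ := (N x).1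

variable [RiemannianBundle (fun p : M => TangentSpace (𝓡 n) p)]

theorem angle_eq (x : S) : angle f N x = (N x).2 := by
  have h : angle f N x = metricForm (f x).1 (N x).1 0 + (N x).2 * 1 := rfl
  rw [h, map_zero, zero_add, mul_one]

/-- The normalized horizontal part of the normal field, with the sign of `sectionNormal`. -/
def unitNormalH (N : ∀ x : S, TangentSpace ((𝓡 n).prod 𝓘(ℝ, ℝ)) (f x)) (x : S) : ℝⁿ :=
  (-(√(1 - angle f N x ^ 2))⁻¹) • normalH N x

theorem sectionNormal_eq (x : S) : sectionNormal f N x = unitNormalH N x := by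
  have h : sectionNormal f N x
    = (-(√(1 - angle f N x ^ 2))⁻¹) • (normalH N x - angle f N x • (0 : ℝⁿ)) := rfl
  rw [h, smul_zero, sub_zero, unitNormalH]

variable [TopologicalSpace S] [ChartedSpace (EuclideanSpace ℝ (Fin n)) S]

/-- The differential of the projection of the hypersurface to `M`. -/
def dproj (f : S → M × ℝ) (x : S) : ℝⁿ →L[ℝ] ℝⁿ := mfderiv (𝓡 n) (𝓡 n) (proj f) x

variable [IsManifold (𝓡 n) ∞ M]

/-- The differential of the angle function. -/
def dangle (N : ∀ x : S, TangentSpace ((𝓡 n).prod 𝓘(ℝ, ℝ)) (f x)) (x : S) : ℝⁿ →L[ℝ] ℝ :=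
  mfderiv (𝓡 n) 𝓘(ℝ, ℝ) (angle f N) x

namespace IsOrientedHypersurface

theorem contMDiff_proj (hf : IsOrientedHypersurface f N) : ContMDiff (𝓡 n) (𝓡 n) ∞ (proj f) :=
  contMDiff_fst.comp hf.smooth

theorem contMDiff_height (hf : IsOrientedHypersurface f N) :
    ContMDiff (𝓡 n) 𝓘(ℝ, ℝ) ∞ (height f) :=
  contMDiff_snd.comp hf.smooth

theorem contMDiff_normalH (hf : IsOrientedHypersurface f N) : ContMDiff (𝓡 n) (𝓡 n).tangent ∞
    (fun x => (⟨proj f x, normalH N x⟩ : TangentBundle (𝓡 n) M)) := by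
  refine (((contMDiff_fst (I := 𝓡 n) (J := 𝓘(ℝ, ℝ)) (M := M) (N := ℝ)
    (n := ∞)).contMDiff_tangentMap (m := ∞) (by simp)).comp hf.normal_smooth).congr fun x => ?_
  simp only [Function.comp, tangentMap, mfderiv_fst]
  rfl

theorem contMDiff_angle (hf : IsOrientedHypersurface f N) :
    ContMDiff (𝓡 n) 𝓘(ℝ, ℝ) ∞ (angle f N) := by
  have h := ((contMDiff_snd (I := 𝓡 n) (J := 𝓘(ℝ, ℝ)) (M := M) (N := ℝ)
    (n := ∞)).contMDiff_tangentMap (m := ∞) (by simp)).comp hf.normal_smooth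
  refine ((contMDiff_snd_tangentBundle_modelSpace ℝ 𝓘(ℝ, ℝ)).comp h).congr fun x => ?_
  simp only [Function.comp, tangentMap, mfderiv_snd]
  exact angle_eq x

theorem mfderiv_eq (hf : IsOrientedHypersurface f N) (x : S) (v : ℝⁿ) :
    mfderiv (𝓡 n) ((𝓡 n).prod 𝓘(ℝ, ℝ)) f x v = ((dproj f x v, dheight f x v) : ℝⁿ × ℝ) :=
  congrArg (fun A : ℝⁿ →L[ℝ] ℝⁿ × ℝ => A v) (mfderiv_prodMk
    ((hf.contMDiff_proj x).mdifferentiableAt (by simp))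
    ((hf.contMDiff_height x).mdifferentiableAt (by simp)))

theorem prodMetric_mfderiv (hf : IsOrientedHypersurface f N) (x : S) (v w : ℝⁿ) :
    prodMetric (f x) (mfderiv (𝓡 n) ((𝓡 n).prod 𝓘(ℝ, ℝ)) f x v)
      (mfderiv (𝓡 n) ((𝓡 n).prod 𝓘(ℝ, ℝ)) f x w)
      = metricForm (proj f x) (dproj f x v) (dproj f x w) + dheight f x v * dheight f x w := by
  rw [prodMetric_eq, hf.mfderiv_eq x v, hf.mfderiv_eq x w]
  rfl

theorem metricForm_normalH (hf : IsOrientedHypersurface f N) (x : S) :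
    metricForm (proj f x) (normalH N x) (normalH N x) = 1 - angle f N x ^ 2 := by
  have h := hf.normal_unit x
  rw [prodMetric_eq, ← angle_eq] at h
  exact eq_sub_of_add_eq ((congrArg _ (sq _)).trans h)

theorem metricForm_normalH_dproj (hf : IsOrientedHypersurface f N) (x : S) (v : ℝⁿ) :
    metricForm (proj f x) (normalH N x) (dproj f x v) = -(angle f N x * dheight f x v) := by
  have h := hf.normal_orthogonal x v
  rw [prodMetric_eq, hf.mfderiv_eq x v, ← angle_eq] at h
  exact eq_neg_of_add_eq_zero_left h

theorem one_sub_angle_sq_pos (hf : IsOrientedHypersurface f N) {x : S}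
    (hx : angle f N x ^ 2 ≠ 1) : 0 < 1 - angle f N x ^ 2 := by
  have h := hf.metricForm_normalH x
  have hN : normalH N x ≠ 0 := fun h0 => hx <| by
    rw [h0, map_zero] at h
    exact (sub_eq_zero.1 h.symm).symm
  exact h ▸ metricForm_pos _ hN

theorem dproj_injective (hf : IsOrientedHypersurface f N) {x : S} (hx : angle f N x ≠ 0) :
    Function.Injective (dproj (n := n) f x) := by
  rw [injective_iff_map_eq_zero]
  intro v hv
  have h := hf.metricForm_normalH_dproj x v
  rw [hv, map_zero, zero_eq_neg] at h
  have hf' := hf.mfderiv_eq x v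
  rw [hv, (mul_eq_zero.1 h).resolve_left hx] at hf'
  exact hf.immersion x (hf'.trans (map_zero _).symm)

theorem dheight_eq_of_dproj_eq (hf : IsOrientedHypersurface f N) {x : S} {v : ℝⁿ}
    (hθ : angle f N x ≠ 0) (hv : dproj f x v = -angle f N x • normalH N x) :
    dheight f x v = 1 - angle f N x ^ 2 := by
  have h := hf.metricForm_normalH_dproj x v
  rw [hv, map_smul, hf.metricForm_normalH, smul_eq_mul] at h
  exact mul_left_cancel₀ hθ (by linarith)

theorem isHeightGradient (hf : IsOrientedHypersurface f N) {x : S} {v : ℝⁿ}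
    (hθ : angle f N x ≠ 0) (hv : dproj f x v = -angle f N x • normalH N x) :
    IsHeightGradient f x v := by
  have h (w : ℝⁿ) : metricForm (proj f x) (dproj f x v) (dproj f x w)
      + dheight f x v * dheight f x w = dheight f x w := by
    rw [hf.dheight_eq_of_dproj_eq hθ hv, hv, map_smul, LinearMap.smul_apply,
      hf.metricForm_normalH_dproj, smul_eq_mul]
    ring
  exact fun w => (hf.prodMetric_mfderiv x v w).trans (h w)

theorem mfderiv_dchart_normal (hf : IsOrientedHypersurface f N) (x : S) (v : ℝⁿ) :
    mfderiv (𝓡 n) 𝓘(ℝ, ℝⁿ × ℝ)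
      (fun z => dchart ((𝓡 n).prod 𝓘(ℝ, ℝ)) (f x) (f z) (N z)) x v
      = ((mfderiv (𝓡 n) 𝓘(ℝ, ℝⁿ)
          (fun z => dchart (𝓡 n) (proj f x) (proj f z) (normalH N z)) x v, dangle N x v) :
        ℝⁿ × ℝ) := by
  have hcomp : (fun z => dchart ((𝓡 n).prod 𝓘(ℝ, ℝ)) (f x) (f z) (N z))
      =ᶠ[𝓝 x] fun z => (dchart (𝓡 n) (proj f x) (proj f z) (normalH N z), angle f N z) := by
    filter_upwards [hf.contMDiff_proj.continuous.continuousAt.preimage_mem_nhds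
      (extChartAt_source_mem_nhds (I := 𝓡 n) (proj f x))] with z hz
    exact (dchart_prod hz (N z)).trans (congrArg _ (angle_eq z).symm)
  have hN : MDifferentiableAt (𝓡 n) 𝓘(ℝ, ℝⁿ)
      (fun z => dchart (𝓡 n) (proj f x) (proj f z) (normalH N z)) x :=
    (contMDiffAt_dchart (hf.contMDiff_normalH x) (mem_extChartAt_source _)).mdifferentiableAt
      (by simp)
  have hθ : MDifferentiableAt (𝓡 n) 𝓘(ℝ, ℝ) (angle f N) x :=
    (hf.contMDiff_angle x).mdifferentiableAt (by simp)
  rw [hcomp.mfderiv_eq, modelWithCornersSelf_prod, ← chartedSpaceSelf_prod]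
  exact congrArg (fun A : ℝⁿ →L[ℝ] ℝⁿ × ℝ => A v) (mfderiv_prodMk hN hθ)

theorem shapeForm_eq [IsContMDiffRiemannianBundle (𝓡 n) ∞ ℝⁿ (fun p : M => TangentSpace (𝓡 n) p)]
    (hf : IsOrientedHypersurface f N) (x : S) (v w : ℝⁿ) :
    shapeForm ((𝓡 n).prod 𝓘(ℝ, ℝ)) (𝓡 n) prodMetric f N x v w
      = -(covAlong (𝓡 n) (𝓡 n) metric (proj f) (normalH N) x v (dproj f x w)
        + dangle N x v * dheight f x w) := by
  have h := covAlong_eq (J := 𝓡 n) hf.smooth.continuous.continuousAt prodMetric (V := N)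
    v (mfderiv (𝓡 n) ((𝓡 n).prod 𝓘(ℝ, ℝ)) f x w)
  rw [hf.mfderiv_dchart_normal x v, hf.mfderiv_eq x v, hf.mfderiv_eq x w] at h
  have hM := covAlong_eq (J := 𝓡 n) hf.contMDiff_proj.continuous.continuousAt metric
    (V := normalH N) (x := x) v (dproj f x w)
  have hw := congrArg (covAlong ((𝓡 n).prod 𝓘(ℝ, ℝ)) (𝓡 n) prodMetric f N x v) (hf.mfderiv_eq x w)
  refine congrArg Neg.neg ((hw.trans h).trans ((congrArg₂ (· + ·) (prodMetric_eq _ _ _)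
    (christoffel_prod _ _ _ _)).trans ?_))
  exact (add_right_comm _ _ _).trans
    (congrArg (· + _) (hM.trans (congrArg _ (christoffel_eq_chris _ _ _ _))).symm)

end IsOrientedHypersurface

end Hypersurface

section LocalSections

open Filter Topology

variable {n : ℕ} {M : Type*} [TopologicalSpace M] [ChartedSpace (EuclideanSpace ℝ (Fin n)) M]
  {S : Type*} {f : S → M × ℝ} {p₀ : M}

local notation "ℝⁿ" => EuclideanSpace ℝ (Fin n)

/-- The field `V` along the projection to `M`, read in the preferred chart at `p₀` by means of the
local section `σ`. -/
def chartField (f : S → M × ℝ) (p₀ : M) (σ : ℝⁿ → S) (V : S → ℝⁿ) (y : ℝⁿ) : ℝⁿ :=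
  dchart (𝓡 n) p₀ (proj f (σ y)) (V (σ y))

theorem chartField_smul (σ : ℝⁿ → S) (k : S → ℝ) (V : S → ℝⁿ) :
    chartField f p₀ σ (fun x => k x • V x) = fun y => k (σ y) • chartField f p₀ σ V y :=
  funext fun _ => map_smul _ _ _

variable [TopologicalSpace S] [ChartedSpace (EuclideanSpace ℝ (Fin n)) S]

/-- The differential at `y` of a map `σ` from the model space to the hypersurface. -/
def dsection (σ : ℝⁿ → S) (y : ℝⁿ) : ℝⁿ →L[ℝ] ℝⁿ := mfderiv 𝓘(ℝ, ℝⁿ) (𝓡 n) σ y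

/-- `σ` is a smooth local section of the projection of the hypersurface to `M`, over the open set
`U` of the preferred chart at `p₀`. It presents a piece of the hypersurface as a vertical graph. -/
structure IsLocalSection (f : S → M × ℝ) (p₀ : M) (U : Set ℝⁿ) (σ : ℝⁿ → S) : Prop where
  isOpen : IsOpen U
  subset : U ⊆ (extChartAt (𝓡 n) p₀).target
  smooth : ContMDiffOn 𝓘(ℝ, ℝⁿ) (𝓡 n) ∞ σ U
  proj_eq : ∀ y ∈ U, proj f (σ y) = (extChartAt (𝓡 n) p₀).symm y

namespace IsLocalSection

variable {U : Set (EuclideanSpace ℝ (Fin n))} {σ : EuclideanSpace ℝ (Fin n) → S}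
  {y : EuclideanSpace ℝ (Fin n)}

theorem contMDiffAt (hσ : IsLocalSection f p₀ U σ) (hy : y ∈ U) :
    ContMDiffAt 𝓘(ℝ, ℝⁿ) (𝓡 n) ∞ σ y :=
  hσ.smooth.contMDiffAt (hσ.isOpen.mem_nhds hy)

theorem proj_mem (hσ : IsLocalSection f p₀ U σ) (hy : y ∈ U) :
    proj f (σ y) ∈ (extChartAt (𝓡 n) p₀).source :=
  hσ.proj_eq y hy ▸ (extChartAt (𝓡 n) p₀).map_target (hσ.subset hy)

theorem chart_proj (hσ : IsLocalSection f p₀ U σ) (hy : y ∈ U) :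
    extChartAt (𝓡 n) p₀ (proj f (σ y)) = y := by
  rw [hσ.proj_eq y hy, (extChartAt (𝓡 n) p₀).right_inv (hσ.subset hy)]

theorem contDiffOn_comp {F : Type*} [NormedAddCommGroup F] [NormedSpace ℝ F] {φ : S → F}
    (hσ : IsLocalSection f p₀ U σ) (hφ : ContMDiff (𝓡 n) 𝓘(ℝ, F) ∞ φ) :
    ContDiffOn ℝ ∞ (fun z => φ (σ z)) U :=
  (hφ.comp_contMDiffOn hσ.smooth).contDiffOn

theorem fderiv_comp {F : Type*} [NormedAddCommGroup F] [NormedSpace ℝ F] {φ : S → F}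
    (hσ : IsLocalSection f p₀ U σ) (hy : y ∈ U) (hφ : MDifferentiableAt (𝓡 n) 𝓘(ℝ, F) φ (σ y))
    (a : ℝⁿ) :
    fderiv ℝ (fun z => φ (σ z)) y a = mfderiv (𝓡 n) 𝓘(ℝ, F) φ (σ y) (dsection σ y a) :=
  congrArg (fun A : ℝⁿ →L[ℝ] F => A a) (mfderiv_eq_fderiv.symm.trans
    (mfderiv_comp y hφ ((hσ.contMDiffAt hy).mdifferentiableAt (by simp))))

theorem transition_transition (hσ : IsLocalSection f p₀ U σ) {q : M} (hy : y ∈ U)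
    (hq : proj f (σ y) ∈ (extChartAt (𝓡 n) q).source) :
    transition (𝓡 n) q p₀ (transition (𝓡 n) p₀ q y) = y := by
  rw [transition, transition, ← hσ.proj_eq y hy, (extChartAt (𝓡 n) q).left_inv hq,
    hσ.chart_proj hy]

theorem transition_mem (hσ : IsLocalSection f p₀ U σ) {q : M} (hy : y ∈ U)
    (hq : proj f (σ y) ∈ (extChartAt (𝓡 n) q).source) :
    transition (𝓡 n) p₀ q y ∈ ((extChartAt (𝓡 n) q).target ∩ (extChartAt (𝓡 n) q).symm ⁻¹'
      (extChartAt (𝓡 n) p₀).source) ∩ transition (𝓡 n) q p₀ ⁻¹' U := by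
  have hτ : transition (𝓡 n) p₀ q y = extChartAt (𝓡 n) q (proj f (σ y)) := by
    rw [transition, ← hσ.proj_eq y hy]
  refine ⟨⟨hτ ▸ (extChartAt (𝓡 n) q).map_source hq, ?_⟩, ?_⟩
  · rw [mem_preimage, hτ, (extChartAt (𝓡 n) q).left_inv hq]
    exact hσ.proj_mem hy
  · rwa [mem_preimage, hσ.transition_transition hy hq]

theorem dproj_dsection (hproj : ContMDiff (𝓡 n) (𝓡 n) ∞ (proj f))
    (hσ : IsLocalSection f p₀ U σ) (hy : y ∈ U) (a : ℝⁿ) :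
    dproj f (σ y) (dsection σ y a) = dchartSymm (𝓡 n) p₀ y a := by
  have h : (fun z => proj f (σ z)) =ᶠ[𝓝 y] (extChartAt (𝓡 n) p₀).symm := by
    filter_upwards [hσ.isOpen.mem_nhds hy] with z hz using hσ.proj_eq z hz
  exact congrArg (fun A : ℝⁿ →L[ℝ] ℝⁿ => A a) ((mfderiv_comp y
    (hproj.mdifferentiableAt (by simp))
    ((hσ.contMDiffAt hy).mdifferentiableAt (by simp))).symm.trans h.mfderiv_eq)

variable [IsManifold (𝓡 n) ∞ M]

theorem transition_comp (hσ : IsLocalSection f p₀ U σ) (q : M) :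
    IsLocalSection f q (((extChartAt (𝓡 n) q).target ∩ (extChartAt (𝓡 n) q).symm ⁻¹'
      (extChartAt (𝓡 n) p₀).source) ∩ transition (𝓡 n) q p₀ ⁻¹' U)
      (fun z => σ (transition (𝓡 n) q p₀ z)) where
  isOpen := ContinuousOn.isOpen_inter_preimage
    (fun z hz => (contDiffAt_transition hz.1 hz.2).continuousAt.continuousWithinAt)
    ((continuousOn_extChartAt_symm q).isOpen_inter_preimage (isOpen_extChartAt_target q)
      (isOpen_extChartAt_source p₀)) hσ.isOpen
  subset _ hz := hz.1.1
  smooth z hz := ((hσ.contMDiffAt hz.2).comp z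
    (contDiffAt_transition hz.1.1 hz.1.2).contMDiffAt).contMDiffWithinAt
  proj_eq z hz := by rw [hσ.proj_eq _ hz.2, transition, (extChartAt (𝓡 n) p₀).left_inv hz.1.2]

theorem fderiv_transition_chartField (hσ : IsLocalSection f p₀ U σ) {q : M} (hy : y ∈ U)
    (hq : proj f (σ y) ∈ (extChartAt (𝓡 n) q).source) (V : S → ℝⁿ) :
    fderiv ℝ (transition (𝓡 n) p₀ q) y (chartField f p₀ σ V y) = chartField f q σ V y := by
  have h := dchartSymm_dchart (hσ.proj_mem hy) (V (σ y))
  rw [hσ.chart_proj hy] at h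
  rw [fderiv_transition (hσ.subset hy) (hσ.proj_eq y hy ▸ hq), chartField, h, chartField,
    ← hσ.proj_eq y hy]

theorem contDiffOn_chartField {V : S → ℝⁿ} (hσ : IsLocalSection f p₀ U σ)
    (hV : ContMDiff (𝓡 n) (𝓡 n).tangent ∞ (fun x => (⟨proj f x, V x⟩ : TangentBundle (𝓡 n) M))) :
    ContDiffOn ℝ ∞ (chartField f p₀ σ V) U := fun y hy =>
  ((contMDiffAt_dchart (hV (σ y)) (hσ.proj_mem hy)).comp y
    (hσ.contMDiffAt hy)).contDiffAt.contDiffWithinAt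

theorem differentiableAt_chartField {V : S → ℝⁿ} (hσ : IsLocalSection f p₀ U σ) (hy : y ∈ U)
    (hV : ContMDiff (𝓡 n) (𝓡 n).tangent ∞ (fun x => (⟨proj f x, V x⟩ : TangentBundle (𝓡 n) M))) :
    DifferentiableAt ℝ (chartField f p₀ σ V) y :=
  ((hσ.contDiffOn_chartField hV).contDiffAt (hσ.isOpen.mem_nhds hy)).differentiableAt (by simp)

theorem dproj_dsection_self (hproj : ContMDiff (𝓡 n) (𝓡 n) ∞ (proj f))
    (hσ : IsLocalSection f (proj f (σ y)) U σ) (hy : y ∈ U) (a : ℝⁿ) :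
    dproj f (σ y) (dsection σ y a) = a := by
  rw [hσ.dproj_dsection hproj hy]
  simpa only [hσ.chart_proj hy] using dchartSymm_self (I := 𝓡 n) (proj f (σ y)) a

variable [RiemannianBundle (fun p : M => TangentSpace (𝓡 n) p)]

theorem gram_chartField (hσ : IsLocalSection f p₀ U σ) (hy : y ∈ U) (V W : S → ℝⁿ) :
    gram p₀ y (chartField f p₀ σ V y) (chartField f p₀ σ W y)
      = metricForm (proj f (σ y)) (V (σ y)) (W (σ y)) := by
  have h := gram_dchart (hσ.proj_mem hy) (V (σ y)) (W (σ y))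
  rwa [hσ.chart_proj hy] at h

theorem gram_chartField_left (hproj : ContMDiff (𝓡 n) (𝓡 n) ∞ (proj f))
    (hσ : IsLocalSection f p₀ U σ) (hy : y ∈ U) (V : S → ℝⁿ) (a : ℝⁿ) :
    gram p₀ y (chartField f p₀ σ V y) a
      = metricForm (proj f (σ y)) (V (σ y)) (dproj f (σ y) (dsection σ y a)) := by
  have h := dchartSymm_dchart (hσ.proj_mem hy) (V (σ y))
  rw [hσ.chart_proj hy] at h
  rw [gram_apply, chartField, h, hσ.dproj_dsection hproj hy, hσ.proj_eq y hy]

theorem covAlong_proj [IsContMDiffRiemannianBundle (𝓡 n) ∞ ℝⁿ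
    (fun p : M => TangentSpace (𝓡 n) p)] {V : S → ℝⁿ} (hproj : ContMDiff (𝓡 n) (𝓡 n) ∞ (proj f))
    (hV : ContMDiff (𝓡 n) (𝓡 n).tangent ∞ (fun x => (⟨proj f x, V x⟩ : TangentBundle (𝓡 n) M)))
    (hσ : IsLocalSection f (proj f (σ y)) U σ) (hy : y ∈ U) (a b : ℝⁿ) :
    covAlong (𝓡 n) (𝓡 n) metric (proj f) V (σ y) (dsection σ y a)
        (dproj f (σ y) (dsection σ y b))
      = covDerivForm (gram (proj f (σ y))) (chartField f (proj f (σ y)) σ V) y a b := by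
  have hd := hσ.fderiv_comp hy ((contMDiffAt_dchart (hV (σ y))
    (mem_extChartAt_source (I := 𝓡 n) _)).mdifferentiableAt (by simp)) a
  have hg (u w : ℝⁿ) : metricForm (proj f (σ y)) u w = gram (proj f (σ y)) y u w := by
    rw [← gram_self, hσ.chart_proj hy]
  refine (covAlong_eq hproj.continuous.continuousAt metric _ _).trans (congrArg₂ (· + ·)
    ((congrArg₂ (fun u w => metricForm (proj f (σ y)) u w) hd.symm
      (hσ.dproj_dsection_self hproj hy b)).trans (hg _ _))
    ((christoffel_eq_chris _ _ _ _).trans ?_))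
  rw [hσ.chart_proj hy, hσ.dproj_dsection_self hproj hy b]
  exact congrArg₂ (fun u w => chris _ y u w b) (hσ.dproj_dsection_self hproj hy a)
    (dchart_self _ _).symm

end IsLocalSection

end LocalSections

section KillingField

open Filter Topology

variable {n : ℕ} {M : Type*} [TopologicalSpace M] [ChartedSpace (EuclideanSpace ℝ (Fin n)) M]
  [IsManifold (𝓡 n) ∞ M] {S : Type*} [TopologicalSpace S]
  [ChartedSpace (EuclideanSpace ℝ (Fin n)) S] {f : S → M × ℝ}

local notation "ℝⁿ" => EuclideanSpace ℝ (Fin n)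

theorem contMDiff_smul_along {g : S → M} {k : S → ℝ} {V : S → ℝⁿ}
    (hk : ContMDiff (𝓡 n) 𝓘(ℝ, ℝ) ∞ k)
    (hV : ContMDiff (𝓡 n) (𝓡 n).tangent ∞ (fun x => (⟨g x, V x⟩ : TangentBundle (𝓡 n) M))) :
    ContMDiff (𝓡 n) (𝓡 n).tangent ∞
      (fun x => (⟨g x, k x • V x⟩ : TangentBundle (𝓡 n) M)) := by
  intro x
  have : IsManifold (𝓡 n) (∞ + 1) M := by simpa
  have hmem (v : TangentSpace (𝓡 n) (g x)) : (⟨g x, v⟩ : TangentBundle (𝓡 n) M)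
      ∈ (trivializationAt ℝⁿ (TangentSpace (𝓡 n) : M → Type _) (g x)).source := by
    rw [Trivialization.mem_source]
    exact FiberBundle.mem_baseSet_trivializationAt' _
  obtain ⟨hg, -⟩ := (Trivialization.contMDiffAt_iff (IB := 𝓡 n) (n := ∞)
    (f := fun x => (⟨g x, V x⟩ : TangentBundle (𝓡 n) M)) (hmem _)).1 (hV x)
  refine (Trivialization.contMDiffAt_iff (IB := 𝓡 n) (n := ∞)
    (f := fun x => (⟨g x, k x • V x⟩ : TangentBundle (𝓡 n) M)) (hmem _)).2 ⟨hg, ?_⟩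
  have h := (hk x).smul (contMDiffAt_dchart (hV x) (mem_extChartAt_source (I := 𝓡 n) (g x)))
  refine h.congr_of_eventuallyEq ?_
  filter_upwards [trivializationAt_snd_eventuallyEq_dchart (V := fun x => k x • V x)
    hg.continuousAt (mem_extChartAt_source (I := 𝓡 n) (g x))] with z hz
  exact hz.trans (map_smul _ _ _)

/-- The slope `θ / √(1 - θ²)` of a hypersurface with angle function `θ`. -/
def slope (θ : ℝ) : ℝ := θ / √(1 - θ ^ 2)

theorem contDiffAt_inv_sqrt_one_sub_sq {θ : ℝ} (hθ : 0 < 1 - θ ^ 2) :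
    ContDiffAt ℝ ∞ (fun t : ℝ => (√(1 - t ^ 2))⁻¹) θ := by
  have h : ContDiffAt ℝ ∞ (fun t : ℝ => 1 - t ^ 2) θ := by fun_prop
  exact (h.sqrt hθ.ne').inv (Real.sqrt_pos.2 hθ).ne'

theorem contDiffAt_slope {θ : ℝ} (hθ : 0 < 1 - θ ^ 2) : ContDiffAt ℝ ∞ slope θ :=
  contDiffAt_id.mul (contDiffAt_inv_sqrt_one_sub_sq hθ)

variable [RiemannianBundle (fun p : M => TangentSpace (𝓡 n) p)]
  {N : ∀ x : S, TangentSpace ((𝓡 n).prod 𝓘(ℝ, ℝ)) (f x)}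

/-- The horizontal field along the hypersurface that is normal to the horizontal sections and along
which the height, seen as a function on the projection to `M`, grows at unit speed. -/
def killing (N : ∀ x : S, TangentSpace ((𝓡 n).prod 𝓘(ℝ, ℝ)) (f x)) (x : S) : ℝⁿ :=
  slope (angle f N x) • unitNormalH N x

namespace IsOrientedHypersurface

theorem metricForm_unitNormalH_dproj (hf : IsOrientedHypersurface f N) (x : S) (v : ℝⁿ) :
    metricForm (proj f x) (unitNormalH N x) (dproj f x v)
      = slope (angle f N x) * dheight f x v := by
  rw [unitNormalH, map_smul, LinearMap.smul_apply, hf.metricForm_normalH_dproj, smul_eq_mul,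
    slope]
  ring

theorem metricForm_unitNormalH (hf : IsOrientedHypersurface f N) {x : S}
    (hx : angle f N x ^ 2 ≠ 1) :
    metricForm (proj f x) (unitNormalH N x) (unitNormalH N x) = 1 := by
  have hpos := hf.one_sub_angle_sq_pos hx
  have hsq := Real.sq_sqrt hpos.le
  have hne := (Real.sqrt_pos.2 hpos).ne'
  rw [unitNormalH, map_smul, map_smul, LinearMap.smul_apply, hf.metricForm_normalH,
    smul_eq_mul, smul_eq_mul, ← hsq, Real.sqrt_sq (Real.sqrt_nonneg _)]
  field_simp

theorem contMDiff_unitNormalH (hf : IsOrientedHypersurface f N)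
    (hN : ∀ x, angle f N x ^ 2 ≠ 1) : ContMDiff (𝓡 n) (𝓡 n).tangent ∞
      (fun x => (⟨proj f x, unitNormalH N x⟩ : TangentBundle (𝓡 n) M)) := by
  have hk : ContMDiff (𝓡 n) 𝓘(ℝ, ℝ) ∞ (fun x => -(√(1 - angle f N x ^ 2))⁻¹) := fun x =>
    (contDiffAt_inv_sqrt_one_sub_sq (hf.one_sub_angle_sq_pos (hN x))).neg.comp_contMDiffAt
      (hf.contMDiff_angle x)
  exact contMDiff_smul_along hk hf.contMDiff_normalH

theorem contMDiff_slope_angle (hf : IsOrientedHypersurface f N) (hN : ∀ x, angle f N x ^ 2 ≠ 1) :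
    ContMDiff (𝓡 n) 𝓘(ℝ, ℝ) ∞ (fun x => slope (angle f N x)) := fun x =>
  (contDiffAt_slope (hf.one_sub_angle_sq_pos (hN x))).comp_contMDiffAt (hf.contMDiff_angle x)

theorem contMDiff_killing (hf : IsOrientedHypersurface f N) (hN : ∀ x, angle f N x ^ 2 ≠ 1) :
    ContMDiff (𝓡 n) (𝓡 n).tangent ∞
      (fun x => (⟨proj f x, killing N x⟩ : TangentBundle (𝓡 n) M)) :=
  contMDiff_smul_along (hf.contMDiff_slope_angle hN) (hf.contMDiff_unitNormalH hN)

theorem slope_angle_ne_zero (hf : IsOrientedHypersurface f N) {x : S}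
    (hx : angle f N x ^ 2 ≠ 1) (hθ : angle f N x ≠ 0) : slope (angle f N x) ≠ 0 :=
  div_ne_zero hθ (Real.sqrt_pos.2 (hf.one_sub_angle_sq_pos hx)).ne'

end IsOrientedHypersurface

namespace IsLocalSection

variable {p₀ : M} {U : Set (EuclideanSpace ℝ (Fin n))} {σ : EuclideanSpace ℝ (Fin n) → S}
  {y : EuclideanSpace ℝ (Fin n)}

theorem fderiv_height (hf : IsOrientedHypersurface f N) (hσ : IsLocalSection f p₀ U σ)
    (hy : y ∈ U) (a : ℝⁿ) :
    fderiv ℝ (fun z => height f (σ z)) y a = dheight f (σ y) (dsection σ y a) :=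
  hσ.fderiv_comp hy ((hf.contMDiff_height _).mdifferentiableAt (by simp)) a

theorem gram_killing_left (hf : IsOrientedHypersurface f N) (hσ : IsLocalSection f p₀ U σ)
    (hy : y ∈ U) (a : ℝⁿ) : gram p₀ y (chartField f p₀ σ (killing N) y) a
      = slope (angle f N (σ y)) ^ 2 * fderiv ℝ (fun z => height f (σ z)) y a := by
  rw [hσ.gram_chartField_left hf.contMDiff_proj hy, killing, map_smul, LinearMap.smul_apply,
    hf.metricForm_unitNormalH_dproj, hσ.fderiv_height hf hy, smul_eq_mul]
  ring

theorem fderiv_height_killing (hf : IsOrientedHypersurface f N) (hσ : IsLocalSection f p₀ U σ)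
    (hy : y ∈ U) (hN : angle f N (σ y) ^ 2 ≠ 1) (hθ : angle f N (σ y) ≠ 0) :
    fderiv ℝ (fun z => height f (σ z)) y (chartField f p₀ σ (killing N) y) = 1 := by
  have h := hσ.gram_killing_left hf hy (chartField f p₀ σ (killing N) y)
  rw [hσ.gram_chartField hy, killing, map_smul, map_smul, LinearMap.smul_apply,
    hf.metricForm_unitNormalH hN, smul_eq_mul, smul_eq_mul, mul_one, ← sq] at h
  exact (mul_eq_left₀ (pow_ne_zero 2 (hf.slope_angle_ne_zero hN hθ))).1 h.symm

variable [IsContMDiffRiemannianBundle (𝓡 n) ∞ (EuclideanSpace ℝ (Fin n))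
  (fun p : M => TangentSpace (𝓡 n) p)]

theorem fderiv_angle_normalH_eq_zero (hf : IsOrientedHypersurface f N)
    (hσ : IsLocalSection f (proj f (σ y)) U σ) (hy : y ∈ U) (hθ : angle f N (σ y) ≠ 0)
    (hA : ∀ v : ℝⁿ, IsHeightGradient f (σ y) v →
      shapeForm ((𝓡 n).prod 𝓘(ℝ, ℝ)) (𝓡 n) prodMetric f N (σ y) v v = 0) :
    fderiv ℝ (fun z => angle f N (σ z)) y (chartField f (proj f (σ y)) σ (normalH N) y) = 0 := by
  have hUy := hσ.isOpen.mem_nhds hy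
  set Y := chartField f (proj f (σ y)) σ (normalH N) with hYdef
  set v := dsection σ y (-angle f N (σ y) • Y y)
  have hYy : Y y = normalH N (σ y) := dchart_self _ _
  have hv : dproj f (σ y) v = -angle f N (σ y) • normalH N (σ y) := by
    rw [hσ.dproj_dsection_self hf.contMDiff_proj hy, hYy]
  have hdangle : dangle N (σ y) v = _ :=
    (hσ.fderiv_comp hy ((hf.contMDiff_angle _).mdifferentiableAt (by simp)) _).symm
  have hasymp := hA v (hf.isHeightGradient hθ hv)
  rw [hf.shapeForm_eq, hσ.covAlong_proj hf.contMDiff_proj hf.contMDiff_normalH hy,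
    covDerivForm_smul_smul, hf.dheight_eq_of_dproj_eq hθ hv, hdangle, map_smul, smul_eq_mul]
    at hasymp
  have hθd : DifferentiableAt ℝ (fun z => angle f N (σ z)) y :=
    ((hσ.contDiffOn_comp hf.contMDiff_angle).contDiffAt hUy).differentiableAt (by simp)
  have hunit : (fun z => gram (proj f (σ y)) z (Y z) (Y z))
      =ᶠ[𝓝 y] fun z => 1 - angle f N (σ z) ^ 2 := by
    filter_upwards [hUy] with z hz
    rw [hσ.gram_chartField hz, hf.metricForm_normalH]
  have hY := two_mul_covDerivForm_self (differentiableAt_gram (hσ.subset hy))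
    (((hσ.contDiffOn_chartField hf.contMDiff_normalH).contDiffAt hUy).differentiableAt (by simp))
    (gram_symm _ _) (Y y)
  rw [hunit.fderiv_eq, ((hθd.hasFDerivAt.pow 2).const_sub 1).fderiv] at hY
  simp only [← hYdef, Nat.add_one_sub_one, pow_one, nsmul_eq_mul, Nat.cast_ofNat, neg_apply,
    smul_apply, smul_eq_mul] at hY
  refine (mul_eq_zero.1 ?_).resolve_left hθ
  linear_combination hasymp + angle f N (σ y) ^ 2 / 2 * hY

end IsLocalSection

end KillingField

section KillingEquation

open Filter Topology

variable {n : ℕ} {M : Type*} [TopologicalSpace M] [ChartedSpace (EuclideanSpace ℝ (Fin n)) M]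
  [IsManifold (𝓡 n) ∞ M] [RiemannianBundle (fun p : M => TangentSpace (𝓡 n) p)]
  {S : Type*} [TopologicalSpace S] [ChartedSpace (EuclideanSpace ℝ (Fin n)) S] {f : S → M × ℝ}
  {N : ∀ x : S, TangentSpace ((𝓡 n).prod 𝓘(ℝ, ℝ)) (f x)} {p₀ : M}
  {U : Set (EuclideanSpace ℝ (Fin n))} {σ : EuclideanSpace ℝ (Fin n) → S}
  {y : EuclideanSpace ℝ (Fin n)}

local notation "ℝⁿ" => EuclideanSpace ℝ (Fin n)

theorem sectionShapeForm_eq (x : S) (v w : ℝⁿ) : sectionShapeForm f N x v w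
    = -covAlong (𝓡 n) (𝓡 n) metric (proj f) (unitNormalH N) x v (dproj f x w) :=
  congrArg (fun V : S → ℝⁿ => -covAlong (𝓡 n) (𝓡 n) metric (proj f) V x v (dproj f x w))
    (funext sectionNormal_eq)

namespace IsLocalSection

theorem contDiffAt_slope_angle (hf : IsOrientedHypersurface f N)
    (hN : ∀ x, angle f N x ^ 2 ≠ 1) (hσ : IsLocalSection f p₀ U σ) (hy : y ∈ U) :
    ContDiffAt ℝ ∞ (fun z => slope (angle f N (σ z))) y :=
  (hσ.contDiffOn_comp (hf.contMDiff_slope_angle hN)).contDiffAt (hσ.isOpen.mem_nhds hy)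

variable [IsContMDiffRiemannianBundle (𝓡 n) ∞ (EuclideanSpace ℝ (Fin n))
  (fun p : M => TangentSpace (𝓡 n) p)]

theorem fderiv_slope_sq_killing_eq_zero (hf : IsOrientedHypersurface f N)
    (hσ : IsLocalSection f (proj f (σ y)) U σ) (hy : y ∈ U) (hN : angle f N (σ y) ^ 2 ≠ 1)
    (hθ : angle f N (σ y) ≠ 0)
    (hA : ∀ v : ℝⁿ, IsHeightGradient f (σ y) v →
      shapeForm ((𝓡 n).prod 𝓘(ℝ, ℝ)) (𝓡 n) prodMetric f N (σ y) v v = 0) :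
    fderiv ℝ (fun z => slope (angle f N (σ z)) ^ 2) y
      (chartField f (proj f (σ y)) σ (killing N) y) = 0 := by
  have hslope : DifferentiableAt ℝ (fun t => slope t ^ 2) (angle f N (σ y)) :=
    ((contDiffAt_slope (hf.one_sub_angle_sq_pos hN)).pow 2).differentiableAt (by simp)
  have hangle : DifferentiableAt ℝ (fun z => angle f N (σ z)) y :=
    ((hσ.contDiffOn_comp hf.contMDiff_angle).contDiffAt
      (hσ.isOpen.mem_nhds hy)).differentiableAt (by simp)
  have hdir : fderiv ℝ (fun z => angle f N (σ z)) y
      (chartField f (proj f (σ y)) σ (killing N) y) = 0 := by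
    simp only [chartField, killing, unitNormalH, map_smul]
    exact smul_eq_zero_of_right _ (smul_eq_zero_of_right _
      (hσ.fderiv_angle_normalH_eq_zero hf hy hθ hA))
  have hcomp : fderiv ℝ (fun z => slope (angle f N (σ z)) ^ 2) y = _ :=
    _root_.fderiv_comp (g := fun t => slope t ^ 2) y hslope hangle
  rw [hcomp, ContinuousLinearMap.comp_apply, hdir, map_zero]

theorem covDerivForm_unitNormalH (hf : IsOrientedHypersurface f N)
    (hN : ∀ x, angle f N x ^ 2 ≠ 1) (hσ : IsLocalSection f (proj f (σ y)) U σ) (hy : y ∈ U)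
    (a b : ℝⁿ) : covDerivForm (gram (proj f (σ y)))
        (chartField f (proj f (σ y)) σ (unitNormalH N)) y a b
      = -sectionShapeForm f N (σ y) (dsection σ y a) (dsection σ y b) := by
  rw [sectionShapeForm_eq, hσ.covAlong_proj hf.contMDiff_proj (hf.contMDiff_unitNormalH hN) hy,
    neg_neg]

theorem lieForm_killing_of_horizontal (hf : IsOrientedHypersurface f N)
    (hN : ∀ x, angle f N x ^ 2 ≠ 1) (hσ : IsLocalSection f (proj f (σ y)) U σ) (hy : y ∈ U)
    (hgeod : TotallyGeodesicSections f N) {a b : ℝⁿ}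
    (ha : dheight f (σ y) (dsection σ y a) = 0) (hb : dheight f (σ y) (dsection σ y b) = 0) :
    lieForm (gram (proj f (σ y))) (chartField f (proj f (σ y)) σ (killing N)) y a b = 0 := by
  have hη (c : ℝⁿ) (hc : dheight f (σ y) (dsection σ y c) = 0) :
      gram (proj f (σ y)) y (chartField f (proj f (σ y)) σ (unitNormalH N) y) c = 0 := by
    rw [hσ.gram_chartField_left hf.contMDiff_proj hy, hf.metricForm_unitNormalH_dproj, hc, mul_zero]
  have hkilling : chartField f (proj f (σ y)) σ (killing N) = _ :=
    chartField_smul σ (fun x => slope (angle f N x)) (unitNormalH N)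
  have hsymm : ∀ᶠ z in 𝓝 y, ∀ a b, gram (proj f (σ y)) z a b = gram (proj f (σ y)) z b a :=
    .of_forall fun z => gram_symm _ z
  rw [hkilling, lieForm_smul ((hσ.contDiffAt_slope_angle hf hN hy).differentiableAt (by simp))
    (hσ.differentiableAt_chartField hy (hf.contMDiff_unitNormalH hN)), gram_symm _ _ a, hη a ha,
    hη b hb, lieForm_eq_covDerivForm_add (differentiableAt_gram (hσ.subset hy)) hsymm,
    hσ.covDerivForm_unitNormalH hf hN hy, hσ.covDerivForm_unitNormalH hf hN hy,
    hgeod _ _ _ ha hb, hgeod _ _ _ hb ha]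
  simp

theorem lieForm_killing_self (hf : IsOrientedHypersurface f N) (hN : ∀ x, angle f N x ^ 2 ≠ 1)
    (hθ : ∀ x, angle f N x ≠ 0)
    (hA : ∀ (x : S) (v : ℝⁿ), IsHeightGradient f x v →
      shapeForm ((𝓡 n).prod 𝓘(ℝ, ℝ)) (𝓡 n) prodMetric f N x v v = 0)
    (hgeod : TotallyGeodesicSections f N) (hσ : IsLocalSection f p₀ U σ) (hy : y ∈ U)
    (hp₀ : proj f (σ y) = p₀) (a b : ℝⁿ) :
    lieForm (gram p₀) (chartField f p₀ σ (killing N)) y a b = 0 := by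
  subst hp₀
  have hUy := hσ.isOpen.mem_nhds hy
  refine lieForm_eq_zero_of_ker (u := fun z => height f (σ z))
    (ρ := fun z => slope (angle f N (σ z)) ^ 2) (differentiableAt_gram (hσ.subset hy))
    (hσ.differentiableAt_chartField hy (hf.contMDiff_killing hN))
    (((hσ.contDiffOn_comp hf.contMDiff_height).contDiffAt hUy).of_le (WithTop.coe_le_coe.2 le_top))
    (((hσ.contDiffAt_slope_angle hf hN hy).pow 2).differentiableAt (by simp))
    (.of_forall fun z => gram_symm _ z) ?_ ?_
    (hσ.fderiv_slope_sq_killing_eq_zero hf hy (hN _) (hθ _) (hA _)) (fun a b ha hb => ?_) a b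
  · filter_upwards [hUy] with z hz using hσ.gram_killing_left hf hz
  · filter_upwards [hUy] with z hz using hσ.fderiv_height_killing hf hz (hN _) (hθ _)
  · rw [hσ.fderiv_height hf hy] at ha hb
    exact hσ.lieForm_killing_of_horizontal hf hN hy hgeod ha hb

theorem lieForm_transition {V : S → ℝⁿ} (hproj : ContMDiff (𝓡 n) (𝓡 n) ∞ (proj f))
    (hV : ContMDiff (𝓡 n) (𝓡 n).tangent ∞ (fun x => (⟨proj f x, V x⟩ : TangentBundle (𝓡 n) M)))
    (hσ : IsLocalSection f p₀ U σ) {q : M} (hy : y ∈ U)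
    (hq : proj f (σ y) ∈ (extChartAt (𝓡 n) q).source) (a b : ℝⁿ) :
    lieForm (gram p₀) (chartField f p₀ σ V) y a b
      = lieForm (gram q) (chartField f q (fun z => σ (transition (𝓡 n) q p₀ z)) V)
          (transition (𝓡 n) p₀ q y) (fderiv ℝ (transition (𝓡 n) p₀ q) y a)
          (fderiv ℝ (transition (𝓡 n) p₀ q) y b) := by
  have hmem := hσ.transition_mem hy hq
  have hσ' := hσ.transition_comp q
  have hnear : ∀ᶠ z in 𝓝 y, z ∈ U ∧ proj f (σ z) ∈ (extChartAt (𝓡 n) q).source :=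
    Filter.Eventually.and (hσ.isOpen.mem_nhds hy) ((hproj.continuous.continuousAt.comp
      (hσ.contMDiffAt hy).continuousAt).preimage_mem_nhds
        ((isOpen_extChartAt_source (I := 𝓡 n) q).mem_nhds hq))
  refine lieForm_pullback ((contDiffAt_transition (hσ.subset hy)
      (hσ.proj_eq y hy ▸ hq)).of_le (WithTop.coe_le_coe.2 le_top))
    (differentiableAt_gram (hσ.subset hy)) (differentiableAt_gram (hσ'.subset hmem))
    (hσ.differentiableAt_chartField hy hV) (hσ'.differentiableAt_chartField hmem hV) ?_ ?_ a b
  · filter_upwards [hnear] with z hz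
    exact gram_transition (hσ.subset hz.1) (hσ.proj_eq z hz.1 ▸ hz.2)
  · filter_upwards [hnear] with z hz
    rw [hσ.fderiv_transition_chartField hz.1 hz.2, chartField, hσ.transition_transition hz.1 hz.2,
      chartField]

theorem lieForm_killing (hf : IsOrientedHypersurface f N) (hN : ∀ x, angle f N x ^ 2 ≠ 1)
    (hθ : ∀ x, angle f N x ≠ 0)
    (hA : ∀ (x : S) (v : ℝⁿ), IsHeightGradient f x v →
      shapeForm ((𝓡 n).prod 𝓘(ℝ, ℝ)) (𝓡 n) prodMetric f N x v v = 0)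
    (hgeod : TotallyGeodesicSections f N) (hσ : IsLocalSection f p₀ U σ) (hy : y ∈ U) (a b : ℝⁿ) :
    lieForm (gram p₀) (chartField f p₀ σ (killing N)) y a b = 0 := by
  have hq := mem_extChartAt_source (I := 𝓡 n) (proj f (σ y))
  rw [hσ.lieForm_transition hf.contMDiff_proj (hf.contMDiff_killing hN) hy hq]
  exact (hσ.transition_comp _).lieForm_killing_self hf hN hθ hA hgeod (hσ.transition_mem hy hq)
    (by rw [hσ.transition_transition hy hq]) _ _

end IsLocalSection

end KillingEquation

section ExistenceOfLocalSections

variable {n : ℕ} {M : Type*} [TopologicalSpace M] [ChartedSpace (EuclideanSpace ℝ (Fin n)) M]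
  {S : Type*} [TopologicalSpace S] [ChartedSpace (EuclideanSpace ℝ (Fin n)) S] {f : S → M × ℝ}

local notation "ℝⁿ" => EuclideanSpace ℝ (Fin n)

theorem isOpen_image_extChartAt_symm (x : S) {s : Set ℝⁿ} (hs : IsOpen s)
    (hsub : s ⊆ (extChartAt (𝓡 n) x).target) : IsOpen ((extChartAt (𝓡 n) x).symm '' s) := by
  rw [(extChartAt (𝓡 n) x).symm_image_eq_source_inter_preimage hsub]
  exact (continuousOn_extChartAt x).isOpen_inter_preimage (isOpen_extChartAt_source x) hs

/-- The projection of the hypersurface to `M`, read in the preferred charts at `x` and at its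
projection. -/
def projChart (f : S → M × ℝ) (x : S) (z : ℝⁿ) : ℝⁿ :=
  extChartAt (𝓡 n) (proj f x) (proj f ((extChartAt (𝓡 n) x).symm z))

/-- The part of the preferred chart at `x` that the projection maps into the preferred chart at
the projection of `x`. -/
def projChartDomain (f : S → M × ℝ) (x : S) : Set ℝⁿ :=
  (extChartAt (𝓡 n) x).target ∩
    (fun z => proj f ((extChartAt (𝓡 n) x).symm z)) ⁻¹' (extChartAt (𝓡 n) (proj f x)).source

theorem isOpen_projChartDomain (hproj : Continuous (proj f)) (x : S) :
    IsOpen (projChartDomain (n := n) f x) :=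
  (hproj.comp_continuousOn (continuousOn_extChartAt_symm x)).isOpen_inter_preimage
    (isOpen_extChartAt_target x) (isOpen_extChartAt_source (proj f x))

theorem mem_projChartDomain (x : S) : extChartAt (𝓡 n) x x ∈ projChartDomain f x := by
  refine ⟨mem_extChartAt_target x, ?_⟩
  rw [mem_preimage, extChartAt_to_inv]
  exact mem_extChartAt_source _

theorem projChart_self (x : S) : projChart f x (extChartAt (𝓡 n) x x)
    = extChartAt (𝓡 n) (proj f x) (proj f x) := by
  rw [projChart, extChartAt_to_inv]

variable [IsManifold (𝓡 n) ∞ S]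

theorem isLocalSection_comp_symm (x : S) (h : OpenPartialHomeomorph ℝⁿ ℝⁿ)
    (hsource : h.source ⊆ projChartDomain f x) (heq : ∀ z, h z = projChart f x z)
    (hsmooth : ContDiffOn ℝ ∞ h.symm h.target) :
    IsLocalSection f (proj f x) h.target (fun y => (extChartAt (𝓡 n) x).symm (h.symm y)) := by
  have hmem (y : ℝⁿ) (hy : y ∈ h.target) := hsource (h.map_target hy)
  have hinv (y : ℝⁿ) (hy : y ∈ h.target) : extChartAt (𝓡 n) (proj f x)
      (proj f ((extChartAt (𝓡 n) x).symm (h.symm y))) = y :=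
    (heq _).symm.trans (h.right_inv hy)
  refine ⟨h.open_target, fun y hy => ?_, fun y hy => ?_, fun y hy => ?_⟩
  · exact hinv y hy ▸ (extChartAt (𝓡 n) (proj f x)).map_source (hmem y hy).2
  · exact ((contMDiffAt_extChartAt_symm (hmem y hy).1).comp y
      ((hsmooth.contDiffAt (h.open_target.mem_nhds hy)).contMDiffAt)).contMDiffWithinAt
  · have h' := congrArg (extChartAt (𝓡 n) (proj f x)).symm (hinv y hy)
    rwa [(extChartAt (𝓡 n) (proj f x)).left_inv (hmem y hy).2] at h'

variable [IsManifold (𝓡 n) ∞ M]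

theorem contDiffOn_projChart (hproj : ContMDiff (𝓡 n) (𝓡 n) ∞ (proj f)) (x : S) :
    ContDiffOn ℝ ∞ (projChart (n := n) f x) (projChartDomain f x) := fun z hz =>
  (contMDiffAt_iff_contDiffAt.1 ((contMDiffAt_extChartAt_of_mem hz.2).comp z
    ((hproj _).comp z (contMDiffAt_extChartAt_symm hz.1)))).contDiffWithinAt

theorem hasFDerivAt_projChart (hproj : ContMDiff (𝓡 n) (𝓡 n) ∞ (proj f)) (x : S) :
    HasFDerivAt (projChart (n := n) f x) (dproj f x) (extChartAt (𝓡 n) x x) := by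
  have hmem := mem_projChartDomain (n := n) (f := f) x
  have hsymm := contMDiffAt_extChartAt_symm hmem.1
  have hd := ((contDiffOn_projChart hproj x).contDiffAt
    ((isOpen_projChartDomain hproj.continuous x).mem_nhds hmem)).differentiableAt (by simp)
  refine hd.hasFDerivAt.congr_fderiv (ContinuousLinearMap.ext fun v => ?_)
  have houter : fderiv ℝ (projChart f x) (extChartAt (𝓡 n) x x) = _ :=
    mfderiv_eq_fderiv.symm.trans (mfderiv_comp (extChartAt (𝓡 n) x x)
      ((contMDiffAt_extChartAt_of_mem hmem.2).mdifferentiableAt (by simp))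
      (((hproj _).comp _ hsymm).mdifferentiableAt (by simp)))
  have hinner := mfderiv_comp (extChartAt (𝓡 n) x x)
    ((hproj ((extChartAt (𝓡 n) x).symm (extChartAt (𝓡 n) x x))).mdifferentiableAt (by simp))
    (hsymm.mdifferentiableAt (by simp))
  have h : fderiv ℝ (projChart f x) (extChartAt (𝓡 n) x x) v
      = dchart (𝓡 n) (proj f x) (proj f ((extChartAt (𝓡 n) x).symm (extChartAt (𝓡 n) x x)))
        (dproj f ((extChartAt (𝓡 n) x).symm (extChartAt (𝓡 n) x x))
          (dchartSymm (𝓡 n) x (extChartAt (𝓡 n) x x) v)) := by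
    rw [houter]
    exact congrArg (fun A : ℝⁿ →L[ℝ] ℝⁿ => dchart (𝓡 n) (proj f x) _ (A v)) hinner
  rw [h, dchartSymm_self, extChartAt_to_inv, dchart_self]

theorem exists_isLocalSection (hproj : ContMDiff (𝓡 n) (𝓡 n) ∞ (proj f)) {x : S}
    (hx : Function.Injective (dproj (n := n) f x)) :
    ∃ (U : Set ℝⁿ) (σ : ℝⁿ → S), IsLocalSection f (proj f x) U σ ∧
      extChartAt (𝓡 n) (proj f x) (proj f x) ∈ U ∧
      σ (extChartAt (𝓡 n) (proj f x) (proj f x)) = x ∧ ∀ V ⊆ U, IsOpen V → IsOpen (σ '' V) := by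
  let L : ℝⁿ ≃L[ℝ] ℝⁿ :=
    (LinearEquiv.ofInjectiveEndo (dproj f x).toLinearMap hx).toContinuousLinearEquiv
  have hL : HasFDerivAt (projChart f x) (L : ℝⁿ →L[ℝ] ℝⁿ) (extChartAt (𝓡 n) x x) :=
    (hasFDerivAt_projChart hproj x).congr_fderiv (ContinuousLinearMap.ext fun _ => rfl)
  obtain ⟨h, hxh, hsource, heq, hsmooth⟩ := exists_openPartialHomeomorph_contDiffOn_symm
    (isOpen_projChartDomain hproj.continuous x) (contDiffOn_projChart hproj x)
    (mem_projChartDomain x) hL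
  have hself : h (extChartAt (𝓡 n) x x) = extChartAt (𝓡 n) (proj f x) (proj f x) :=
    (heq _).trans (projChart_self x)
  refine ⟨h.target, _, isLocalSection_comp_symm x h hsource heq hsmooth,
    hself ▸ h.map_source hxh, ?_, fun V hV hVo => ?_⟩
  · simp only [← hself, h.left_inv hxh, extChartAt_to_inv]
  · rw [← image_image (extChartAt (𝓡 n) x).symm h.symm V]
    exact isOpen_image_extChartAt_symm x (h.symm.isOpen_image_of_subset_source hVo hV)
      ((image_subset_iff.2 fun y hy => h.map_target (hV hy)).trans
        (hsource.trans inter_subset_left))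

end ExistenceOfLocalSections

section FlowBox

open Metric Filter Topology

variable {E : Type*} [NormedAddCommGroup E] [NormedSpace ℝ E]
  {K : Type*} [NormedAddCommGroup K] [NormedSpace ℝ K]

namespace IsLocalFlow

variable {X : E → E} {U B : Set E} {a : ℝ} {Fl : ℝ → E → E}

theorem apply_eq_add_mul (h : IsLocalFlow X U B a Fl) (hU : IsOpen U) {u : E → ℝ} {b : ℝ}
    (hu : DifferentiableOn ℝ u U) (huX : ∀ y ∈ U, fderiv ℝ u y (X y) = b) {y : E} (hy : y ∈ B)
    {t : ℝ} (ht : t ∈ Ioo (-a) a) : u (Fl t y) = u y + b * t := by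
  have hderiv : ∀ s ∈ Ioo (-a) a, HasDerivAt (fun s => u (Fl s y) - b * s) 0 s := by
    intro s hs
    have hmem := h.mem y hy s hs
    have hd := ((hu.differentiableAt (hU.mem_nhds hmem)).hasFDerivAt.comp_hasDerivAt s
      (h.hasDerivAt y hy s hs)).sub ((hasDerivAt_id s).const_mul b)
    rwa [huX _ hmem, mul_one, sub_self] at hd
  have h0 : (0 : ℝ) ∈ Ioo (-a) a := by constructor <;> linarith [ht.1, ht.2]
  have hconst := isOpen_Ioo.is_const_of_deriv_eq_zero isPreconnected_Ioo
    (fun s hs => (hderiv s hs).differentiableAt.differentiableWithinAt)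
    (fun s hs => (hderiv s hs).deriv) ht h0
  rw [h.zero y hy, mul_zero, sub_zero] at hconst
  exact sub_eq_iff_eq_add.1 hconst

theorem hasFDerivAt_zero (h : IsLocalFlow X U B a Fl) (hB : IsOpen B) (ha : 0 < a) {y : E}
    (hy : y ∈ B) : HasFDerivAt (fun q : ℝ × E => Fl q.1 q.2)
      ((ContinuousLinearMap.fst ℝ ℝ E).smulRight (X y) + ContinuousLinearMap.snd ℝ ℝ E) (0, y) := by
  have h0 : (0 : ℝ) ∈ Ioo (-a) a := ⟨neg_lt_zero.2 ha, ha⟩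
  refine ((h.contDiffAt hB h0 hy).differentiableAt (by simp)).hasFDerivAt.congr_fderiv
    (ContinuousLinearMap.ext fun q => ?_)
  have hq : q = q.1 • ((1, 0) : ℝ × E) + (0, q.2) := by ext <;> simp
  calc fderiv ℝ (fun q : ℝ × E => Fl q.1 q.2) (0, y) q
      = q.1 • X (Fl 0 y) + fderiv ℝ (Fl 0) y q.2 := by
        rw [h.fderiv_apply_space hB h0 hy, ← h.fderiv_apply_time hB h0 hy, ← map_smul, ← map_add,
          ← hq]
    _ = q.1 • X y + q.2 := by rw [h.zero y hy, h.fderiv_zero hB hy]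

end IsLocalFlow

theorem exists_box_isOpen_image [CompleteSpace E] [CompleteSpace K] {Φ : ℝ × K → E}
    {s : Set (ℝ × K)} (hs : IsOpen s) (hΦ : ContDiffOn ℝ ∞ Φ s) (h0 : (0, 0) ∈ s)
    {e : (ℝ × K) ≃L[ℝ] E} (he : HasFDerivAt Φ (e : ℝ × K →L[ℝ] E) (0, 0)) :
    ∃ ε > 0, Ioo (-ε) ε ×ˢ ball 0 ε ⊆ s ∧
      ∀ η ≤ ε, IsOpen (Φ '' (Ioo (-η) η ×ˢ ball 0 η)) := by
  obtain ⟨h, h0', hsub, heq, -⟩ := exists_openPartialHomeomorph_contDiffOn_symm hs hΦ h0 he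
  obtain ⟨ε, hε, hball⟩ := Metric.isOpen_iff.1 h.open_source _ h0'
  rw [← ball_prod_same, Real.ball_eq_Ioo, zero_sub, zero_add] at hball
  refine ⟨ε, hε, hball.trans hsub, fun η hη => ?_⟩
  rw [← funext heq]
  exact h.isOpen_image_of_subset_source (isOpen_Ioo.prod isOpen_ball)
    ((Set.prod_mono (Ioo_subset_Ioo (neg_le_neg hη) hη) (ball_subset_ball hη)).trans hball)

/-- The union of the flow lines, for times in `(-ε, ε)`, through the slice `c '' ball 0 ε`. -/
def flowBox (Fl : ℝ → E → E) (c : K → E) (ε : ℝ) : Set E :=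
  (fun q : ℝ × K => Fl q.1 (c q.2)) '' (Ioo (-ε) ε ×ˢ ball 0 ε)

namespace IsLocalFlow

variable {X : E → E} {U B : Set E} {a : ℝ} {Fl : ℝ → E → E} {c : K → E} {ρ : ℝ}

theorem hasFDerivAt_comp_slice (h : IsLocalFlow X U B a Fl) (hB : IsOpen B) (ha : 0 < a)
    (hc : DifferentiableAt ℝ c 0) (hcB : c 0 ∈ B) :
    HasFDerivAt (fun q : ℝ × K => Fl q.1 (c q.2))
      ((ContinuousLinearMap.fst ℝ ℝ K).smulRight (X (c 0)) +
        (fderiv ℝ c 0).comp (ContinuousLinearMap.snd ℝ ℝ K)) (0, 0) := by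
  have hslice : HasFDerivAt (fun q : ℝ × K => (q.1, c q.2)) _ (0, 0) :=
    hasFDerivAt_fst.prodMk (hc.hasFDerivAt.comp ((0, 0) : ℝ × K) hasFDerivAt_snd)
  exact (HasFDerivAt.comp (g := fun q : ℝ × E => Fl q.1 q.2) ((0, 0) : ℝ × K)
    (h.hasFDerivAt_zero hB ha hcB) hslice).congr_fderiv (by ext <;> simp)

theorem exists_flowBox [CompleteSpace E] [CompleteSpace K] (h : IsLocalFlow X U B a Fl)
    (hB : IsOpen B) (ha : 0 < a) (hρ : 0 < ρ) (hc : ContDiffOn ℝ ∞ c (ball 0 ρ)) (hcB : c 0 ∈ B)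
    (e : (ℝ × K) ≃L[ℝ] E) (he : ∀ q, e q = q.1 • X (c 0) + fderiv ℝ c 0 q.2) :
    ∃ ε > 0, ε ≤ a ∧ ε ≤ ρ ∧ MapsTo c (ball 0 ε) B ∧ flowBox Fl c ε ⊆ B ∧
      IsOpen (flowBox Fl c ε) ∧ IsConnected (flowBox Fl c ε) := by
  set Φ : ℝ × K → E := fun q => Fl q.1 (c q.2)
  set W : Set K := ball 0 ρ ∩ c ⁻¹' B
  have hW : IsOpen W := hc.continuousOn.isOpen_inter_preimage isOpen_ball hB
  have h0W : (0 : K) ∈ W := ⟨mem_ball_self hρ, hcB⟩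
  have hΦ : ContDiffOn ℝ ∞ Φ (Ioo (-a) a ×ˢ W) :=
    h.smooth.comp (contDiffOn_fst.prodMk ((hc.mono inter_subset_left).comp contDiffOn_snd
      fun q hq => hq.2)) fun q hq => ⟨hq.1, hq.2.2⟩
  have hΦe : HasFDerivAt Φ (e : ℝ × K →L[ℝ] E) (0, 0) :=
    (h.hasFDerivAt_comp_slice hB ha
      ((hc.contDiffAt (ball_mem_nhds 0 hρ)).differentiableAt (by simp)) hcB).congr_fderiv
      (ContinuousLinearMap.ext fun q => (he q).symm)
  have h0 : ((0 : ℝ), (0 : K)) ∈ (Ioo (-a) a ×ˢ W) ∩ Φ ⁻¹' B :=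
    ⟨⟨⟨neg_lt_zero.2 ha, ha⟩, h0W⟩, by simpa [Φ, h.zero _ hcB] using hcB⟩
  obtain ⟨η, hη, hbox, hopen⟩ := exists_box_isOpen_image
    (hΦ.continuousOn.isOpen_inter_preimage (isOpen_Ioo.prod hW) hB)
    (hΦ.mono inter_subset_left) h0 hΦe
  set ε := min η (min a ρ)
  have hε : 0 < ε := lt_min hη (lt_min ha hρ)
  have hsub : Ioo (-ε) ε ×ˢ ball (0 : K) ε ⊆ (Ioo (-a) a ×ˢ W) ∩ Φ ⁻¹' B :=
    (Set.prod_mono (Ioo_subset_Ioo (neg_le_neg (min_le_left _ _)) (min_le_left _ _))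
      (ball_subset_ball (min_le_left _ _))).trans hbox
  have h0ε : (0 : ℝ) ∈ Ioo (-ε) ε := ⟨neg_lt_zero.2 hε, hε⟩
  refine ⟨ε, hε, (min_le_right _ _).trans (min_le_left _ _),
    (min_le_right _ _).trans (min_le_right _ _),
    fun z hz => (hsub (show ((0 : ℝ), z) ∈ _ from ⟨h0ε, hz⟩)).1.2.2,
    image_subset_iff.2 fun q hq => (hsub hq).2, hopen ε (min_le_left _ _), ?_⟩
  exact IsConnected.image (s := Ioo (-ε) ε ×ˢ ball (0 : K) ε) ⟨⟨(0, 0), h0ε, mem_ball_self hε⟩,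
    isPreconnected_Ioo.prod (convex_ball _ _).isPreconnected⟩ _
    (hΦ.continuousOn.mono (hsub.trans inter_subset_left))

end IsLocalFlow

/-- The parametrization of the level set of `u` through `y₀` by the kernel of `du`: each point
`y₀ + k` is moved back to the level of `y₀` by the flow of a field along which `u` grows at unit
speed. -/
def levelSlice (u : E → ℝ) (Fl : ℝ → E → E) (y₀ : E) (k : (fderiv ℝ u y₀).ker) : E :=
  Fl (u y₀ - u (y₀ + k)) (y₀ + k)

namespace IsLocalFlow

variable {X : E → E} {U B : Set E} {a : ℝ} {Fl : ℝ → E → E} {u : E → ℝ} {y₀ : E}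

theorem levelSlice_zero (h : IsLocalFlow X U B a Fl) (hy₀ : y₀ ∈ B) :
    levelSlice u Fl y₀ 0 = y₀ := by
  simp [levelSlice, h.zero y₀ hy₀]

theorem fderiv_levelSlice (h : IsLocalFlow X U B a Fl) (hB : IsOpen B) (ha : 0 < a)
    (hy₀ : y₀ ∈ B) (hu : DifferentiableAt ℝ u y₀) (k : (fderiv ℝ u y₀).ker) :
    fderiv ℝ (levelSlice u Fl y₀) 0 k = k := by
  let K := (fderiv ℝ u y₀).ker
  have htrans : HasFDerivAt (fun k : K => y₀ + (k : E)) K.subtypeL 0 :=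
    K.subtypeL.hasFDerivAt.const_add y₀
  have htime : HasFDerivAt (fun k : K => u y₀ - u (y₀ + k)) (0 : K →L[ℝ] ℝ) 0 := by
    have hu' : HasFDerivAt u (fderiv ℝ u y₀) (y₀ + ((0 : K) : E)) := by
      simpa only [ZeroMemClass.coe_zero, add_zero] using hu.hasFDerivAt
    refine ((hu'.comp (0 : K) htrans).const_sub (u y₀)).congr_fderiv ?_
    ext k
    simp
  have hflow : HasFDerivAt (fun q : ℝ × E => Fl q.1 q.2)
      ((ContinuousLinearMap.fst ℝ ℝ E).smulRight (X y₀) + ContinuousLinearMap.snd ℝ ℝ E)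
      (u y₀ - u (y₀ + ((0 : K) : E)), y₀ + ((0 : K) : E)) := by
    simpa only [ZeroMemClass.coe_zero, add_zero, sub_self] using h.hasFDerivAt_zero hB ha hy₀
  have hslice : HasFDerivAt (levelSlice u Fl y₀) _ 0 :=
    HasFDerivAt.comp (g := fun q : ℝ × E => Fl q.1 q.2) (0 : K) hflow (htime.prodMk htrans)
  simp [hslice.fderiv]

theorem exists_contDiffOn_levelSlice (h : IsLocalFlow X U B a Fl) (hU : IsOpen U) (hB : IsOpen B)
    (ha : 0 < a) (hy₀ : y₀ ∈ B) (huB : ContDiffOn ℝ ∞ u B) (huU : DifferentiableOn ℝ u U)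
    (huX : ∀ y ∈ U, fderiv ℝ u y (X y) = 1) :
    ∃ ρ > 0, ContDiffOn ℝ ∞ (levelSlice u Fl y₀) (ball 0 ρ) ∧
      ∀ z ∈ ball 0 ρ, u (levelSlice u Fl y₀ z) = u y₀ := by
  set K := (fderiv ℝ u y₀).ker
  let g : K → ℝ × E := fun k => (u y₀ - u (y₀ + k), y₀ + k)
  have htrans : ContDiff ℝ ∞ (fun k : K => y₀ + (k : E)) :=
    contDiff_const.add K.subtypeL.contDiff
  set T := (fun k : K => y₀ + (k : E)) ⁻¹' B
  have hg : ContDiffOn ℝ ∞ g T :=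
    (contDiffOn_const.sub (huB.comp htrans.contDiffOn fun _ hk => hk)).prodMk htrans.contDiffOn
  have hopen : IsOpen (T ∩ g ⁻¹' (Ioo (-a) a ×ˢ B)) :=
    hg.continuousOn.isOpen_inter_preimage (hB.preimage htrans.continuous) (isOpen_Ioo.prod hB)
  have h0 : (0 : K) ∈ T ∩ g ⁻¹' (Ioo (-a) a ×ˢ B) := by simp [T, g, hy₀, ha]
  obtain ⟨ρ, hρ, hball⟩ := Metric.isOpen_iff.1 hopen _ h0
  refine ⟨ρ, hρ, h.smooth.comp (hg.mono fun k hk => (hball hk).1) fun k hk => (hball hk).2,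
    fun z hz => ?_⟩
  obtain ⟨htime, hmem⟩ := (hball hz).2
  rw [levelSlice, h.apply_eq_add_mul hU huU huX hmem htime, one_mul, add_sub_cancel]

end IsLocalFlow

theorem exists_equiv_prod_ker [FiniteDimensional ℝ E] (ℓ : E →L[ℝ] ℝ) {x : E} (hx : ℓ x = 1) :
    ∃ e : (ℝ × ℓ.ker) ≃L[ℝ] E, ∀ q, e q = q.1 • x + q.2 := by
  let T : ℝ × ℓ.ker →ₗ[ℝ] E :=
    (LinearMap.fst ℝ ℝ ℓ.ker).smulRight x + ℓ.ker.subtype ∘ₗ LinearMap.snd ℝ ℝ ℓ.ker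
  have hT (q : ℝ × ℓ.ker) : T q = q.1 • x + q.2 := rfl
  have hbij : Function.Bijective T := by
    refine ⟨(injective_iff_map_eq_zero T).2 fun q hq => ?_,
      fun v => ⟨(ℓ v, ⟨v - ℓ v • x, by simp [hx]⟩), by simp [hT]⟩⟩
    have h1 : q.1 = 0 := by
      have hk : ℓ q.2 = 0 := q.2.2
      simpa [hT, hx, hk] using congrArg ℓ hq
    rw [hT, h1, zero_smul, zero_add] at hq
    exact Prod.ext h1 (Subtype.ext hq)
  exact ⟨(LinearEquiv.ofBijective T hbij).toContinuousLinearEquiv, hT⟩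

end FlowBox

section ChartConjugation

open Filter Topology

variable {n : ℕ} {M : Type*} [TopologicalSpace M] [ChartedSpace (EuclideanSpace ℝ (Fin n)) M]
  {p₀ p : M} {Ω : Set (EuclideanSpace ℝ (Fin n))}
  {F : EuclideanSpace ℝ (Fin n) → EuclideanSpace ℝ (Fin n)}

local notation "ℝⁿ" => EuclideanSpace ℝ (Fin n)

/-- The map `F` of the model space, transported to `M` by the preferred chart at `p₀`. -/
def chartConj (p₀ : M) (F : ℝⁿ → ℝⁿ) (p : M) : M :=
  (extChartAt (𝓡 n) p₀).symm (F (extChartAt (𝓡 n) p₀ p))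

theorem mem_image_extChartAt_symm_iff (hΩ : Ω ⊆ (extChartAt (𝓡 n) p₀).target) :
    p ∈ (extChartAt (𝓡 n) p₀).symm '' Ω ↔
      p ∈ (extChartAt (𝓡 n) p₀).source ∧ extChartAt (𝓡 n) p₀ p ∈ Ω := by
  rw [(extChartAt (𝓡 n) p₀).symm_image_eq_source_inter_preimage hΩ]
  rfl

theorem chartConj_extChartAt_symm {y : ℝⁿ} (hy : y ∈ (extChartAt (𝓡 n) p₀).target) :
    chartConj p₀ F ((extChartAt (𝓡 n) p₀).symm y) = (extChartAt (𝓡 n) p₀).symm (F y) := by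
  rw [chartConj, (extChartAt (𝓡 n) p₀).right_inv hy]

theorem injOn_chartConj (hΩ : Ω ⊆ (extChartAt (𝓡 n) p₀).target) (hF : InjOn F Ω)
    (hFΩ : MapsTo F Ω (extChartAt (𝓡 n) p₀).target) :
    InjOn (chartConj p₀ F) ((extChartAt (𝓡 n) p₀).symm '' Ω) := by
  rintro _ ⟨y, hy, rfl⟩ _ ⟨z, hz, rfl⟩ heq
  rw [chartConj_extChartAt_symm (hΩ hy), chartConj_extChartAt_symm (hΩ hz)] at heq
  rw [hF hy hz ((extChartAt (𝓡 n) p₀).symm.injOn (hFΩ hy) (hFΩ hz) heq)]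

variable [IsManifold (𝓡 n) ∞ M]

theorem mfderiv_chartConj (hp : p ∈ (extChartAt (𝓡 n) p₀).source)
    (hF : DifferentiableAt ℝ F (extChartAt (𝓡 n) p₀ p))
    (hFp : F (extChartAt (𝓡 n) p₀ p) ∈ (extChartAt (𝓡 n) p₀).target) (v : ℝⁿ) :
    mfderiv (𝓡 n) (𝓡 n) (chartConj p₀ F) p v
      = dchartSymm (𝓡 n) p₀ (F (extChartAt (𝓡 n) p₀ p))
          (fderiv ℝ F (extChartAt (𝓡 n) p₀ p) (dchart (𝓡 n) p₀ p v)) := by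
  have hchart := (contMDiffAt_extChartAt_of_mem hp).mdifferentiableAt (n := ∞) (by simp)
  have hinner := mfderiv_comp p hF.mdifferentiableAt hchart
  rw [mfderiv_eq_fderiv] at hinner
  have houter : (mfderiv (𝓡 n) (𝓡 n) (chartConj p₀ F) p : ℝⁿ →L[ℝ] ℝⁿ) = _ :=
    mfderiv_comp p ((contMDiffAt_extChartAt_symm hFp).mdifferentiableAt (by simp))
      (hF.mdifferentiableAt.comp p hchart)
  exact (congrArg (fun A : ℝⁿ →L[ℝ] ℝⁿ => A v) houter).trans
    (congrArg (fun A : ℝⁿ →L[ℝ] ℝⁿ => dchartSymm (𝓡 n) p₀ _ (A v)) hinner)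

theorem mfderiv_comp_extChartAt {u : ℝⁿ → ℝ} (hp : p ∈ (extChartAt (𝓡 n) p₀).source)
    (hu : DifferentiableAt ℝ u (extChartAt (𝓡 n) p₀ p)) (v : ℝⁿ) :
    (mfderiv (𝓡 n) 𝓘(ℝ, ℝ) (fun q => u (extChartAt (𝓡 n) p₀ q)) p : ℝⁿ →L[ℝ] ℝ) v
      = fderiv ℝ u (extChartAt (𝓡 n) p₀ p) (dchart (𝓡 n) p₀ p v) := by
  have h := mfderiv_comp p hu.mdifferentiableAt
    ((contMDiffAt_extChartAt_of_mem hp).mdifferentiableAt (n := ∞) (by simp))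
  rw [mfderiv_eq_fderiv] at h
  exact congrArg (fun A : ℝⁿ →L[ℝ] ℝ => A v) h

theorem isHypersurface_image_extChartAt_symm {u : ℝⁿ → ℝ} {t₀ : ℝ} (hΩo : IsOpen Ω)
    (hΩ : Ω ⊆ (extChartAt (𝓡 n) p₀).target) (hu : ContDiffOn ℝ ∞ u Ω)
    (hdu : ∀ y ∈ Ω, fderiv ℝ u y ≠ 0) :
    IsHypersurface (n := n) ((extChartAt (𝓡 n) p₀).symm '' {y ∈ Ω | u y = t₀}) := by
  rintro p ⟨y, hy, rfl⟩
  have hmem (q : M) := mem_image_extChartAt_symm_iff (p := q) hΩ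
  have hsmooth : ∀ y ∈ Ω, ContDiffAt ℝ ∞ (fun y => u y - t₀) y := fun y hy =>
    (hu.contDiffAt (hΩo.mem_nhds hy)).sub contDiffAt_const
  refine ⟨(extChartAt (𝓡 n) p₀).symm '' Ω, fun q => u (extChartAt (𝓡 n) p₀ q) - t₀,
    isOpen_image_extChartAt_symm p₀ hΩo hΩ, mem_image_of_mem _ hy.1, fun q hq => ?_,
    fun q hq heq => ?_, ?_⟩
  · obtain ⟨hsource, hqΩ⟩ := (hmem q).1 hq
    exact ((hsmooth _ hqΩ).contMDiffAt.comp q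
      (contMDiffAt_extChartAt_of_mem hsource)).contMDiffWithinAt
  · obtain ⟨z, hz, rfl⟩ := hq
    have hsource := (extChartAt (𝓡 n) p₀).map_target (hΩ hz)
    refine hdu z hz (ContinuousLinearMap.ext fun v => ?_)
    have h := mfderiv_comp_extChartAt (u := fun y => u y - t₀) hsource
      ((hsmooth _ ((hmem _).1 (mem_image_of_mem _ hz)).2).differentiableAt (by simp))
      (dchartSymm (𝓡 n) p₀ z v)
    rw [dchart_dchartSymm (hΩ hz), (extChartAt (𝓡 n) p₀).right_inv (hΩ hz),
      fderiv_sub_const] at h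
    exact h.symm.trans (congrArg (fun A : ℝⁿ →L[ℝ] ℝ => A _) heq)
  · ext q
    rw [mem_inter_iff, mem_sep_iff, hmem, sub_eq_zero,
      mem_image_extChartAt_symm_iff ((sep_subset _ _).trans hΩ), mem_sep_iff]
    tauto

theorem contMDiffOn_chartConj {Fl : ℝ → ℝⁿ → ℝⁿ} {I : Set ℝ} (hI : IsOpen I) (hΩo : IsOpen Ω)
    (hΩ : Ω ⊆ (extChartAt (𝓡 n) p₀).target)
    (hFl : ContDiffOn ℝ ∞ (fun q : ℝ × ℝⁿ => Fl q.1 q.2) (I ×ˢ Ω))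
    (hmem : ∀ t ∈ I, MapsTo (Fl t) Ω (extChartAt (𝓡 n) p₀).target) :
    ContMDiffOn (𝓘(ℝ, ℝ).prod (𝓡 n)) (𝓡 n) ∞ (fun q : ℝ × M => chartConj p₀ (Fl q.1) q.2)
      (I ×ˢ ((extChartAt (𝓡 n) p₀).symm '' Ω)) := by
  rintro ⟨t, p⟩ ⟨ht, hp⟩
  obtain ⟨hsource, hpΩ⟩ := (mem_image_extChartAt_symm_iff hΩ).1 hp
  have hchart : ContMDiffAt (𝓘(ℝ, ℝ).prod (𝓡 n)) 𝓘(ℝ, ℝ × ℝⁿ) ∞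
      (fun q : ℝ × M => (q.1, extChartAt (𝓡 n) p₀ q.2)) (t, p) :=
    contMDiffAt_fst.prodMk_space
      (ContMDiffAt.comp (t, p) (contMDiffAt_extChartAt_of_mem hsource) contMDiffAt_snd)
  have hflow : ContDiffAt ℝ ∞ (fun q : ℝ × ℝⁿ => Fl q.1 q.2) (t, extChartAt (𝓡 n) p₀ p) :=
    hFl.contDiffAt ((hI.prod hΩo).mem_nhds ⟨ht, hpΩ⟩)
  exact (ContMDiffAt.comp (t, p) (contMDiffAt_extChartAt_symm (hmem t ht hpΩ))
    (ContMDiffAt.comp (t, p) hflow.contMDiffAt hchart)).contMDiffWithinAt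

variable [RiemannianBundle (fun p : M => TangentSpace (𝓡 n) p)]

theorem metric_mfderiv_chartConj (hp : p ∈ (extChartAt (𝓡 n) p₀).source)
    (hF : DifferentiableAt ℝ F (extChartAt (𝓡 n) p₀ p))
    (hFp : F (extChartAt (𝓡 n) p₀ p) ∈ (extChartAt (𝓡 n) p₀).target) (v w : ℝⁿ) :
    metric (chartConj p₀ F p) (mfderiv (𝓡 n) (𝓡 n) (chartConj p₀ F) p v)
        (mfderiv (𝓡 n) (𝓡 n) (chartConj p₀ F) p w)
      = gram p₀ (F (extChartAt (𝓡 n) p₀ p))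
          (fderiv ℝ F (extChartAt (𝓡 n) p₀ p) (dchart (𝓡 n) p₀ p v))
          (fderiv ℝ F (extChartAt (𝓡 n) p₀ p) (dchart (𝓡 n) p₀ p w)) :=
  congrArg₂ (fun a b : ℝⁿ => metricForm (chartConj p₀ F p) a b)
    (mfderiv_chartConj hp hF hFp v) (mfderiv_chartConj hp hF hFp w)

end ChartConjugation

section TwistingPieces

open Metric Filter Topology

variable {n : ℕ} {M : Type*} [TopologicalSpace M] [ChartedSpace (EuclideanSpace ℝ (Fin n)) M]
  {S : Type*} {f : S → M × ℝ} {p₀ : M}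

local notation "ℝⁿ" => EuclideanSpace ℝ (Fin n)

theorem image_ball_eq_levelSet_flowBox {E K : Type*} [NormedAddCommGroup K] {Fl : ℝ → E → E}
    {c : K → E} {u : E → ℝ} {t₀ ε : ℝ} (hε : 0 < ε) (hzero : ∀ z ∈ ball 0 ε, Fl 0 (c z) = c z)
    (hu : ∀ z ∈ ball 0 ε, ∀ t ∈ Ioo (-ε) ε, u (Fl t (c z)) = t₀ + t) :
    c '' ball 0 ε = {y ∈ flowBox Fl c ε | u y = t₀} := by
  have h0 : (0 : ℝ) ∈ Ioo (-ε) ε := ⟨neg_lt_zero.2 hε, hε⟩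
  ext y
  constructor
  · rintro ⟨z, hz, rfl⟩
    refine ⟨⟨(0, z), ⟨h0, hz⟩, hzero z hz⟩, ?_⟩
    rw [← hzero z hz, hu z hz 0 h0, add_zero]
  · rintro ⟨⟨⟨t, z⟩, ⟨ht, hz⟩, rfl⟩, hy⟩
    have ht0 : t = 0 := by simpa [hu z hz t ht] using hy
    exact ⟨z, hz, by simp [ht0, hzero z hz]⟩

section Sections

variable [TopologicalSpace S] [ChartedSpace (EuclideanSpace ℝ (Fin n)) S]
  {U : Set (EuclideanSpace ℝ (Fin n))} {σ : EuclideanSpace ℝ (Fin n) → S}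

namespace IsLocalSection

theorem apply_eq (hσ : IsLocalSection f p₀ U σ) {y : ℝⁿ} (hy : y ∈ U) :
    f (σ y) = ((extChartAt (𝓡 n) p₀).symm y, height f (σ y)) :=
  Prod.ext (hσ.proj_eq y hy) rfl

theorem injOn_image (hσ : IsLocalSection f p₀ U σ) : InjOn f (σ '' U) := by
  rintro _ ⟨y, hy, rfl⟩ _ ⟨z, hz, rfl⟩ heq
  rw [hσ.apply_eq hy, hσ.apply_eq hz] at heq
  rw [(extChartAt (𝓡 n) p₀).symm.injOn (hσ.subset hy) (hσ.subset hz) (Prod.ext_iff.1 heq).1]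

theorem image_flowBox_eq_pitchedTwisting {K : Type*} [NormedAddCommGroup K] {Fl : ℝ → ℝⁿ → ℝⁿ}
    {c : K → ℝⁿ} {t₀ ε : ℝ} (hσ : IsLocalSection f p₀ U σ) (hbox : flowBox Fl c ε ⊆ U)
    (hc : MapsTo c (ball 0 ε) U)
    (hu : ∀ z ∈ ball 0 ε, ∀ t ∈ Ioo (-ε) ε, height f (σ (Fl t (c z))) = t₀ + t) :
    f '' (σ '' flowBox Fl c ε) = pitchedTwisting 1 t₀
      ((extChartAt (𝓡 n) p₀).symm '' (c '' ball 0 ε)) ε (fun t => chartConj p₀ (Fl t)) := by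
  have hpoint : ∀ z ∈ ball 0 ε, ∀ t ∈ Ioo (-ε) ε, f (σ (Fl t (c z)))
      = (chartConj p₀ (Fl t) ((extChartAt (𝓡 n) p₀).symm (c z)), t₀ + 1 * t) := fun z hz t ht => by
    rw [hσ.apply_eq (hbox ⟨(t, z), ⟨ht, hz⟩, rfl⟩), hu z hz t ht,
      chartConj_extChartAt_symm (hσ.subset (hc hz)), one_mul]
  ext q
  constructor
  · rintro ⟨_, ⟨_, ⟨⟨t, z⟩, ⟨ht, hz⟩, rfl⟩, rfl⟩, rfl⟩
    exact ⟨_, ⟨_, ⟨z, hz, rfl⟩, rfl⟩, t, ht, hpoint z hz t ht⟩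
  · rintro ⟨_, ⟨_, ⟨z, hz, rfl⟩, rfl⟩, t, ht, rfl⟩
    exact ⟨_, ⟨_, ⟨(t, z), ⟨ht, hz⟩, rfl⟩, rfl⟩, hpoint z hz t ht⟩

end IsLocalSection

end Sections

variable [IsManifold (𝓡 n) ∞ M] [RiemannianBundle (fun p : M => TangentSpace (𝓡 n) p)]
  [IsContMDiffRiemannianBundle (𝓡 n) ∞ (EuclideanSpace ℝ (Fin n))
    (fun p : M => TangentSpace (𝓡 n) p)]

theorem IsLocalFlow.isLocalIsometryGroup_chartConj {X : ℝⁿ → ℝⁿ} {V Ω : Set ℝⁿ} {ε : ℝ}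
    {Fl : ℝ → ℝⁿ → ℝⁿ} {C : NNReal} (h : IsLocalFlow X V Ω ε Fl) (hε : 0 < ε) (hV : IsOpen V)
    (hVt : V ⊆ (extChartAt (𝓡 n) p₀).target) (hΩo : IsOpen Ω) (hC : LipschitzOnWith C X V)
    (hX : DifferentiableOn ℝ X V) (hK : ∀ y ∈ V, ∀ a b, lieForm (gram p₀) X y a b = 0) :
    IsLocalIsometryGroup (n := n) ((extChartAt (𝓡 n) p₀).symm '' Ω) ε
      (fun t => chartConj p₀ (Fl t)) := by
  have hΩ : Ω ⊆ (extChartAt (𝓡 n) p₀).target := (h.subset hε).trans hVt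
  have htarget : ∀ t ∈ Ioo (-ε) ε, MapsTo (Fl t) Ω (extChartAt (𝓡 n) p₀).target :=
    fun t ht y hy => hVt (h.mem y hy t ht)
  have hgram : DifferentiableOn ℝ (gram p₀) V := fun y hy =>
    (differentiableAt_gram (hVt hy)).differentiableWithinAt
  refine ⟨isOpen_image_extChartAt_symm p₀ hΩo hΩ,
    contMDiffOn_chartConj isOpen_Ioo hΩo hΩ h.smooth htarget,
    fun t ht => injOn_chartConj hΩ (h.injOn hC ht) (htarget t ht), fun t ht p hp v w => ?_, ?_, ?_⟩
  · obtain ⟨hsource, hpΩ⟩ := (mem_image_extChartAt_symm_iff hΩ).1 hp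
    have hFl : DifferentiableAt ℝ (Fl t) (extChartAt (𝓡 n) p₀ p) :=
      ((h.contDiffAt hΩo ht hpΩ).comp (extChartAt (𝓡 n) p₀ p)
        (contDiffAt_const.prodMk contDiffAt_id)).differentiableAt (by simp)
    refine (metric_mfderiv_chartConj hsource hFl (htarget t ht hpΩ) v w).trans ?_
    exact (h.isometry hV hΩo hgram hX hK ht hpΩ _ _).trans (gram_dchart hsource v w)
  · rintro _ ⟨y, hy, rfl⟩
    rw [chartConj_extChartAt_symm (hΩ hy), h.zero y hy]
  · rintro s hs t ht hst _ ⟨y, hy, rfl⟩ hp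
    rw [chartConj_extChartAt_symm (hΩ hy)] at hp ⊢
    have hmem := ((mem_image_extChartAt_symm_iff hΩ).1 hp).2
    rw [(extChartAt (𝓡 n) p₀).right_inv (htarget t ht hy)] at hmem
    rw [chartConj_extChartAt_symm (hΩ hy), chartConj_extChartAt_symm (htarget t ht hy),
      h.add hC hy hs ht hst hmem]

variable [TopologicalSpace S] [ChartedSpace (EuclideanSpace ℝ (Fin n)) S]
  {U : Set (EuclideanSpace ℝ (Fin n))} {σ : EuclideanSpace ℝ (Fin n) → S}

theorem IsLocalSection.isTwistingPiece_flowBox {K : Type*} [NormedAddCommGroup K]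
    {X : ℝⁿ → ℝⁿ} {V B : Set ℝⁿ} {ε t₀ : ℝ} {Fl : ℝ → ℝⁿ → ℝⁿ} {C : NNReal} {c : K → ℝⁿ}
    (hσ : IsLocalSection f p₀ U σ) (hu : ContDiffOn ℝ ∞ (fun y => height f (σ y)) U)
    (huX : ∀ y ∈ U, fderiv ℝ (fun y => height f (σ y)) y (X y) = 1) (hV : IsOpen V) (hVU : V ⊆ U)
    (hC : LipschitzOnWith C X V) (hX : DifferentiableOn ℝ X V)
    (hK : ∀ y ∈ V, ∀ a b, lieForm (gram p₀) X y a b = 0) (h : IsLocalFlow X V B ε Fl) (hε : 0 < ε)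
    (hcB : MapsTo c (ball 0 ε) B) (hcu : ∀ z ∈ ball 0 ε, height f (σ (c z)) = t₀)
    (hboxB : flowBox Fl c ε ⊆ B) (hbox : IsOpen (flowBox Fl c ε))
    (hconn : IsConnected (flowBox Fl c ε)) (hopen : IsOpen (σ '' flowBox Fl c ε)) :
    IsTwistingPiece (n := n) f (σ '' flowBox Fl c ε) t₀
      ((extChartAt (𝓡 n) p₀).symm '' (c '' ball 0 ε)) ε (fun t => chartConj p₀ (Fl t)) := by
  have hboxU : flowBox Fl c ε ⊆ U := hboxB.trans ((h.subset hε).trans hVU)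
  have hzero : ∀ z ∈ ball 0 ε, Fl 0 (c z) = c z := fun z hz => h.zero _ (hcB hz)
  have hslice : MapsTo c (ball 0 ε) (flowBox Fl c ε) := fun z hz =>
    ⟨(0, z), ⟨⟨neg_lt_zero.2 hε, hε⟩, hz⟩, hzero z hz⟩
  have hheight : ∀ z ∈ ball 0 ε, ∀ t ∈ Ioo (-ε) ε, height f (σ (Fl t (c z))) = t₀ + t :=
    fun z hz t ht => by
      rw [h.apply_eq_add_mul hV ((hu.mono hVU).differentiableOn (by simp))
        (fun y hy => huX y (hVU hy)) (hcB hz) ht, one_mul, hcu z hz]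
  have hproj : proj f '' (σ '' flowBox Fl c ε)
      = (extChartAt (𝓡 n) p₀).symm '' flowBox Fl c ε := by
    rw [image_image]
    exact image_congr fun y hy => hσ.proj_eq y (hboxU hy)
  refine ⟨hopen, hconn.image σ (hσ.smooth.continuousOn.mono hboxU),
    hσ.injOn_image.mono (image_mono hboxU), hε, ?_, ?_, ?_,
    hσ.image_flowBox_eq_pitchedTwisting hboxU (hslice.mono_right hboxU) hheight⟩
  · rw [image_ball_eq_levelSet_flowBox (u := fun y => height f (σ y)) hε hzero hheight]
    refine isHypersurface_image_extChartAt_symm hbox (hboxU.trans hσ.subset) (hu.mono hboxU)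
      fun y hy hdu => zero_ne_one (α := ℝ) ?_
    rw [← huX y (hboxU hy), hdu]
    rfl
  · rw [hproj]
    exact image_mono hslice.image_subset
  · rw [hproj]
    exact (h.mono hboxB le_rfl).isLocalIsometryGroup_chartConj hε hV (hVU.trans hσ.subset) hbox hC
      hX hK

variable {N : ∀ x : S, TangentSpace ((𝓡 n).prod 𝓘(ℝ, ℝ)) (f x)}

theorem IsLocalSection.exists_isTwistingPiece {K : Type*} [NormedAddCommGroup K] [NormedSpace ℝ K]
    [CompleteSpace K] (hf : IsOrientedHypersurface f N) (hN : ∀ x, angle f N x ^ 2 ≠ 1)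
    (hθ : ∀ x, angle f N x ≠ 0)
    (hA : ∀ (x : S) (v : ℝⁿ), IsHeightGradient f x v →
      shapeForm ((𝓡 n).prod 𝓘(ℝ, ℝ)) (𝓡 n) prodMetric f N x v v = 0)
    (hgeod : TotallyGeodesicSections f N) (hσ : IsLocalSection f p₀ U σ)
    (hopen : ∀ V ⊆ U, IsOpen V → IsOpen (σ '' V)) {c : K → ℝⁿ} {ρ : ℝ} (hρ : 0 < ρ)
    (hc : ContDiffOn ℝ ∞ c (ball 0 ρ)) (hcU : c 0 ∈ U)
    (hcu : ∀ z ∈ ball 0 ρ, height f (σ (c z)) = height f (σ (c 0))) (e : (ℝ × K) ≃L[ℝ] ℝⁿ)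
    (he : ∀ q, e q = q.1 • chartField f p₀ σ (killing N) (c 0) + fderiv ℝ c 0 q.2) :
    ∃ (S' : Set S) (ε : ℝ) (Γ : ℝ → M → M), ε ≤ ρ ∧ σ (c 0) ∈ S' ∧
      IsTwistingPiece (n := n) f S' (height f (σ (c 0)))
        ((extChartAt (𝓡 n) p₀).symm '' (c '' ball 0 ε)) ε Γ := by
  have hX : ContDiffOn ℝ ∞ (chartField f p₀ σ (killing N)) U :=
    hσ.contDiffOn_chartField (hf.contMDiff_killing hN)
  obtain ⟨V, hVU, hV, C, hC, a, ha, r, hr, Fl, hFl⟩ := exists_isLocalFlow hσ.isOpen hX hcU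
  obtain ⟨ε, hε, hεa, hερ, hcB, hboxB, hbox, hconn⟩ :=
    hFl.exists_flowBox isOpen_ball ha hρ hc (mem_ball_self hr) e he
  have hmem : σ (c 0) ∈ σ '' flowBox Fl c ε := mem_image_of_mem σ
    ⟨(0, 0), ⟨⟨neg_lt_zero.2 hε, hε⟩, mem_ball_self hε⟩, hFl.zero _ (mem_ball_self hr)⟩
  exact ⟨σ '' flowBox Fl c ε, ε, fun t => chartConj p₀ (Fl t), hερ, hmem,
    hσ.isTwistingPiece_flowBox (hσ.contDiffOn_comp hf.contMDiff_height)
      (fun y hy => hσ.fderiv_height_killing hf hy (hN _) (hθ _)) hV hVU hC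
      ((hX.mono hVU).differentiableOn (by simp))
      (fun y hy => hσ.lieForm_killing hf hN hθ hA hgeod (hVU hy)) (hFl.mono subset_rfl hεa) hε hcB
      (fun z hz => hcu z (ball_subset_ball hερ hz)) hboxB hbox hconn
      (hopen _ (hboxB.trans ((hFl.subset ha).trans hVU)) hbox)⟩

theorem exists_isTwistingPiece_of_totallyGeodesic [IsManifold (𝓡 n) ∞ S]
    (hf : IsOrientedHypersurface f N) (hN : ∀ x, angle f N x ^ 2 ≠ 1)
    (hθ : ∀ x, angle f N x ≠ 0)
    (hA : ∀ (x : S) (v : ℝⁿ), IsHeightGradient f x v →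
      shapeForm ((𝓡 n).prod 𝓘(ℝ, ℝ)) (𝓡 n) prodMetric f N x v v = 0)
    (hgeod : TotallyGeodesicSections f N) (x₀ : S) :
    ∃ (S' : Set S) (L : Set M) (ε : ℝ) (Γ : ℝ → M → M), x₀ ∈ S' ∧
      IsTwistingPiece (n := n) f S' (height f x₀) L ε Γ := by
  obtain ⟨U, σ, hσ, hy₀, hx₀, hopen⟩ :=
    exists_isLocalSection hf.contMDiff_proj (hf.dproj_injective (hθ x₀))
  set X := chartField f (proj f x₀) σ (killing N)
  set u : ℝⁿ → ℝ := fun y => height f (σ y)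
  have hu : ContDiffOn ℝ ∞ u U := hσ.contDiffOn_comp hf.contMDiff_height
  have huX : ∀ y ∈ U, fderiv ℝ u y (X y) = 1 := fun y hy =>
    hσ.fderiv_height_killing hf hy (hN _) (hθ _)
  obtain ⟨V, hVU, hV, -, -, a, ha, r, hr, Fl, hFl⟩ :=
    exists_isLocalFlow hσ.isOpen (hσ.contDiffOn_chartField (hf.contMDiff_killing hN)) hy₀
  set y₀ := extChartAt (𝓡 n) (proj f x₀) (proj f x₀)
  have hyB : y₀ ∈ ball y₀ r := mem_ball_self hr
  have hBU : ball y₀ r ⊆ U := (hFl.subset ha).trans hVU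
  obtain ⟨ρ, hρ, hsmooth, hlevel⟩ := hFl.exists_contDiffOn_levelSlice hV isOpen_ball ha hyB
    (hu.mono hBU) ((hu.mono hVU).differentiableOn (by simp)) fun y hy => huX y (hVU hy)
  obtain ⟨e, he⟩ := exists_equiv_prod_ker _ (huX _ hy₀)
  have hzero : levelSlice u Fl y₀ 0 = y₀ := hFl.levelSlice_zero hyB
  obtain ⟨S', ε, Γ, -, hmem, hpiece⟩ := hσ.exists_isTwistingPiece hf hN hθ hA hgeod hopen hρ
    hsmooth (hzero.symm ▸ hy₀) (fun z hz => (hlevel z hz).trans (by rw [hzero])) e fun q => by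
      rw [he, hzero, hFl.fderiv_levelSlice isOpen_ball ha hyB
        ((hu.differentiableOn (by simp)).differentiableAt (hσ.isOpen.mem_nhds hy₀))]
  rw [hzero, hx₀] at hmem hpiece
  exact ⟨S', _, ε, Γ, hmem, hpiece⟩

end TwistingPieces

section GeodesicEquation

open Filter Topology

variable {E : Type*} [NormedAddCommGroup E] [NormedSpace ℝ E]

theorem exists_equiv_prod_real [FiniteDimensional ℝ E] (hE : Module.finrank ℝ E = 2)
    (ℓ : E →L[ℝ] ℝ) {x w : E} (hx : ℓ x ≠ 0) (hw : ℓ w = 0) (hw₀ : w ≠ 0) :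
    ∃ e : (ℝ × ℝ) ≃L[ℝ] E, ∀ q, e q = q.1 • x + q.2 • w := by
  let T : ℝ × ℝ →ₗ[ℝ] E :=
    (LinearMap.fst ℝ ℝ ℝ).smulRight x + (LinearMap.snd ℝ ℝ ℝ).smulRight w
  have hT (q : ℝ × ℝ) : T q = q.1 • x + q.2 • w := rfl
  have hinj : Function.Injective T := by
    refine (injective_iff_map_eq_zero T).2 fun q hq => ?_
    rw [hT] at hq
    have hℓ : q.1 * ℓ x = 0 := by simpa [hw] using congrArg ℓ hq
    have hq₁ : q.1 = 0 := (mul_eq_zero.1 hℓ).resolve_right hx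
    rw [hq₁, zero_smul, zero_add] at hq
    exact Prod.ext hq₁ ((smul_eq_zero.1 hq).resolve_right hw₀)
  have hrank : Module.finrank ℝ (ℝ × ℝ) = Module.finrank ℝ E := by
    rw [hE, Module.finrank_prod, Module.finrank_self]
  exact ⟨(LinearEquiv.ofInjectiveOfFinrankEq T hinj hrank).toContinuousLinearEquiv, hT⟩

/-- The acceleration of a unit speed curve is orthogonal to the curve; its component along a normal
field `W` is, after differentiating `⟨W, v⟩ = 0`, the shape term `⟨∇_v W, v⟩` up to sign. -/
theorem geodesic_equation [FiniteDimensional ℝ E] (hE : Module.finrank ℝ E = 2)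
    {G : E → E →L[ℝ] E →L[ℝ] ℝ} {c v W : ℝ → E} {v' W' : E} {t : ℝ}
    (hG : DifferentiableAt ℝ G (c t)) (hsymm : ∀ z a b, G z a b = G z b a)
    (hc : HasDerivAt c (v t) t) (hv : HasDerivAt v v' t) (hW : HasDerivAt W W' t)
    (hunit : ∀ᶠ s in 𝓝 t, G (c s) (v s) (v s) = 1)
    (horth : ∀ᶠ s in 𝓝 t, G (c s) (W s) (v s) = 0) (hW₀ : G (c t) (W t) (W t) ≠ 0)
    (hshape : G (c t) W' (v t) + chris G (c t) (v t) (W t) (v t) = 0) (z : E) :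
    G (c t) v' z + chris G (c t) (v t) (v t) z = 0 := by
  have hs := fderiv_bilin_symm hG (Eventually.of_forall hsymm)
  have hunit' := (hasDerivAt_bilin hG hc hv hv).unique
    ((hasDerivAt_const t (1 : ℝ)).congr_of_eventuallyEq hunit)
  have horth' := (hasDerivAt_bilin hG hc hW hv).unique
    ((hasDerivAt_const t (0 : ℝ)).congr_of_eventuallyEq horth)
  have hv₀ : v t ≠ 0 := fun h => zero_ne_one (α := ℝ) <| by
    simpa [h] using hunit.self_of_nhds
  obtain ⟨e, he⟩ := exists_equiv_prod_real hE (G (c t) (W t)) hW₀ horth.self_of_nhds hv₀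
  obtain ⟨q, rfl⟩ := e.surjective z
  rw [hsymm _ (v t) v'] at hunit'
  rw [hsymm _ (W t) v', hs _ (W t) (v t)] at horth'
  rw [chris, hs _ (W t) (v t)] at hshape
  have hz (B : E →L[ℝ] ℝ) : B (e q) = q.1 * B (W t) + q.2 * B (v t) := by
    rw [he, map_add, map_smul, map_smul, smul_eq_mul, smul_eq_mul]
  have hz' (B : E →L[ℝ] E →L[ℝ] E →L[ℝ] ℝ) (a b : E) :
      B (e q) a b = q.1 * B (W t) a b + q.2 * B (v t) a b :=
    hz ((ContinuousLinearMap.apply ℝ ℝ b).comp ((ContinuousLinearMap.apply ℝ _ a).comp B))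
  rw [chris, hz, hz, hz', hs _ (v t) (v t)]
  linear_combination q.2 / 2 * hunit' + q.1 * horth' - q.1 * hshape

end GeodesicEquation

section Curves

open Filter Topology

variable {E : Type*} [NormedAddCommGroup E] [NormedSpace ℝ E] {H : Type*} [TopologicalSpace H]
  {I : ModelWithCorners ℝ E H} {P : Type*} [TopologicalSpace P] [ChartedSpace H P]

/-- The velocity of a curve, as a vector of the model space. -/
def modelVelocity (I : ModelWithCorners ℝ E H) (γ : ℝ → P) (t : ℝ) : E :=
  mfderiv 𝓘(ℝ, ℝ) I γ t (1 : ℝ)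

variable {γ : ℝ → P} {t : ℝ} {q : P}

theorem modelVelocity_comp {E' : Type*} [NormedAddCommGroup E'] [NormedSpace ℝ E'] {H' : Type*}
    [TopologicalSpace H'] {J : ModelWithCorners ℝ E' H'} {S : Type*} [TopologicalSpace S]
    [ChartedSpace H' S] {g : S → P} {x : ℝ → S} (hg : MDifferentiableAt J I g (x t))
    (hx : MDifferentiableAt 𝓘(ℝ, ℝ) J x t) :
    modelVelocity I (fun s => g (x s)) t
      = mfderiv J I g (x t) (modelVelocity (E := E') J x t) :=
  congrArg (fun A : ℝ →L[ℝ] E => A 1) (mfderiv_comp t hg hx)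

theorem hasDerivAt_modelVelocity {c : ℝ → E} (hc : DifferentiableAt ℝ c t) :
    HasDerivAt c (modelVelocity 𝓘(ℝ, E) c t) t := by
  have h : modelVelocity 𝓘(ℝ, E) c t = fderiv ℝ c t 1 :=
    congrArg (fun A : ℝ →L[ℝ] E => A 1) mfderiv_eq_fderiv
  exact h ▸ hc.hasFDerivAt.hasDerivAt

theorem hasDerivAt_extChartAt_comp [IsManifold I ∞ P] (hγ : MDifferentiableAt 𝓘(ℝ, ℝ) I γ t)
    (hq : γ t ∈ (extChartAt I q).source) :
    HasDerivAt (fun s => extChartAt I q (γ s)) (dchart I q (γ t) (modelVelocity I γ t)) t := by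
  have hchart : MDifferentiableAt I 𝓘(ℝ, E) (extChartAt I q) (γ t) :=
    (contMDiffAt_extChartAt_of_mem hq).mdifferentiableAt (by simp)
  exact (hasDerivAt_modelVelocity (hchart.comp t hγ).differentiableAt).congr_deriv
    (modelVelocity_comp hchart hγ)

theorem differentiableAt_dchart_modelVelocity [IsManifold I ∞ P]
    (hγ : ContMDiffAt 𝓘(ℝ, ℝ) I ∞ γ t) (hq : γ t ∈ (extChartAt I q).source) :
    DifferentiableAt ℝ (fun s => dchart I q (γ s) (modelVelocity I γ s)) t := by
  have hb : ContDiffAt ℝ ∞ (fun s => extChartAt I q (γ s)) t :=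
    contMDiffAt_iff_contDiffAt.1 ((contMDiffAt_extChartAt_of_mem hq).comp t hγ)
  have hderiv : DifferentiableAt ℝ (fderiv ℝ fun s => extChartAt I q (γ s)) t :=
    (hb.fderiv_right (m := 1) (WithTop.coe_le_coe.2 le_top)).differentiableAt (by simp)
  refine (hderiv.clm_apply (differentiableAt_const 1)).congr_of_eventuallyEq ?_
  have hγ' := (contMDiffAt_iff_contMDiffAt_nhds (n := 1) (by simp)).1 (hγ.of_le (by simp))
  filter_upwards [hγ', hγ.continuousAt.preimage_mem_nhds
    ((isOpen_extChartAt_source q).mem_nhds hq)] with s hs hsq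
  rw [fderiv_apply_one_eq_deriv,
    (hasDerivAt_extChartAt_comp (hs.mdifferentiableAt (by simp)) hsq).deriv]

end Curves

section RiemannianCurves

open Filter Topology

variable {n : ℕ} {M : Type*} [TopologicalSpace M] [ChartedSpace (EuclideanSpace ℝ (Fin n)) M]
  [IsManifold (𝓡 n) ∞ M] [RiemannianBundle (fun p : M => TangentSpace (𝓡 n) p)]

local notation "ℝⁿ" => EuclideanSpace ℝ (Fin n)

theorem covAlong_comp_curve {E' : Type*} [NormedAddCommGroup E'] [NormedSpace ℝ E'] {H' : Type*}
    [TopologicalSpace H'] {J : ModelWithCorners ℝ E' H'} {S : Type*} [TopologicalSpace S]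
    [ChartedSpace H' S] {g : S → M} {x : ℝ → S} {V : ∀ y : S, TangentSpace (𝓡 n) (g y)} {t : ℝ}
    (hV : ContMDiffAt J (𝓡 n).tangent ∞ (fun y => (⟨g y, V y⟩ : TangentBundle (𝓡 n) M)) (x t))
    (hg : MDifferentiableAt J (𝓡 n) g (x t)) (hx : MDifferentiableAt 𝓘(ℝ, ℝ) J x t) (z : ℝⁿ) :
    covAlong (𝓡 n) 𝓘(ℝ, ℝ) metric (fun s => g (x s)) (fun s => V (x s)) t (1 : ℝ) z
      = covAlong (𝓡 n) J metric g V (x t) (modelVelocity (E := E') J x t) z := by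
  have hgx : ContinuousAt (fun s => g (x s)) t := (hg.comp t hx).continuousAt
  have hV' := (contMDiffAt_dchart hV (mem_extChartAt_source (g (x t)))).mdifferentiableAt (by simp)
  have h₁ := modelVelocity_comp hV' hx
  have h₂ := modelVelocity_comp hg hx
  exact (covAlong_eq hgx metric _ z).trans <| (congrArg₂ (fun a b : ℝⁿ => metricForm (g (x t)) a z
    + christoffel (𝓡 n) metric (g (x t)) b (V (x t)) z) h₁ h₂).trans
    (covAlong_eq hg.continuousAt metric _ z).symm

variable [IsContMDiffRiemannianBundle (𝓡 n) ∞ (EuclideanSpace ℝ (Fin n))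
    (fun p : M => TangentSpace (𝓡 n) p)]
  {γ : ℝ → M} {W : ℝ → EuclideanSpace ℝ (Fin n)} {t : ℝ}

theorem covAlong_curve_eq (hγ : ContinuousAt γ t) {W' : ℝⁿ}
    (hW : HasDerivAt (fun s => dchart (𝓡 n) (γ t) (γ s) (W s)) W' t) (z : ℝⁿ) :
    covAlong (𝓡 n) 𝓘(ℝ, ℝ) metric γ W t (1 : ℝ) z
      = gram (γ t) (extChartAt (𝓡 n) (γ t) (γ t)) W' z
        + chris (gram (γ t)) (extChartAt (𝓡 n) (γ t) (γ t)) (modelVelocity (𝓡 n) γ t) (W t) z := by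
  have h := (hasDerivAt_modelVelocity hW.differentiableAt).unique hW
  rw [gram_self, ← christoffel_eq_chris, ← h]
  exact covAlong_eq hγ metric _ z

theorem covAlong_velocity_eq_zero (hn : n = 2) (hγ : ContMDiffAt 𝓘(ℝ, ℝ) (𝓡 n) ∞ γ t)
    (hW : DifferentiableAt ℝ (fun s => dchart (𝓡 n) (γ t) (γ s) (W s)) t)
    (hunit : ∀ᶠ s in 𝓝 t, metricForm (γ s) (modelVelocity (𝓡 n) γ s) (modelVelocity (𝓡 n) γ s) = 1)
    (horth : ∀ᶠ s in 𝓝 t, metricForm (γ s) (W s) (modelVelocity (𝓡 n) γ s) = 0)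
    (hW₀ : W t ≠ 0)
    (hshape : covAlong (𝓡 n) 𝓘(ℝ, ℝ) metric γ W t (1 : ℝ)
      (modelVelocity (E := ℝⁿ) (𝓡 n) γ t) = 0)
    (z : ℝⁿ) : covAlong (𝓡 n) 𝓘(ℝ, ℝ) metric γ (velocity γ) t (1 : ℝ) z = 0 := by
  have hsource : ∀ᶠ s in 𝓝 t, γ s ∈ (extChartAt (𝓡 n) (γ t)).source :=
    hγ.continuousAt.preimage_mem_nhds (extChartAt_source_mem_nhds (γ t))
  have hb := hasDerivAt_extChartAt_comp (hγ.mdifferentiableAt (by simp)) hsource.self_of_nhds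
  have hv := (differentiableAt_dchart_modelVelocity hγ hsource.self_of_nhds).hasDerivAt
  rw [covAlong_curve_eq hγ.continuousAt hW.hasDerivAt] at hshape
  refine (covAlong_curve_eq hγ.continuousAt hv z).trans ?_
  have hunit' : ∀ᶠ s in 𝓝 t, gram (γ t) (extChartAt (𝓡 n) (γ t) (γ s))
      (dchart (𝓡 n) (γ t) (γ s) (modelVelocity (𝓡 n) γ s))
      (dchart (𝓡 n) (γ t) (γ s) (modelVelocity (𝓡 n) γ s)) = 1 := by
    filter_upwards [hunit, hsource] with s hs hmem
    rw [gram_dchart hmem, hs]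
  have horth' : ∀ᶠ s in 𝓝 t, gram (γ t) (extChartAt (𝓡 n) (γ t) (γ s))
      (dchart (𝓡 n) (γ t) (γ s) (W s))
      (dchart (𝓡 n) (γ t) (γ s) (modelVelocity (𝓡 n) γ s)) = 0 := by
    filter_upwards [horth, hsource] with s hs hmem
    rw [gram_dchart hmem, hs]
  have key := geodesic_equation (by rw [finrank_euclideanSpace_fin, hn])
    (differentiableAt_gram (mem_extChartAt_target (γ t))) (gram_symm (γ t)) hb hv hW.hasDerivAt
    hunit' horth'
  simp only [dchart_self] at key
  exact key (gram_pos (mem_extChartAt_target (γ t)) hW₀).ne' hshape z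

end RiemannianCurves

section HorizontalCurves

open Filter Topology

variable {n : ℕ} {M : Type*} [TopologicalSpace M] [ChartedSpace (EuclideanSpace ℝ (Fin n)) M]
  [IsManifold (𝓡 n) ∞ M] [RiemannianBundle (fun p : M => TangentSpace (𝓡 n) p)]
  {S : Type*} [TopologicalSpace S] [ChartedSpace (EuclideanSpace ℝ (Fin n)) S] {f : S → M × ℝ}
  {N : ∀ x : S, TangentSpace ((𝓡 n).prod 𝓘(ℝ, ℝ)) (f x)}

local notation "ℝⁿ" => EuclideanSpace ℝ (Fin n)

namespace IsOrientedHypersurface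

theorem dheight_modelVelocity_eq_zero (hf : IsOrientedHypersurface f N) {x : ℝ → S} {t h₀ : ℝ}
    (hx : MDifferentiableAt 𝓘(ℝ, ℝ) (𝓡 n) x t) (hheight : ∀ᶠ s in 𝓝 t, height f (x s) = h₀) :
    dheight f (x t) (modelVelocity (E := ℝⁿ) (𝓡 n) x t) = 0 := by
  have hd : HasDerivAt (fun s => height f (x s)) 0 t :=
    (hasDerivAt_const t h₀).congr_of_eventuallyEq hheight
  have hξ : MDifferentiableAt (𝓡 n) 𝓘(ℝ, ℝ) (height f) (x t) :=
    (hf.contMDiff_height _).mdifferentiableAt (by simp)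
  exact (modelVelocity_comp hξ hx).symm.trans
    ((hasDerivAt_modelVelocity hd.differentiableAt).unique hd)

variable [IsContMDiffRiemannianBundle (𝓡 n) ∞ (EuclideanSpace ℝ (Fin n))
  (fun p : M => TangentSpace (𝓡 n) p)]

theorem isGeodesic_proj_comp (hf : IsOrientedHypersurface f N) (hN : ∀ x, angle f N x ^ 2 ≠ 1)
    (hgeod : TotallyGeodesicSections f N) (hn : n = 2) {x : ℝ → S} {δ h₀ : ℝ}
    (hx : ContMDiffOn 𝓘(ℝ, ℝ) (𝓡 n) ∞ x (Ioo (-δ) δ))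
    (hheight : ∀ t ∈ Ioo (-δ) δ, height f (x t) = h₀)
    (hunit : ∀ t ∈ Ioo (-δ) δ, metricForm (proj f (x t))
      (modelVelocity (𝓡 n) (fun s => proj f (x s)) t)
      (modelVelocity (𝓡 n) (fun s => proj f (x s)) t) = 1) :
    IsGeodesic (n := n) (fun t => proj f (x t)) δ := by
  have hI (t : ℝ) (ht : t ∈ Ioo (-δ) δ) : ∀ᶠ s in 𝓝 t, s ∈ Ioo (-δ) δ := isOpen_Ioo.mem_nhds ht
  have hxd (t : ℝ) (ht : t ∈ Ioo (-δ) δ) : MDifferentiableAt 𝓘(ℝ, ℝ) (𝓡 n) x t :=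
    (hx.contMDiffAt (hI t ht)).mdifferentiableAt (by simp)
  have hproj (s : S) : MDifferentiableAt (𝓡 n) (𝓡 n) (proj f) s :=
    (hf.contMDiff_proj s).mdifferentiableAt (by simp)
  have hhor (t : ℝ) (ht : t ∈ Ioo (-δ) δ) :
      dheight f (x t) (modelVelocity (E := ℝⁿ) (𝓡 n) x t) = 0 :=
    hf.dheight_modelVelocity_eq_zero (hxd t ht) ((hI t ht).mono hheight)
  have hvel (t : ℝ) (ht : t ∈ Ioo (-δ) δ) : modelVelocity (𝓡 n) (fun s => proj f (x s)) t
      = dproj f (x t) (modelVelocity (E := ℝⁿ) (𝓡 n) x t) := modelVelocity_comp (hproj _) (hxd t ht)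
  have hη := hf.contMDiff_unitNormalH hN
  refine ⟨hf.contMDiff_proj.comp_contMDiffOn hx, fun t ht h => zero_ne_one (α := ℝ) ?_,
    fun t ht => ?_⟩
  · rw [← hunit t ht, show modelVelocity (𝓡 n) (fun s => proj f (x s)) t = 0 from h, map_zero]
  · have hW := ((contMDiffAt_dchart (hη (x t)) (mem_extChartAt_source (proj f (x t)))).comp t
      (hx.contMDiffAt (hI t ht))).contDiffAt.differentiableAt (by simp)
    refine covAlong_velocity_eq_zero hn ((hf.contMDiff_proj _).comp t (hx.contMDiffAt (hI t ht)))
      (W := fun s => unitNormalH N (x s)) hW ((hI t ht).mono hunit)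
      ((hI t ht).mono fun s hs => ?_) (fun h => ?_) ?_
    · rw [hvel s hs, hf.metricForm_unitNormalH_dproj, hhor s hs, mul_zero]
    · have hone := hf.metricForm_unitNormalH (hN (x t))
      rw [h, map_zero] at hone
      exact zero_ne_one hone
    · have hshape := hgeod _ _ _ (hhor t ht) (hhor t ht)
      rw [sectionShapeForm_eq, neg_eq_zero] at hshape
      rw [hvel t ht]
      exact (covAlong_comp_curve (hη (x t)) (hproj _) (hxd t ht) _).trans hshape

end IsOrientedHypersurface

end HorizontalCurves

section Minimal

theorem chris_smul_smul {E : Type*} [NormedAddCommGroup E] [NormedSpace ℝ E]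
    (G : E → E →L[ℝ] E →L[ℝ] ℝ) (y : E) (a b : ℝ) (u w z : E) :
    chris G y (a • u) w (b • z) = a * b * chris G y u w z := by
  have hl (B : E →L[ℝ] E →L[ℝ] E →L[ℝ] ℝ) (v₁ v₂ : E) (r : ℝ) (v : E) :
      B (r • v) v₁ v₂ = r * B v v₁ v₂ :=
    ((ContinuousLinearMap.apply ℝ ℝ v₂).comp
      ((ContinuousLinearMap.apply ℝ _ v₁).comp B)).map_smul r v
  have hm (B : E →L[ℝ] E →L[ℝ] ℝ) (v₂ : E) (r : ℝ) (v : E) : B (r • v) v₂ = r * B v v₂ :=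
    ((ContinuousLinearMap.apply ℝ ℝ v₂).comp B).map_smul r v
  have hr (B : E →L[ℝ] ℝ) (r : ℝ) (v : E) : B (r • v) = r * B v := B.map_smul r v
  rw [chris, chris, hl, hr, hm, hr, hl, hm]
  ring

variable {n : ℕ} {M : Type*} [TopologicalSpace M] [ChartedSpace (EuclideanSpace ℝ (Fin n)) M]
  [IsManifold (𝓡 n) ∞ M] [RiemannianBundle (fun p : M => TangentSpace (𝓡 n) p)]
  [IsContMDiffRiemannianBundle (𝓡 n) ∞ (EuclideanSpace ℝ (Fin n))
    (fun p : M => TangentSpace (𝓡 n) p)]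
  {S : Type*} [TopologicalSpace S] [ChartedSpace (EuclideanSpace ℝ (Fin n)) S]

local notation "ℝⁿ" => EuclideanSpace ℝ (Fin n)

theorem covAlong_smul_smul {g : S → M} {V : S → ℝⁿ} {x : S} (hg : ContinuousAt g x)
    (a b : ℝ) (v z : ℝⁿ) : covAlong (𝓡 n) (𝓡 n) metric g V x (a • v) (b • z)
      = a * b * covAlong (𝓡 n) (𝓡 n) metric g V x v z := by
  have h (D₁ D₂ : ℝⁿ →L[ℝ] ℝⁿ) : metricForm (g x) (D₁ (a • v)) (b • z)
      + christoffel (𝓡 n) metric (g x) (D₂ (a • v)) (V x) (b • z)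
      = a * b * (metricForm (g x) (D₁ v) z + christoffel (𝓡 n) metric (g x) (D₂ v) (V x) z) := by
    rw [christoffel_eq_chris, christoffel_eq_chris, D₂.map_smul, chris_smul_smul, D₁.map_smul,
      map_smul, map_smul, LinearMap.smul_apply, smul_eq_mul, smul_eq_mul]
    ring
  exact (covAlong_eq hg metric _ _).trans
    ((h _ _).trans (congrArg (a * b * ·) (covAlong_eq hg metric _ _).symm))

namespace IsOrientedHypersurface

theorem sectionShapeForm_smul_smul {f : S → M × ℝ}
    {N : ∀ x : S, TangentSpace ((𝓡 n).prod 𝓘(ℝ, ℝ)) (f x)} (hf : IsOrientedHypersurface f N)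
    (x : S) (a b : ℝ) (v w : ℝⁿ) :
    sectionShapeForm f N x (a • v) (b • w) = a * b * sectionShapeForm f N x v w := by
  rw [sectionShapeForm_eq, sectionShapeForm_eq, (dproj f x).map_smul,
    covAlong_smul_smul (hf.contMDiff_proj x).continuousAt, mul_neg]

end IsOrientedHypersurface

end Minimal

section Surface

variable {M : Type*} [TopologicalSpace M] [ChartedSpace (EuclideanSpace ℝ (Fin 2)) M]
  [IsManifold (𝓡 2) ∞ M] [RiemannianBundle (fun p : M => TangentSpace (𝓡 2) p)]
  {S : Type*} [TopologicalSpace S] [ChartedSpace (EuclideanSpace ℝ (Fin 2)) S] {f : S → M × ℝ}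
  {N : ∀ x : S, TangentSpace ((𝓡 2).prod 𝓘(ℝ, ℝ)) (f x)}

local notation "ℝ²" => EuclideanSpace ℝ (Fin 2)

namespace IsOrientedHypersurface

theorem exists_eq_smul_of_dheight_eq_zero (hf : IsOrientedHypersurface f N) {x : S}
    (hN : angle f N x ^ 2 ≠ 1) (hθ : angle f N x ≠ 0) {v w : ℝ²} (hv₀ : v ≠ 0)
    (hv : dheight f x v = 0) (hw : dheight f x w = 0) : ∃ b : ℝ, w = b • v := by
  let ℓ : ℝ² →L[ℝ] ℝ := LinearMap.toContinuousLinearMap (metricForm (proj f x) (unitNormalH N x))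
  have hℓ (u : ℝ²) : ℓ (dproj f x u) = slope (angle f N x) * dheight f x u :=
    hf.metricForm_unitNormalH_dproj x u
  have hη : ℓ (unitNormalH N x) = 1 := hf.metricForm_unitNormalH hN
  obtain ⟨e, he⟩ := exists_equiv_prod_real finrank_euclideanSpace_fin ℓ (hη ▸ one_ne_zero)
    (by rw [hℓ, hv, mul_zero])
    ((map_ne_zero_iff (dproj f x) (hf.dproj_injective hθ)).2 hv₀)
  obtain ⟨q, hq⟩ := e.surjective (dproj f x w)
  rw [he] at hq
  have hq₁ : q.1 = 0 := by
    have h := congrArg ℓ hq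
    rwa [map_add, map_smul, map_smul, hη, hℓ, hℓ, hv, hw, mul_zero, smul_zero, add_zero,
      smul_eq_mul, mul_one] at h
  rw [hq₁, zero_smul, zero_add, ← map_smul] at hq
  exact ⟨q.2, (hf.dproj_injective hθ hq).symm⟩

variable [IsContMDiffRiemannianBundle (𝓡 2) ∞ (EuclideanSpace ℝ (Fin 2))
    (fun p : M => TangentSpace (𝓡 2) p)]

theorem sectionShapeForm_self_eq_zero_of_minimalSections (hf : IsOrientedHypersurface f N)
    (hmin : MinimalSections f N) {x : S} (hθ : angle f N x ≠ 0) {v : ℝ²} (hv₀ : v ≠ 0)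
    (hv : dheight f x v = 0) : sectionShapeForm f N x v v = 0 := by
  set κ := metricForm (proj f x) (dproj f x v) (dproj f x v) with hκ
  have hκ_pos : 0 < κ :=
    metricForm_pos _ ((map_ne_zero_iff (dproj f x) (hf.dproj_injective hθ)).2 hv₀)
  set e : ℝ² := (√κ)⁻¹ • v with he
  have hde : dheight f x e = 0 :=
    (map_smul (mfderiv (𝓡 2) 𝓘(ℝ, ℝ) (height f) x) _ _).trans
      ((congrArg ((√κ)⁻¹ * ·) hv).trans (mul_zero _))
  have hunit : prodMetric (f x) (mfderiv (𝓡 2) ((𝓡 2).prod 𝓘(ℝ, ℝ)) f x e)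
      (mfderiv (𝓡 2) ((𝓡 2).prod 𝓘(ℝ, ℝ)) f x e) = 1 := by
    rw [hf.prodMetric_mfderiv, hde, mul_zero, add_zero, he, map_smul, map_smul, map_smul,
      LinearMap.smul_apply, ← hκ, smul_eq_mul, smul_eq_mul, ← mul_assoc, ← mul_inv,
      Real.mul_self_sqrt hκ_pos.le, inv_mul_cancel₀ hκ_pos.ne']
  have htrace := hmin x (fun _ => e) (fun _ => hde) fun i j => by
    rw [if_pos (Subsingleton.elim (α := Fin 1) i j), hunit]
  have hform : sectionShapeForm f N x e e = 0 := (Fin.sum_univ_one _).symm.trans htrace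
  rw [he, hf.sectionShapeForm_smul_smul] at hform
  have hsqrt : (√κ)⁻¹ ≠ 0 := inv_ne_zero (Real.sqrt_pos.2 hκ_pos).ne'
  exact (mul_eq_zero.1 hform).resolve_left (mul_ne_zero hsqrt hsqrt)

theorem totallyGeodesicSections_of_minimalSections (hf : IsOrientedHypersurface f N)
    (hN : ∀ x, angle f N x ^ 2 ≠ 1) (hθ : ∀ x, angle f N x ≠ 0) (hmin : MinimalSections f N) :
    TotallyGeodesicSections f N := by
  intro x (v : ℝ²) (w : ℝ²) hv hw
  by_cases hv₀ : v = 0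
  · have h := hf.sectionShapeForm_smul_smul x 0 1 v w
    rwa [zero_smul, one_smul, zero_mul, zero_mul, ← hv₀] at h
  · obtain ⟨b, rfl⟩ := hf.exists_eq_smul_of_dheight_eq_zero (hN x) (hθ x) hv₀ hv hw
    have h := hf.sectionShapeForm_smul_smul x 1 b v v
    rwa [one_smul, hf.sectionShapeForm_self_eq_zero_of_minimalSections hmin (hθ x) hv₀ hv,
      mul_zero] at h

end IsOrientedHypersurface

end Surface

section LevelCurves

open Metric

local notation "ℝ²" => EuclideanSpace ℝ (Fin 2)

/-- The dual vector of a linear form on the plane, rotated by a right angle; it spans the kernel of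
a nonzero form. -/
def rotatedDual : (ℝ² →L[ℝ] ℝ) →ₗ[ℝ] ℝ² where
  toFun ℓ := !₂[-ℓ (EuclideanSpace.single 1 1), ℓ (EuclideanSpace.single 0 1)]
  map_add' ℓ ℓ' := by
    ext i
    fin_cases i <;> simp [add_comm]
  map_smul' r ℓ := by
    ext i
    fin_cases i <;> simp

theorem apply_eq_sum_single (ℓ : ℝ² →L[ℝ] ℝ) (v : ℝ²) :
    ℓ v = v 0 * ℓ (EuclideanSpace.single 0 1) + v 1 * ℓ (EuclideanSpace.single 1 1) := by
  have h : v = v 0 • EuclideanSpace.single 0 (1 : ℝ) + v 1 • EuclideanSpace.single 1 (1 : ℝ) := by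
    ext i
    fin_cases i <;> simp
  conv_lhs => rw [h, map_add, map_smul, map_smul, smul_eq_mul, smul_eq_mul]

theorem apply_rotatedDual (ℓ : ℝ² →L[ℝ] ℝ) : ℓ (rotatedDual ℓ) = 0 := by
  rw [apply_eq_sum_single, show rotatedDual ℓ 0 = -ℓ (EuclideanSpace.single 1 1) from rfl,
    show rotatedDual ℓ 1 = ℓ (EuclideanSpace.single 0 1) from rfl]
  ring

theorem rotatedDual_ne_zero {ℓ : ℝ² →L[ℝ] ℝ} (hℓ : ℓ ≠ 0) : rotatedDual ℓ ≠ 0 := by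
  refine fun h => hℓ (ContinuousLinearMap.ext fun v => ?_)
  have h₀ : -ℓ (EuclideanSpace.single 1 1) = 0 := congrArg (fun w : ℝ² => w 0) h
  have h₁ : ℓ (EuclideanSpace.single 0 1) = 0 := congrArg (fun w : ℝ² => w 1) h
  rw [apply_eq_sum_single, neg_eq_zero.1 h₀, h₁, mul_zero, mul_zero, add_zero, zero_apply]

variable {U : Set (EuclideanSpace ℝ (Fin 2))} {u : EuclideanSpace ℝ (Fin 2) → ℝ}
  {G : EuclideanSpace ℝ (Fin 2) →
    EuclideanSpace ℝ (Fin 2) →L[ℝ] EuclideanSpace ℝ (Fin 2) →L[ℝ] ℝ}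

theorem exists_unit_field_tangent_level (hU : IsOpen U) (hu : ContDiffOn ℝ ∞ u U)
    (hdu : ∀ y ∈ U, fderiv ℝ u y ≠ 0) (hG : ContDiffOn ℝ ∞ G U)
    (hG_pos : ∀ y ∈ U, ∀ v ≠ 0, 0 < G y v v) :
    ∃ T : ℝ² → ℝ², ContDiffOn ℝ ∞ T U ∧ (∀ y, fderiv ℝ u y (T y) = 0) ∧
      ∀ y ∈ U, G y (T y) (T y) = 1 := by
  set k : ℝ² → ℝ² := fun y => rotatedDual (fderiv ℝ u y)
  have hk_smooth : ContDiffOn ℝ ∞ k U :=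
    (LinearMap.toContinuousLinearMap rotatedDual).contDiff.comp_contDiffOn
      (hu.fderiv_of_isOpen hU (by simp))
  set κ : ℝ² → ℝ := fun y => G y (k y) (k y)
  have hκ_smooth : ContDiffOn ℝ ∞ κ U := (hG.clm_apply hk_smooth).clm_apply hk_smooth
  have hκ_pos (y : ℝ²) (hy : y ∈ U) : 0 < κ y := hG_pos y hy _ (rotatedDual_ne_zero (hdu y hy))
  refine ⟨fun y => (√(κ y))⁻¹ • k y, ?_, fun y => ?_, fun y hy => ?_⟩
  · exact ((hκ_smooth.sqrt fun y hy => (hκ_pos y hy).ne').inv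
      fun y hy => (Real.sqrt_pos.2 (hκ_pos y hy)).ne').smul hk_smooth
  · rw [map_smul, apply_rotatedDual, smul_zero]
  · rw [map_smul, map_smul, smul_apply, smul_eq_mul, smul_eq_mul, ← mul_assoc, ← mul_inv,
      Real.mul_self_sqrt (hκ_pos y hy).le, inv_mul_cancel₀ (hκ_pos y hy).ne']

theorem exists_unit_speed_levelCurve (hU : IsOpen U) (hu : ContDiffOn ℝ ∞ u U)
    (hdu : ∀ y ∈ U, fderiv ℝ u y ≠ 0) (hG : ContDiffOn ℝ ∞ G U)
    (hG_pos : ∀ y ∈ U, ∀ v ≠ 0, 0 < G y v v) {y₀ : ℝ²} (hy₀ : y₀ ∈ U) :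
    ∃ a > 0, ∃ c : ℝ → ℝ², ContDiffOn ℝ ∞ c (Ioo (-a) a) ∧ c 0 = y₀ ∧
      ∀ t ∈ Ioo (-a) a, c t ∈ U ∧ u (c t) = u y₀ ∧ fderiv ℝ u (c t) (deriv c t) = 0 ∧
        G (c t) (deriv c t) (deriv c t) = 1 := by
  obtain ⟨T, hT, hTu, hTG⟩ := exists_unit_field_tangent_level hU hu hdu hG hG_pos
  obtain ⟨V, hVU, hV, -, -, a, ha, r, hr, Fl, hFl⟩ := exists_isLocalFlow hU hT hy₀
  have hy₀r : y₀ ∈ ball y₀ r := mem_ball_self hr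
  refine ⟨a, ha, fun t => Fl t y₀, ?_, hFl.zero y₀ hy₀r, fun t ht => ?_⟩
  · exact hFl.smooth.comp (contDiffOn_id.prodMk contDiffOn_const) fun t ht => ⟨ht, hy₀r⟩
  · have hmem := hVU (hFl.mem y₀ hy₀r t ht)
    have hu_eq := hFl.apply_eq_add_mul hV ((hu.mono hVU).differentiableOn (by simp))
      (fun y _ => hTu y) hy₀r ht
    rw [zero_mul, add_zero] at hu_eq
    rw [(hFl.hasDerivAt y₀ hy₀r t ht).deriv]
    exact ⟨hmem, hu_eq, hTu _, hTG _ hmem⟩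

end LevelCurves

section GeodesicPieces

open Metric Filter Topology

section Curves

variable {n : ℕ} {M : Type*} [TopologicalSpace M] [ChartedSpace (EuclideanSpace ℝ (Fin n)) M]
  [IsManifold (𝓡 n) ∞ M] [RiemannianBundle (fun p : M => TangentSpace (𝓡 n) p)]
  {S : Type*} [TopologicalSpace S] [ChartedSpace (EuclideanSpace ℝ (Fin n)) S] {f : S → M × ℝ}

local notation "ℝⁿ" => EuclideanSpace ℝ (Fin n)

theorem IsLocalSection.gram_deriv {p₀ : M} {U : Set ℝⁿ} {σ : ℝⁿ → S} {c : ℝ → ℝⁿ} {t : ℝ}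
    (hσ : IsLocalSection f p₀ U σ) (hproj : ContMDiff (𝓡 n) (𝓡 n) ∞ (proj f))
    (hc : DifferentiableAt ℝ c t) (ht : c t ∈ U) :
    gram p₀ (c t) (deriv c t) (deriv c t)
      = metricForm (proj f (σ (c t))) (modelVelocity (𝓡 n) (fun s => proj f (σ (c s))) t)
        (modelVelocity (𝓡 n) (fun s => proj f (σ (c s))) t) := by
  have hcurve : MDifferentiableAt 𝓘(ℝ, ℝ) (𝓡 n) (fun s => proj f (σ (c s))) t :=
    ((hproj _).comp _ (hσ.contMDiffAt ht)).mdifferentiableAt (by simp) |>.comp t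
      hc.mdifferentiableAt
  have hmem := hσ.proj_mem ht
  have hchart : (fun s => extChartAt (𝓡 n) p₀ (proj f (σ (c s)))) =ᶠ[𝓝 t] c := by
    filter_upwards [hc.continuousAt.preimage_mem_nhds (hσ.isOpen.mem_nhds ht)] with s hs
    exact hσ.chart_proj hs
  rw [← gram_dchart hmem, hσ.chart_proj ht, ← (hasDerivAt_extChartAt_comp hcurve hmem).deriv,
    hchart.deriv_eq]

end Curves

variable {M : Type*} [TopologicalSpace M] [ChartedSpace (EuclideanSpace ℝ (Fin 2)) M]
  [IsManifold (𝓡 2) ∞ M] [RiemannianBundle (fun p : M => TangentSpace (𝓡 2) p)]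
  [IsContMDiffRiemannianBundle (𝓡 2) ∞ (EuclideanSpace ℝ (Fin 2))
    (fun p : M => TangentSpace (𝓡 2) p)]
  {S : Type*} [TopologicalSpace S] [ChartedSpace (EuclideanSpace ℝ (Fin 2)) S] {f : S → M × ℝ}
  {N : ∀ x : S, TangentSpace ((𝓡 2).prod 𝓘(ℝ, ℝ)) (f x)}

local notation "ℝ²" => EuclideanSpace ℝ (Fin 2)

theorem IsLocalSection.exists_isTwistingPiece_geodesic (hf : IsOrientedHypersurface f N)
    (hN : ∀ x, angle f N x ^ 2 ≠ 1) (hθ : ∀ x, angle f N x ≠ 0)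
    (hA : ∀ (x : S) (v : ℝ²), IsHeightGradient f x v →
      shapeForm ((𝓡 2).prod 𝓘(ℝ, ℝ)) (𝓡 2) prodMetric f N x v v = 0)
    (hgeod : TotallyGeodesicSections f N) {p₀ : M} {U : Set ℝ²} {σ : ℝ² → S}
    (hσ : IsLocalSection f p₀ U σ) (hopen : ∀ V ⊆ U, IsOpen V → IsOpen (σ '' V)) {y₀ : ℝ²}
    (hy₀ : y₀ ∈ U) :
    ∃ (S' : Set S) (L : Set M) (ε : ℝ) (Γ : ℝ → M → M), σ y₀ ∈ S' ∧
      IsTwistingPiece (n := 2) f S' (height f (σ y₀)) L ε Γ ∧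
      ∃ (γ : ℝ → M) (δ : ℝ), 0 < δ ∧ IsGeodesic (n := 2) γ δ ∧ L = γ '' Ioo (-δ) δ := by
  set u : ℝ² → ℝ := fun y => height f (σ y)
  have huX : ∀ y ∈ U, fderiv ℝ u y (chartField f p₀ σ (killing N) y) = 1 := fun y hy =>
    hσ.fderiv_height_killing hf hy (hN _) (hθ _)
  have hdu : ∀ y ∈ U, fderiv ℝ u y ≠ 0 := fun y hy h => zero_ne_one (α := ℝ) <| by
    rw [← huX y hy, h, zero_apply]
  obtain ⟨a, ha, c, hc, rfl, hlevel⟩ := exists_unit_speed_levelCurve hσ.isOpen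
    (hσ.contDiffOn_comp hf.contMDiff_height) hdu ((contDiffOn_gram p₀).mono hσ.subset)
    (fun y hy v hv => gram_pos (hσ.subset hy) hv) hy₀
  have hball (r : ℝ) : ball (0 : ℝ) r = Ioo (-r) r := by
    rw [Real.ball_eq_Ioo, zero_sub, zero_add]
  obtain ⟨-, -, hdu₀, hunit₀⟩ := hlevel 0 ⟨neg_lt_zero.2 ha, ha⟩
  have hdc₀ : deriv c 0 ≠ 0 := fun h => zero_ne_one (α := ℝ) <| by
    rw [← hunit₀, h, map_zero]
  obtain ⟨e, he⟩ := exists_equiv_prod_real finrank_euclideanSpace_fin _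
    (ne_of_eq_of_ne (huX _ hy₀) one_ne_zero) hdu₀ hdc₀
  obtain ⟨S', ε, Γ, hεa, hmem, hpiece⟩ := hσ.exists_isTwistingPiece hf hN hθ hA hgeod hopen ha
    (hball a ▸ hc) hy₀ (fun t ht => (hlevel t (hball a ▸ ht)).2.1) e fun q => by
      rw [he, fderiv_eq_smul_deriv]
  have hsub : Ioo (-ε) ε ⊆ Ioo (-a) a := Ioo_subset_Ioo (neg_le_neg hεa) hεa
  have hcU : MapsTo c (Ioo (-ε) ε) U := fun t ht => (hlevel t (hsub ht)).1
  refine ⟨S', _, ε, Γ, hmem, hpiece, fun t => proj f (σ (c t)), ε, hpiece.eps_pos,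
    hf.isGeodesic_proj_comp hN hgeod rfl (hσ.smooth.comp (hc.mono hsub).contMDiffOn hcU)
      (fun t ht => (hlevel t (hsub ht)).2.1) fun t ht => ?_, ?_⟩
  · rw [← hσ.gram_deriv hf.contMDiff_proj
      ((hc.differentiableOn (by simp)).differentiableAt (isOpen_Ioo.mem_nhds (hsub ht))) (hcU ht)]
    exact (hlevel t (hsub ht)).2.2.2
  · rw [hball, image_image]
    exact image_congr fun t ht => (hσ.proj_eq _ (hcU ht)).symm

end GeodesicPieces

theorem _root_.mainTheorem4_general {n : ℕ} {M : Type*} [TopologicalSpace M]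
    [ChartedSpace (EuclideanSpace ℝ (Fin n)) M] [IsManifold (𝓡 n) ∞ M]
    [RiemannianBundle (fun p : M => TangentSpace (𝓡 n) p)]
    [IsContMDiffRiemannianBundle (𝓡 n) ∞ (EuclideanSpace ℝ (Fin n))
      (fun p : M => TangentSpace (𝓡 n) p)]
    {S : Type*} [TopologicalSpace S] [ChartedSpace (EuclideanSpace ℝ (Fin n)) S]
    [IsManifold (𝓡 n) ∞ S] {f : S → M × ℝ}
    {N : ∀ x : S, TangentSpace ((𝓡 n).prod 𝓘(ℝ, ℝ)) (f x)} (hf : IsOrientedHypersurface f N)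
    (hN : ∀ x, angle f N x ^ 2 ≠ 1) (hθ : ∀ x, angle f N x ≠ 0)
    (hA : ∀ (x : S) (v : TangentSpace (𝓡 n) x), IsHeightGradient f x v →
      shapeForm ((𝓡 n).prod 𝓘(ℝ, ℝ)) (𝓡 n) prodMetric f N x v v = 0) :
    (TotallyGeodesicSections f N →
      ∀ x₀ : S, ∃ (S' : Set S) (L : Set M) (ε : ℝ) (Γ : ℝ → M → M), x₀ ∈ S' ∧
        IsTwistingPiece (n := n) f S' (height f x₀) L ε Γ) ∧
    (n = 2 → MinimalSections f N →
      ∀ x₀ : S, ∃ (S' : Set S) (L : Set M) (ε : ℝ) (Γ : ℝ → M → M), x₀ ∈ S' ∧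
        IsTwistingPiece (n := n) f S' (height f x₀) L ε Γ ∧
        ∃ (γ : ℝ → M) (δ : ℝ), 0 < δ ∧ IsGeodesic (n := n) γ δ ∧ L = γ '' Ioo (-δ) δ) := by
  refine ⟨exists_isTwistingPiece_of_totallyGeodesic hf hN hθ hA, ?_⟩
  rintro rfl hmin x₀
  obtain ⟨U, σ, hσ, hy₀, hx₀, hopen⟩ :=
    exists_isLocalSection hf.contMDiff_proj (hf.dproj_injective (hθ x₀))
  have h := hσ.exists_isTwistingPiece_geodesic hf hN hθ hA
    (hf.totallyGeodesicSections_of_minimalSections hN hθ hmin) hopen hy₀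
  rwa [hx₀] at h

end VerticalHelicoid

end

theorem mainTheorem4 {n : ℕ} (hn : 2 ≤ n)
    {M : Type*} [TopologicalSpace M] [T2Space M] [ChartedSpace (EuclideanSpace ℝ (Fin n)) M]
    [IsManifold (𝓡 n) ∞ M] [RiemannianBundle (fun p : M => TangentSpace (𝓡 n) p)]
    [IsContMDiffRiemannianBundle (𝓡 n) ∞ (EuclideanSpace ℝ (Fin n))
      (fun p : M => TangentSpace (𝓡 n) p)]
    {S : Type*} [TopologicalSpace S] [T2Space S] [ChartedSpace (EuclideanSpace ℝ (Fin n)) S]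
    [IsManifold (𝓡 n) ∞ S]
    (f : S → M × ℝ) (N : ∀ x : S, TangentSpace ((𝓡 n).prod 𝓘(ℝ, ℝ)) (f x))
    (hf : VerticalHelicoid.IsVerticalHelicoid f N)
    (hθ : ∀ x, VerticalHelicoid.angle f N x ≠ 0) :
    (VerticalHelicoid.TotallyGeodesicSections f N →
      ∀ x₀ : S, ∃ (S' : Set S) (L : Set M) (ε : ℝ) (Γ : ℝ → M → M), x₀ ∈ S' ∧
        VerticalHelicoid.IsTwistingPiece (n := n) f S' (VerticalHelicoid.height f x₀) L ε Γ) ∧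
    (n = 2 →
      ∀ x₀ : S, ∃ (S' : Set S) (L : Set M) (ε : ℝ) (Γ : ℝ → M → M), x₀ ∈ S' ∧
        VerticalHelicoid.IsTwistingPiece (n := n) f S' (VerticalHelicoid.height f x₀) L ε Γ ∧
        ∃ (γ : ℝ → M) (δ : ℝ), 0 < δ ∧ VerticalHelicoid.IsGeodesic (n := n) γ δ ∧
          L = γ '' Ioo (-δ) δ) :=
  (mainTheorem4_general hf.hypersurface hf.no_horizontal_point hθ
    hf.asymptotic).imp_right fun h hn₂ => h hn₂ hf.minimal_sections
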